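/- All graphs are finite and simple; $|G|$ is the number of vertices of $G$, $\omega(G)$ its clique number and $\#\omega(G)$ the number of its (nonempty, not necessarily maximal) cliques. Graph classes, and parameterized graph problems $\Pi$ (sets of pairs $(G,k)$ with $k\in\mathbb N$; no pair with $k<0$ is in $\Pi$), are closed under isomorphism. $\Pi_{\mathcal G}=\{(G,k)\in\Pi : G\in\mathcal G\}$. **Definitions.** For $W\subseteq V(G)$ let $\partial_G(W)$ be the set of vertices of $W$ with a neighbor outside $W$, and $N(W)$ the set of vertices outside $W$ with a neighbor in $W$. $W$ is a *$b$-protrusion* if $|\partial_G(W)|\le b$ and $\mathrm{tw}(G[W])\le b-1$. A partition $V(G)=Y_0\uplus\dots\uplus Y_\ell$ is an *$(\alpha,b)$-protrusion decomposition* if $\max\{\ell,|Y_0|\}\le\alpha$ and, for $1\le i\le\ell$, $N(Y_i)\subseteq Y_0$ and $Y_i\cup N(Y_i)$ is a $b$-protrusion. A *$b$-boundaried graph* is a graph with $b$ distinct vertices labeled $1,\dots,b$; $A\oplus B$ is the disjoint union of $A$ and $B$ with equally labeled vertices identified; $\mathcal G_b$ is the set of $b$-boundaried graphs whose graph is in $\mathcal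 G$. For $A,B\in\mathcal G_b$ write $A\equiv_b B$ with shift $\Delta(A,B)=\delta\in\mathbb Z$ if for all $b$-boundaried $F$ and all $k\in\mathbb Z$: $A\oplus F\in\mathcal G\iff B\oplus F\in\mathcal G$, and $(A\oplus F,k)\in\Pi\iff(B\oplus F,k+\delta)\in\Pi$. $\Pi$ has *finite integer index (FII) on $\mathcal G$* if $\equiv_b$ has finitely many classes on $\mathcal G_b$ for every $b$. A *family of representatives* consists of finite sets $\mathcal R_b\subseteq\mathcal G_b$ ($b\in\mathbb N$) such that every $B\in\mathcal G_b$ satisfies $A\equiv_b B$ with a shift $\Delta(A,B)\ge 0$ for some $A\in\mathcal R_b$. Its *protrusion limit* is $\mathrm{prot}(b)=\max_{A\in\mathcal R_b}|A|$ (and $b$ if $\mathcal R_b=\emptyset$), and $\mathrm{prot}'(b)=\mathrm{prot}(2b)$. A graph is *reduced* for boundary size $b$ if it has no $b$-protrusion with more than $\mathrm{prot}'(b)$ vertices. $\Pi$ is *$(s,t)$-treewidth-bounding on $\mathcal G$* if every $(G,k)\in\Pi_{\mathcal G}$ has a set $X\subseteq V(G)$ with $|X|\le s(k)$ and $\mathrm{tw}(G-X)\le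 t-1$. Let $\mathcal P$ be a set of paths in $G$, the two endpoints of each being distinct and non-adjacent in $G$, any two of which share at most one vertex, which must be an endpoint of both. The *constriction* $G|_{\mathcal P}$ is obtained by joining the endpoints of each path by an edge and deleting all inner vertices of the paths. $\mathcal G$ *$d$-constricts into* $\mathcal H$ if $G'|_{\mathcal P}\in\mathcal H$ for all $G\in\mathcal G$, $G'\subseteq G$ and such sets $\mathcal P$ of paths of $G'$ with at most $d$ vertices each. **Theorem.** Let $\mathcal G,\mathcal H$ be graph classes closed under taking subgraphs. Let $f_E,f_{\#\omega}\colon\mathbb N\to\mathbb N$ and $\omega_{\mathcal H}\in\mathbb N$ be such that every $H\in\mathcal H$ satisfies $$|E(H)|\le f_E(|H|),\qquad \#\omega(H)\le f_{\#\omega}(|H|),\qquad \omega(H)<\omega_{\mathcal H}.$$ Let $\Pi$ be a parameterized graph problem that has FII and is $(s,t)$-treewidth-bounding, both on $\mathcal G$. Put $x_k:=s(k)+2t\cdot f_E(s(k))$ and $\beta:=2t+\omega_{\mathcal H}$. Then families of representatives exist, and for each of them, with its protrusion limit, the following holds. Assume that $\mathcal G$ $d$-constricts into $\mathcal H$ for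 some constant $d\ge 2\,\mathrm{prot}'(\beta)+2$. 1. For every $(G,k)\in\Pi_{\mathcal G}$ that is reduced for boundary size $\beta$, there is a $(\max\{\ell,|Y_0|\},\beta)$-protrusion decomposition $V(G)=Y_0\uplus Y_1\uplus\dots\uplus Y_\ell$ with $|Y_0|\le x_k$, with $|Y_i|\le\mathrm{prot}'(\beta)$ for $1\le i\le\ell$, and with $\ell\le f_{\#\omega}(x_k)+x_k+1$. 2. Let $g(k):=x_k+(f_{\#\omega}(x_k)+x_k+1)\,\mathrm{prot}'(\beta)$. If $g$ is nondecreasing and the relation $n\le g(k)$ is decidable in time polynomial in $n+k$, then $\Pi$ restricted to $\mathcal G$ admits a kernel of size at most $g(k)$: there is an algorithm which, given $(G,k)$ with $G\in\mathcal G$ and $k\in\mathbb N$, outputs in time polynomial in $|G|+k$ an instance $(G',k')$ with $(G,k)\in\Pi_{\mathcal G}\iff(G',k')\in\Pi_{\mathcal G}$, $|G'|\le g(k)$ and $k'\le k$. (The algorithm may depend on all fixed data, e.g. on $\Pi$, $\mathcal G$ and the representatives.) -/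

import Mathlib

/-! Graph classes and parameterized graph problems.  All graphs are finite and simple. -/

/-- A class of finite graphs, closed under isomorphism. -/
structure GraphClass where
  mem : ∀ {V : Type} [Finite V], SimpleGraph V → Prop
  mem_of_iso : ∀ {V W : Type} [Finite V] [Finite W] {G : SimpleGraph V} {H : SimpleGraph W},
    (G ≃g H) → mem G → mem H

/-- The class is closed under taking (not necessarily induced) subgraphs. -/
def GraphClass.SubgraphClosed (C : GraphClass) : Prop :=
  ∀ {V W : Type} [Finite V] [Finite W] (G : SimpleGraph V) (H : SimpleGraph W),
    H.IsContained G → C.mem G → C.mem H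

/-- A parameterized graph problem: an isomorphism-invariant set of pairs `(G, k)`, `k ∈ ℕ`. -/
structure GraphProblem where
  mem : ∀ {V : Type} [Finite V], SimpleGraph V → ℕ → Prop
  mem_of_iso : ∀ {V W : Type} [Finite V] [Finite W] {G : SimpleGraph V} {H : SimpleGraph W}
    {k : ℕ}, (G ≃g H) → mem G k → mem H k

/-- `(G, k) ∈ Π` for an integer `k`; pairs with a negative `k` never belong to `Π`. -/
def GraphProblem.memInt (P : GraphProblem) {V : Type} [Finite V] (G : SimpleGraph V) (k : ℤ) :
    Prop :=
  ∃ m : ℕ, (m : ℤ) = k ∧ P.mem G m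

/-- The restriction `Π_𝒢` of a problem to a graph class. -/
def GraphProblem.restrict (P : GraphProblem) (C : GraphClass) : GraphProblem where
  mem G k := C.mem G ∧ P.mem G k
  mem_of_iso e h := ⟨C.mem_of_iso e h.1, P.mem_of_iso e h.2⟩

/-! Treewidth and protrusions. -/

structure TreeDecomp {V : Type} (G : SimpleGraph V) where
  Node : Type
  finite_node : Finite Node
  tree : SimpleGraph Node
  isTree : tree.IsTree
  bag : Node → Set V
  cover_vertex : ∀ v, ∃ x, v ∈ bag x
  cover_edge : ∀ u v, G.Adj u v → ∃ x, u ∈ bag x ∧ v ∈ bag x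
  subtree : ∀ v, (tree.induce {x | v ∈ bag x}).Connected

/-- `tw(G) ≤ t - 1`: some tree-decomposition has only bags with at most `t` vertices. -/
def TreewidthLT {V : Type} (G : SimpleGraph V) (t : ℕ) : Prop :=
  ∃ D : TreeDecomp G, ∀ x, (D.bag x).ncard ≤ t

/-- `∂_G(W)`: the vertices of `W` that have a neighbor outside `W`. -/
def vertexBoundary {V : Type} (G : SimpleGraph V) (W : Set V) : Set V :=
  {x | x ∈ W ∧ ∃ y, y ∉ W ∧ G.Adj x y}

/-- `N_G(W)`: the vertices outside `W` that have a neighbor in `W`. -/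
def setNeighbors {V : Type} (G : SimpleGraph V) (W : Set V) : Set V :=
  vertexBoundary G Wᶜ

/-- `W` is a `t`-protrusion of `G`. -/
def IsProtrusion {V : Type} (G : SimpleGraph V) (t : ℕ) (W : Set V) : Prop :=
  (vertexBoundary G W).ncard ≤ t ∧ TreewidthLT (G.induce W) t

/-- `V(G) = Y 0 ⊎ Y 1 ⊎ ⋯ ⊎ Y ℓ` is an `(α, t)`-protrusion decomposition of `G`. -/
structure IsProtrusionDecomposition {V : Type} (G : SimpleGraph V) (α t l : ℕ)
    (Y : Fin (l + 1) → Set V) : Prop where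
  cover : ⋃ i, Y i = Set.univ
  disjoint : Pairwise fun i j => Disjoint (Y i) (Y j)
  neighbors : ∀ i, i ≠ 0 → setNeighbors G (Y i) ⊆ Y 0
  card_le : max l (Y 0).ncard ≤ α
  protrusion : ∀ i, i ≠ 0 → IsProtrusion G t (Y i ∪ (setNeighbors G (Y i) ∩ Y 0))

/-! Boundaried graphs, gluing, finite integer index, protrusion limit. -/

/-- A `t`-boundaried graph: a finite graph with `t` distinguished vertices, labeled by `Fin t`. -/
structure BoundariedGraph (t : ℕ) where
  V : Type
  finite_V : Finite V
  graph : SimpleGraph V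
  bd : Fin t ↪ V

attribute [instance] BoundariedGraph.finite_V

/-- The vertices of `A ⊕ B`: those of `A`, and those of `B` that are not in the boundary of `B`. -/
abbrev GlueVertex {t : ℕ} (A B : BoundariedGraph t) : Type :=
  A.V ⊕ {x : B.V // x ∉ Set.range B.bd}

open Classical in
/-- The embedding of `B` into `A ⊕ B`: the boundary vertex of `B` with label `i` becomes the
boundary vertex of `A` with label `i`. -/
noncomputable def glueRight {t : ℕ} (A B : BoundariedGraph t) (x : B.V) : GlueVertex A B :=
  if h : x ∈ Set.range B.bd then Sum.inl (A.bd h.choose) else Sum.inr ⟨x, h⟩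

/-- Gluing `A ⊕ B`: the disjoint union, with boundary vertices of equal label identified. -/
noncomputable def glue {t : ℕ} (A B : BoundariedGraph t) : SimpleGraph (GlueVertex A B) :=
  A.graph.map Sum.inl ⊔ B.graph.map (glueRight A B)

/-- `A ≡ B` with the shift `Δ(A, B) = δ`: for all boundaried graphs `F` and all `k`,
`A ⊕ F ∈ 𝒢` iff `B ⊕ F ∈ 𝒢`, and `(A ⊕ F, k) ∈ Π` iff `(B ⊕ F, k + δ) ∈ Π`. -/
def EquivShift (P : GraphProblem) (C : GraphClass) {t : ℕ} (δ : ℤ) (A B : BoundariedGraph t) :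
    Prop :=
  ∀ F : BoundariedGraph t, (C.mem (glue A F) ↔ C.mem (glue B F)) ∧
    ∀ k : ℤ, P.memInt (glue A F) k ↔ P.memInt (glue B F) (k + δ)

/-- The relation `≡_{Π,t}` on `𝒢_t`, the `t`-boundaried graphs whose graph is in `𝒢`. -/
def equivSetoid (P : GraphProblem) (C : GraphClass) (t : ℕ) :
    Setoid {A : BoundariedGraph t // C.mem A.graph} where
  r A B := ∃ δ : ℤ, EquivShift P C δ A.1 B.1
  iseqv :=
    { refl := fun A => ⟨0, fun F => ⟨Iff.rfl, fun k => by simp⟩⟩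
      symm := by
        rintro A B ⟨δ, h⟩
        refine ⟨-δ, fun F => ⟨(h F).1.symm, fun k => ?_⟩⟩
        have := (h F).2 (k + -δ)
        rw [neg_add_cancel_right] at this
        exact this.symm
      trans := by
        rintro A B D ⟨δ, h⟩ ⟨ε, h'⟩
        refine ⟨δ + ε, fun F => ⟨(h F).1.trans (h' F).1, fun k => ?_⟩⟩
        rw [← add_assoc]
        exact ((h F).2 k).trans ((h' F).2 (k + δ)) }

/-- `Π` has finite integer index in the class `𝒢`. -/
def HasFII (P : GraphProblem) (C : GraphClass) : Prop :=
  ∀ t : ℕ, Finite (Quotient (equivSetoid P C t))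

/-- Sets `R t` of representatives: for each `t`, finitely many graphs from `𝒢_t`, such that every
`B ∈ 𝒢_t` is equivalent to some `A ∈ R t` with `Δ(A, B) ≥ 0` (so that replacing `B` by `A` does
not increase the parameter). -/
def IsRepresentativeFamily (P : GraphProblem) (C : GraphClass)
    (R : ∀ t : ℕ, Set (BoundariedGraph t)) : Prop :=
  ∀ t : ℕ, (R t).Finite ∧ (∀ A ∈ R t, C.mem A.graph) ∧
    ∀ B : BoundariedGraph t, C.mem B.graph →
      ∃ A ∈ R t, ∃ δ : ℤ, 0 ≤ δ ∧ EquivShift P C δ A B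

/-- The protrusion limit: the largest order of a graph in `R t`.  Every `t`-boundaried graph has
at least `t` vertices, so the `max` only fixes the value `t` in case `R t` is empty. -/
noncomputable def protLimit (R : ∀ t : ℕ, Set (BoundariedGraph t)) (t : ℕ) : ℕ :=
  max t (sSup ((fun A : BoundariedGraph t => Nat.card A.V) '' R t))

/-- The protrusion limit at the doubled boundary size. -/
noncomputable def protLimit' (R : ∀ t : ℕ, Set (BoundariedGraph t)) (t : ℕ) : ℕ :=
  protLimit R (2 * t)

/-- `G` is reduced with respect to the protrusion reduction rule for boundary size `b`: there is no
`b`-protrusion that is larger than the limit, i.e. the rule is not applicable. -/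
def ProtrusionReduced (R : ∀ t : ℕ, Set (BoundariedGraph t)) (b : ℕ) {V : Type} (G : SimpleGraph V) :
    Prop :=
  ¬ ∃ W : Set V, IsProtrusion G b W ∧ protLimit' R b < W.ncard

/-- `Π` is `(s, t)`-treewidth-bounding on the class `𝒢`. -/
def TreewidthBounding (P : GraphProblem) (C : GraphClass) (s : ℕ → ℕ) (t : ℕ) : Prop :=
  ∀ {V : Type} [Finite V] (G : SimpleGraph V) (k : ℕ), C.mem G → P.mem G k →
    ∃ X : Set V, X.ncard ≤ s k ∧ TreewidthLT (G.induce Xᶜ) t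

/-! Constrictions. -/

/-- A set of paths with pairwise distinct, non-adjacent endpoints, any two of which share at most
one vertex, which then is an endpoint of both. -/
structure PathSystem {V : Type} (G : SimpleGraph V) where
  Idx : Type
  src : Idx → V
  dst : Idx → V
  walk : ∀ i, G.Walk (src i) (dst i)
  isPath : ∀ i, (walk i).IsPath
  src_ne_dst : ∀ i, src i ≠ dst i
  not_adj : ∀ i, ¬ G.Adj (src i) (dst i)
  share_endpoint : ∀ i j, i ≠ j → ∀ x, x ∈ (walk i).support → x ∈ (walk j).support →
    (x = src i ∨ x = dst i) ∧ (x = src j ∨ x = dst j)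
  share_at_most_one : ∀ i j, i ≠ j → ∀ x y, x ∈ (walk i).support → x ∈ (walk j).support →
    y ∈ (walk i).support → y ∈ (walk j).support → x = y

/-- The inner vertices of the paths. -/
def PathSystem.inner {V : Type} {G : SimpleGraph V} (S : PathSystem G) : Set V :=
  {x | ∃ i, x ∈ (S.walk i).support ∧ x ≠ S.src i ∧ x ≠ S.dst i}

/-- The constriction of `G` under the paths: join the endpoints of each path by an edge and remove
all inner vertices. -/
def PathSystem.constriction {V : Type} {G : SimpleGraph V} (S : PathSystem G) :
    SimpleGraph {x : V // x ∉ S.inner} :=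
  SimpleGraph.fromRel fun x y =>
    G.Adj x.1 y.1 ∨ ∃ i, x.1 = S.src i ∧ y.1 = S.dst i

/-- `H` is (isomorphic to) the constriction of a subgraph of `G` under a set of paths each of which
has at most `d` vertices. -/
def IsDConstriction (d : ℕ) {V W : Type} (G : SimpleGraph V) (H : SimpleGraph W) : Prop :=
  ∃ (G' : G.Subgraph) (S : PathSystem G'.coe),
    (∀ i, (S.walk i).support.length ≤ d) ∧ Nonempty (S.constriction ≃g H)

/-- `𝒢` `d`-constricts into `ℋ`. -/
def DConstrictsInto (d : ℕ) (C D : GraphClass) : Prop :=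
  ∀ {V W : Type} [Finite V] [Finite W] (G : SimpleGraph V) (H : SimpleGraph W),
    C.mem G → IsDConstriction d G H → D.mem H

/-- The number of (not necessarily maximal, nonempty) cliques of `H`. -/
noncomputable def numCliques {V : Type} (H : SimpleGraph V) : ℕ :=
  {K : Set V | K.Nonempty ∧ H.IsClique K}.ncard

/-! A machine model with a step count: programs of a random access machine whose memory consists
of natural-number variables and named two-dimensional arrays, with addition and truncated
subtraction (but no multiplication) as arithmetic.  Every assignment, store and test costs one
step, so that polynomial time is the same as on Turing machines. -/

namespace Ram

structure State where
  var : ℕ → ℕ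
  arr : ℕ → ℕ → ℕ → ℕ

inductive Expr where
  | const (n : ℕ)
  | var (x : ℕ)
  | arr (a : ℕ) (i j : Expr)
  | add (e f : Expr)
  | sub (e f : Expr)

def Expr.eval (σ : State) : Expr → ℕ
  | const n => n
  | var x => σ.var x
  | arr a i j => σ.arr a (i.eval σ) (j.eval σ)
  | add e f => e.eval σ + f.eval σ
  | sub e f => e.eval σ - f.eval σ

inductive Prog where
  | skip
  | assign (x : ℕ) (e : Expr)
  | store (a : ℕ) (i j e : Expr)
  | seq (p q : Prog)
  | ite (e : Expr) (p q : Prog)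
  | loop (e : Expr) (p : Prog)

/-- `var x := v`. -/
def State.setVar (σ : State) (x v : ℕ) : State where
  var := Function.update σ.var x v
  arr := σ.arr

/-- `arr a i j := v`. -/
def State.setArr (σ : State) (a i j v : ℕ) : State where
  var := σ.var
  arr := Function.update σ.arr a
    (Function.update (σ.arr a) i (Function.update (σ.arr a i) j v))

/-- `Exec p σ T τ`: started in state `σ`, the program `p` halts after exactly `T` steps in `τ`. -/
inductive Exec : Prog → State → ℕ → State → Prop where
  | skip (σ : State) : Exec Prog.skip σ 1 σ
  | assign (x : ℕ) (e : Expr) (σ : State) :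
      Exec (Prog.assign x e) σ 1 (σ.setVar x (e.eval σ))
  | store (a : ℕ) (i j e : Expr) (σ : State) :
      Exec (Prog.store a i j e) σ 1 (σ.setArr a (i.eval σ) (j.eval σ) (e.eval σ))
  | seq {p q : Prog} {σ τ ρ : State} {m n : ℕ} :
      Exec p σ m τ → Exec q τ n ρ → Exec (Prog.seq p q) σ (m + n) ρ
  | ite_then {e : Expr} {p q : Prog} {σ τ : State} {m : ℕ} :
      e.eval σ ≠ 0 → Exec p σ m τ → Exec (Prog.ite e p q) σ (m + 1) τ
  | ite_else {e : Expr} {p q : Prog} {σ τ : State} {m : ℕ} :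
      e.eval σ = 0 → Exec q σ m τ → Exec (Prog.ite e p q) σ (m + 1) τ
  | loop_step {e : Expr} {p : Prog} {σ τ ρ : State} {m n : ℕ} :
      e.eval σ ≠ 0 → Exec p σ m τ → Exec (Prog.loop e p) τ n ρ →
      Exec (Prog.loop e p) σ (m + n + 1) ρ
  | loop_exit {e : Expr} {p : Prog} {σ : State} :
      e.eval σ = 0 → Exec (Prog.loop e p) σ 1 σ

/-- The input `(n, k)`: `n` in variable 0, `k` in variable 1, all other memory is zero. -/
def inputPair (n k : ℕ) : State where
  var x := if x = 0 then n else if x = 1 then k else 0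
  arr _ _ _ := 0

open Classical in
/-- The input `(G, k)`: the order of `G` in variable 0, `k` in variable 1, the adjacency matrix of
`G` in array 0, all other memory is zero. -/
noncomputable def inputInstance {n : ℕ} (G : SimpleGraph (Fin n)) (k : ℕ) : State where
  var x := if x = 0 then n else if x = 1 then k else 0
  arr a i j := if a = 0 ∧ ∃ u v : Fin n, (u : ℕ) = i ∧ (v : ℕ) = j ∧ G.Adj u v then 1 else 0

/-- The state `σ` holds the output `(G, k)`, in the same format. -/
def IsOutput (σ : State) {n : ℕ} (G : SimpleGraph (Fin n)) (k : ℕ) : Prop :=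
  σ.var 0 = n ∧ σ.var 1 = k ∧ ∀ u v : Fin n, G.Adj u v ↔ σ.arr 0 u v = 1

end Ram

/-- A relation on `ℕ` is decidable in time polynomial in `n + k`. -/
def PolyTimeDecidable (r : ℕ → ℕ → Prop) : Prop :=
  ∃ (p : Ram.Prog) (q : Polynomial ℕ), ∀ n k : ℕ, ∃ (T : ℕ) (σ : Ram.State),
    Ram.Exec p (Ram.inputPair n k) T σ ∧ T ≤ q.eval (n + k) ∧ (σ.var 0 ≠ 0 ↔ r n k)

/-- `Π` restricted to `𝒢` admits a kernel with at most `g k` vertices: an algorithm that maps every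
instance `(G, k)` with `G ∈ 𝒢`, in time polynomial in `|G| + k`, to an equivalent instance
`(G', k')` of `Π_𝒢` with `|G'| ≤ g k` and `k' ≤ k`. -/
def HasKernelOfSize (P : GraphProblem) (C : GraphClass) (g : ℕ → ℕ) : Prop :=
  ∃ (p : Ram.Prog) (q : Polynomial ℕ), ∀ (n : ℕ) (G : SimpleGraph (Fin n)) (k : ℕ), C.mem G →
    ∃ (T : ℕ) (σ : Ram.State) (n' : ℕ) (G' : SimpleGraph (Fin n')) (k' : ℕ),
      Ram.Exec p (Ram.inputInstance G k) T σ ∧ T ≤ q.eval (n + k) ∧ Ram.IsOutput σ G' k' ∧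
      ((P.restrict C).mem G k ↔ (P.restrict C).mem G' k') ∧ n' ≤ g k ∧ k' ≤ k

/-- `x_k = s(k) + 2t · f_E(s(k))`. -/
def sepBound (s fE : ℕ → ℕ) (t k : ℕ) : ℕ :=
  s k + 2 * t * fE (s k)

/-- `x_k + (f_{#ω}(x_k) + x_k + 1) · Q`. -/
def kernelBound (s fE fK : ℕ → ℕ) (t Q k : ℕ) : ℕ :=
  sepBound s fE t k + (fK (sepBound s fE t k) + sepBound s fE t k + 1) * Q

/-!
Protrusion decompositions and kernels from constrictions into sparse graphs.

**Representatives.** Among the boundaried graphs of an equivalence class choose one, `A`, for which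
some gluing `A ⊕ F` is in the problem with the smallest parameter; all shifts from `A` are then
nonnegative (`exists_minimal_representative`).

**The decomposition.** Let `Q` be the protrusion limit, so that protrusions have at most `Q`
vertices in a reduced graph `G`, and let `X` be a set of `s k` vertices such that `G - X` has
treewidth less than `t`.  Instead of a tree-decomposition of `G - X` the proof uses an elimination
order of a chordal supergraph (`TreewidthLT.exists_elimOrder`): a forest on the vertices, each of
which carries a bag `K v` of at most `t` vertices that separates the vertices below `v` from the
rest of `G - X`.  The vertices are processed from the bottom up (`ElimOrder.Marking.step`).  If the
component at `v` of the unmarked vertices below `v` has two neighbors in `X` that are not adjacent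
yet, then join them by an edge and mark the bag of `v`.  The new edge stands for a path through the
component, a `Link`, which has at most `2Q` vertices as the components strictly below `v` are in
protrusions.  The bag of `v` is also marked if `v` is the lowest common ancestor of bags marked
before.  The links give a constriction of `G` onto `X` (`DConstrictsInto.mem_augment`), which is in
`ℋ`; hence there are at most `fE (s k)` links, and at most `2t` vertices are marked for each
(`ElimOrder.exists_marked`).  In the end, the neighbors in `X` of a component form a clique of a
graph of `ℋ`, and the other neighbors lie in two bags, one above and one below.  So the components,
and also the union of all components with the same neighborhood, are in protrusions.

It remains to count the neighborhoods of components of `G - Y₀`, where `Y₀` consists of `X` and the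
marked vertices.  Treated by increasing size, each neighborhood either is a clique already or
provides a link between two of its vertices, and so the neighborhoods are mapped injectively to
cliques of a constriction of `G` onto `Y₀` (`exists_links_injOn_cliques`, `card_neighborhoods_le`).

**The kernel.** If a graph is not reduced, then it has a set of more than `Q` and at most `2Q`
vertices whose boundary has at most `2β` vertices (`IsProtrusion.exists_bounded`).  Up to
isomorphism there are finitely many such sets, and each of them can be replaced by its
representative, which is smaller (`IsRepresentativeFamily.exists_rule`).  So the algorithm tries a
fixed finite list of replacement rules at all tuples of vertices until none of them applies; there
are at most `|G|` replacements, and the decrease of the parameter is recorded.  The programs carry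
explicit time bounds, which are polynomial (`Ram.exists_runs_reduce`).  The remaining vertices are
then renumbered (`Ram.exists_runs_compact`).  The graph obtained is reduced, hence the
decomposition bounds its order if the instance is in the problem.  The decision program for
`n ≤ g k` is run in a fresh part of the memory (`Ram.Exec.shift`).  If it rejects, or if the
parameter would be negative, then the output is a complete graph on `ω` vertices.  It is not in `𝒢`,
because it is its own constriction and its clique number is too large for a graph of `ℋ`
(`DConstrictsInto.not_mem_top`).
-/

/-! ### Elimination orders -/

/-- In a tree rooted at `ρ`, if two subtrees `A` and `B` meet, then the top node of the one whose
top is farther from `ρ` belongs to the other one. -/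
theorem SimpleGraph.IsTree.top_mem_of_inter {N : Type*} {T : SimpleGraph N} (hT : T.IsTree)
    (ρ : N) {A B : Set N} (hA : (T.induce A).Connected) (hB : (T.induce B).Connected)
    {a b x : N} (ha : a ∈ A) (hb : b ∈ B) (hamin : ∀ y ∈ A, T.dist a ρ ≤ T.dist y ρ)
    (hbmin : ∀ y ∈ B, T.dist b ρ ≤ T.dist y ρ) (hxA : x ∈ A) (hxB : x ∈ B)
    (hab : T.dist b ρ ≤ T.dist a ρ) : a ∈ B := by
  classical
  -- For each of the two sets, a path from `x` to `ρ` that first stays in the set, up to its top,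
  -- and from there on only meets nodes that are closer to `ρ`.
  have key : ∀ (C : Set N) (c : N), (T.induce C).Connected → c ∈ C →
      (∀ y ∈ C, T.dist c ρ ≤ T.dist y ρ) → x ∈ C →
      ∃ p : T.Walk x ρ, p.IsPath ∧ c ∈ p.support ∧
        ∀ y ∈ p.support, y ∈ C ∨ T.dist y ρ < T.dist c ρ := by
    intro C c hC hc hmin hx
    obtain ⟨w0, hw0⟩ := (hC.preconnected ⟨x, hx⟩ ⟨c, hc⟩).exists_isPath
    let w : T.Walk x c := w0.map (SimpleGraph.Embedding.induce C).toHom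
    have hw : w.IsPath := hw0.map Subtype.val_injective
    have hwC : ∀ y ∈ w.support, y ∈ C := by
      intro y hy
      have hy' : y ∈ (w0.map (SimpleGraph.Embedding.induce C).toHom).support := hy
      rw [SimpleGraph.Walk.support_map] at hy'
      obtain ⟨z, -, rfl⟩ := List.mem_map.1 hy'
      exact z.2
    obtain ⟨q, hq, hql⟩ := hT.connected.exists_path_of_dist c ρ
    have hqlt : ∀ y ∈ q.support, y = c ∨ T.dist y ρ < T.dist c ρ := by
      intro y hy
      by_cases hyc : y = c
      · exact Or.inl hyc
      right
      have h1 := SimpleGraph.dist_le (q.dropUntil y hy)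
      have h2 : (q.takeUntil y hy).length + (q.dropUntil y hy).length = q.length := by
        rw [← SimpleGraph.Walk.length_append, SimpleGraph.Walk.take_spec]
      have h3 : (q.takeUntil y hy).length ≠ 0 := fun h0 =>
        hyc (SimpleGraph.Walk.eq_of_length_eq_zero h0).symm
      omega
    refine ⟨w.append q, ?_, ?_, ?_⟩
    · rw [SimpleGraph.Walk.isPath_def, SimpleGraph.Walk.support_append]
      refine List.Nodup.append hw.support_nodup (hq.support_nodup.tail) ?_
      intro y hy hy'
      have hyq := List.mem_of_mem_tail hy'
      rcases hqlt y hyq with rfl | h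
      · have := hq.support_nodup
        rw [← SimpleGraph.Walk.cons_tail_support] at this
        exact (List.nodup_cons.1 this).1 hy'
      · exact absurd (hmin y (hwC y hy)) (by omega)
    · simp
    · intro y hy
      rw [SimpleGraph.Walk.mem_support_append_iff] at hy
      rcases hy with hy | hy
      · exact Or.inl (hwC y hy)
      · rcases hqlt y hy with rfl | h
        · exact Or.inl hc
        · exact Or.inr h
  obtain ⟨p, hp, hap, -⟩ := key A a hA ha hamin hxA
  obtain ⟨p', hp', -, hB'⟩ := key B b hB hb hbmin hxB
  have hpp : p = p' := (hT.existsUnique_path x ρ).unique hp hp'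
  rcases hB' a (hpp ▸ hap) with h | h
  · exact h
  · omega

/-- The combinatorial content of a tree-decomposition of `G[U]` with bags of at most `t` vertices:
an elimination order of a chordal supergraph.  `K v` consists of `v` and of its later neighbors in
the chordal supergraph; it is empty for `v ∉ U`.  The edges of the supergraph are the pairs `u`, `v`
with `u ∈ K v`, and `chord` says that `K v` is a clique in it. -/
structure ElimOrder {V : Type} (G : SimpleGraph V) (U : Set V) (t : ℕ) where
  rank : V → ℕ
  rank_inj : Function.Injective rank
  K : V → Set V
  mem_self : ∀ v ∈ U, v ∈ K v
  subset : ∀ v, K v ⊆ U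
  mem_of_mem : ∀ {u v}, u ∈ K v → v ∈ U
  card_le : ∀ v, (K v).ncard ≤ t
  up : ∀ {u v}, u ∈ K v → u = v ∨ rank v < rank u
  edge : ∀ {u v}, u ∈ U → v ∈ U → G.Adj u v → v ∈ K u ∨ u ∈ K v
  chord : ∀ {u v w}, v ∈ K u → w ∈ K u → w ∈ K v ∨ v ∈ K w

/-- There is a linear order in which the vertices of larger depth `d` come first. -/
theorem exists_injective_rank {V : Type} [Finite V] (d : V → ℕ) :
    ∃ r : V → ℕ, Function.Injective r ∧ ∀ u v, r u < r v → d v ≤ d u := by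
  obtain ⟨n, ⟨e⟩⟩ := Finite.exists_equiv_fin V
  obtain ⟨M, hM⟩ : ∃ M, ∀ v, d v ≤ M := by
    obtain ⟨M, hM⟩ := (Set.finite_range d).bddAbove
    exact ⟨M, fun v => hM ⟨v, rfl⟩⟩
  have key : ∀ u v, (M - d u) * n + e u ≤ (M - d v) * n + e v → d v ≤ d u := by
    intro u v h
    by_contra hlt
    have h1 : M - d v + 1 ≤ M - d u := by have := hM v; omega
    have h2 := Nat.mul_le_mul_right n h1
    have h3 := (e v).2
    rw [add_mul, one_mul] at h2
    omega
  refine ⟨fun v => (M - d v) * n + e v, ?_, fun u v h => key u v h.le⟩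
  intro u v h
  have h1 := key u v h.le
  have h2 := key v u h.ge
  have h3 : d u = d v := le_antisymm h2 h1
  simp only [h3] at h
  exact e.injective (Fin.ext (by omega))

/-- Root the tree of the decomposition and eliminate the vertices by decreasing depth of the tops of
their subtrees.  A vertex `v` is joined to the later vertices that share a bag with it; all of
these lie in the bag at the top of the subtree of `v`. -/
theorem TreewidthLT.exists_elimOrder {V : Type} [Finite V] {G : SimpleGraph V} {U : Set V} {t : ℕ}
    (h : TreewidthLT (G.induce U) t) : Nonempty (ElimOrder G U t) := by
  classical
  obtain ⟨D, hD⟩ := h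
  obtain ⟨ρ⟩ := D.isTree.connected.nonempty
  have htop : ∀ v : U, ∃ x, v ∈ D.bag x ∧ ∀ y, v ∈ D.bag y → D.tree.dist x ρ ≤ D.tree.dist y ρ := by
    intro v
    have hne : {x | v ∈ D.bag x}.Nonempty := D.cover_vertex v
    refine ⟨Function.argminOn (fun x => D.tree.dist x ρ) {x | v ∈ D.bag x} hne,
      Function.argminOn_mem (fun x => D.tree.dist x ρ) {x | v ∈ D.bag x} hne, ?_⟩
    intro y hy
    exact Function.argminOn_le (fun x => D.tree.dist x ρ) {x | v ∈ D.bag x} (a := y) hy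
  choose top htop1 htop2 using htop
  obtain ⟨r, hr, hrd⟩ := exists_injective_rank
    (fun v : V => if h : v ∈ U then D.tree.dist (top ⟨v, h⟩) ρ else 0)
  let share : U → U → Prop := fun u v => ∃ x, u ∈ D.bag x ∧ v ∈ D.bag x
  let K : V → Set V := fun v =>
    {u | ∃ (hu : u ∈ U) (hv : v ∈ U), u = v ∨ (r v < r u ∧ share ⟨u, hu⟩ ⟨v, hv⟩)}
  have hK : ∀ v (hv : v ∈ U), ∀ u, u ∈ K v → ∃ hu : u ∈ U, (⟨u, hu⟩ : U) ∈ D.bag (top ⟨v, hv⟩) := by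
    rintro v hv u ⟨hu, _, h⟩
    refine ⟨hu, ?_⟩
    rcases h with rfl | ⟨hlt, x, hxu, hxv⟩
    · exact htop1 _
    · have := hrd _ _ hlt
      simp only [hu, hv, dif_pos] at this
      exact D.isTree.top_mem_of_inter ρ (D.subtree ⟨v, hv⟩) (D.subtree ⟨u, hu⟩)
        (htop1 ⟨v, hv⟩) (htop1 ⟨u, hu⟩) (htop2 _) (htop2 _) hxv hxu this
  refine ⟨⟨r, hr, K, ?_, ?_, ?_, ?_, ?_, ?_, ?_⟩⟩
  · exact fun v hv => ⟨hv, hv, Or.inl rfl⟩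
  · rintro v u ⟨hu, -, -⟩
    exact hu
  · rintro u v ⟨-, hv, -⟩
    exact hv
  · intro v
    by_cases hv : v ∈ U
    · have hsub : K v ⊆ Subtype.val '' D.bag (top ⟨v, hv⟩) := by
        intro u hu
        obtain ⟨h1, h2⟩ := hK v hv u hu
        exact ⟨_, h2, rfl⟩
      calc (K v).ncard ≤ (Subtype.val '' D.bag (top ⟨v, hv⟩)).ncard :=
            Set.ncard_le_ncard hsub (Set.toFinite _)
        _ ≤ (D.bag (top ⟨v, hv⟩)).ncard := Set.ncard_image_le (Set.toFinite _)
        _ ≤ t := hD _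
    · have : K v = ∅ := by
        ext u
        simp [K, hv]
      simp [this]
  · rintro u v ⟨_, _, h⟩
    rcases h with h | h
    · exact Or.inl h
    · exact Or.inr h.1
  · intro u v hu hv huv
    obtain ⟨x, hx1, hx2⟩ := D.cover_edge ⟨u, hu⟩ ⟨v, hv⟩ huv
    rcases lt_trichotomy (r u) (r v) with h | h | h
    · exact Or.inl ⟨hv, hu, Or.inr ⟨h, x, hx2, hx1⟩⟩
    · exact Or.inl ⟨hv, hu, Or.inl (hr h).symm⟩
    · exact Or.inr ⟨hu, hv, Or.inr ⟨h, x, hx1, hx2⟩⟩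
  · intro u v w hv hw
    have hu : u ∈ U := hv.2.1
    obtain ⟨hvU, hv'⟩ := hK u hu v hv
    obtain ⟨hwU, hw'⟩ := hK u hu w hw
    rcases lt_trichotomy (r v) (r w) with h | h | h
    · exact Or.inl ⟨hwU, hvU, Or.inr ⟨h, _, hw', hv'⟩⟩
    · exact Or.inl ⟨hwU, hvU, Or.inl (hr h).symm⟩
    · exact Or.inr ⟨hvU, hwU, Or.inr ⟨h, _, hv', hw'⟩⟩

namespace ElimOrder

variable {V : Type} {G : SimpleGraph V} {U : Set V} {t : ℕ} (O : ElimOrder G U t)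

/-- `O.Le u v`: `v` is `u` or an ancestor of `u` in the elimination forest. -/
def Le (u v : V) : Prop := Relation.ReflTransGen (fun a b => b ∈ O.K a) u v

/-- The vertices below `v` (including `v`) in the elimination forest. -/
def below (v : V) : Set V := {u | O.Le u v}

variable {O}

theorem Le.refl (v : V) : O.Le v v := Relation.ReflTransGen.refl

theorem Le.trans {u v w : V} (h : O.Le u v) (h' : O.Le v w) : O.Le u w :=
  Relation.ReflTransGen.trans h h'

theorem Le.of_mem {u v : V} (h : v ∈ O.K u) : O.Le u v := Relation.ReflTransGen.single h

theorem Le.rank_le {u v : V} (h : O.Le u v) : O.rank u ≤ O.rank v := by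
  induction h with
  | refl => exact le_rfl
  | tail _ h ih =>
    rcases O.up h with rfl | h
    · exact ih
    · exact ih.trans h.le

theorem Le.eq_of_rank_le {u v : V} (h : O.Le u v) (h' : O.rank v ≤ O.rank u) : u = v :=
  O.rank_inj (le_antisymm h.rank_le h')

theorem Le.mem {u v : V} (h : O.Le u v) (hv : v ∈ U) : u ∈ U := by
  induction h using Relation.ReflTransGen.head_induction_on with
  | refl => exact hv
  | head h _ _ => exact O.mem_of_mem h

theorem below_subset {v : V} (hv : v ∈ U) : O.below v ⊆ U := fun _ h => Le.mem h hv

/-- An edge of the chordal supergraph that leaves the set of vertices below `m` upwards, ends in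
`K m`. -/
theorem mem_of_not_le {a b m : V} (hab : a ∈ O.K b) (hbm : O.Le b m) (ham : ¬ O.Le a m) :
    a ∈ O.K m := by
  induction hbm using Relation.ReflTransGen.head_induction_on with
  | refl => exact hab
  | head h h' ih =>
    refine ih ?_
    rcases O.chord h hab with h1 | h1
    · exact h1
    · exact absurd ((Le.of_mem h1).trans h') ham

/-- The ancestors of a vertex form a chain. -/
theorem le_total_of_le {u y m : V} (hy : O.Le u y) (hm : O.Le u m) : O.Le y m ∨ O.Le m y := by
  induction hy with
  | refl => exact Or.inl hm
  | tail _ h ih =>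
    rename_i b c _
    rcases ih with hbm | hmb
    · by_cases hcm : O.Le c m
      · exact Or.inl hcm
      · exact Or.inr (Le.of_mem (mem_of_not_le h hbm hcm))
    · exact Or.inr (hmb.trans (Le.of_mem h))

end ElimOrder

/-! ### Links and constrictions -/

/-- The full subgraph on the vertex set `s`. -/
def fullSubgraph {V : Type} (G : SimpleGraph V) (s : Set V) : G.Subgraph where
  verts := s
  Adj a b := G.Adj a b ∧ a ∈ s ∧ b ∈ s
  adj_sub h := h.1
  edge_vert h := h.2.1
  symm := ⟨fun _ _ h => ⟨h.1.symm, h.2.2, h.2.1⟩⟩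

theorem exists_walk_fullSubgraph {V : Type} {G : SimpleGraph V} {s : Set V} {u v : V}
    (p : G.Walk u v) (hp : ∀ x ∈ p.support, x ∈ s) (hu : u ∈ s) (hv : v ∈ s) :
    ∃ q : (fullSubgraph G s).coe.Walk ⟨u, hu⟩ ⟨v, hv⟩, q.support.map Subtype.val = p.support := by
  induction p with
  | nil => exact ⟨SimpleGraph.Walk.nil, by simp⟩
  | cons h p ih =>
    rename_i a b c
    have hb : b ∈ s := hp b (by simp)
    obtain ⟨q, hq⟩ := ih (fun x hx => hp x (by simp [hx])) hb hv
    have hadj : (fullSubgraph G s).coe.Adj ⟨a, hu⟩ ⟨b, hb⟩ := ⟨h, hu, hb⟩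
    exact ⟨SimpleGraph.Walk.cons hadj q, by simp [hq]⟩

/-- A path of `G` with at most `d` vertices whose ends are distinct, non-adjacent and in `Y`, and
whose inner vertices are not in `Y`. -/
structure Link {V : Type} (G : SimpleGraph V) (Y : Set V) (d : ℕ) where
  src : V
  dst : V
  walk : G.Walk src dst
  isPath : walk.IsPath
  ne : src ≠ dst
  not_adj : ¬ G.Adj src dst
  src_mem : src ∈ Y
  dst_mem : dst ∈ Y
  inner_notMem : ∀ x ∈ walk.support, x ≠ src → x ≠ dst → x ∉ Y
  length_le : walk.support.length ≤ d

namespace Link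

variable {V : Type} {G : SimpleGraph V} {Y : Set V} {d : ℕ}

/-- The inner vertices of a link. -/
def inner (a : Link G Y d) : Set V := {x | x ∈ a.walk.support ∧ x ≠ a.src ∧ x ≠ a.dst}

/-- The pair of ends of a link. -/
def ends (a : Link G Y d) : Sym2 V := s(a.src, a.dst)

/-- Two links that may be constricted together, each of them adding an edge of its own: they share
at most one vertex, which is an end of both, because all ends are in `Y`. -/
def Compatible (a b : Link G Y d) : Prop := Disjoint a.inner b.inner ∧ a.ends ≠ b.ends

theorem Compatible.symm {a b : Link G Y d} (h : a.Compatible b) : b.Compatible a :=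
  ⟨h.1.symm, h.2.symm⟩

theorem mem_inner_or {a : Link G Y d} {x : V} (hx : x ∈ a.walk.support) :
    x ∈ a.inner ∨ x = a.src ∨ x = a.dst := by
  by_cases h1 : x = a.src
  · exact Or.inr (Or.inl h1)
  by_cases h2 : x = a.dst
  · exact Or.inr (Or.inr h2)
  exact Or.inl ⟨hx, h1, h2⟩

end Link

/-- `G` with the ends of each link of `L` joined by an edge. -/
def augment {V : Type} (G : SimpleGraph V) {Y : Set V} {d : ℕ} (L : List (Link G Y d)) :
    SimpleGraph V :=
  G ⊔ SimpleGraph.fromEdgeSet {e | ∃ a ∈ L, a.ends = e}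

theorem augment_adj {V : Type} {G : SimpleGraph V} {Y : Set V} {d : ℕ} {L : List (Link G Y d)}
    {u v : V} : (augment G L).Adj u v ↔ G.Adj u v ∨ ∃ a ∈ L, a.ends = s(u, v) := by
  rw [augment, SimpleGraph.sup_adj, SimpleGraph.fromEdgeSet_adj]
  constructor
  · rintro (h | ⟨h, -⟩)
    · exact Or.inl h
    · exact Or.inr h
  · rintro (h | ⟨a, ha, h⟩)
    · exact Or.inl h
    · refine Or.inr ⟨⟨a, ha, h⟩, ?_⟩
      rintro rfl
      have : s(a.src, a.dst) = s(u, u) := h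
      rw [Sym2.eq_iff] at this
      rcases this with ⟨h1, h2⟩ | ⟨h1, h2⟩ <;> exact a.ne (h1.trans h2.symm)

theorem augment_mono {V : Type} {G : SimpleGraph V} {Y : Set V} {d : ℕ} {L : List (Link G Y d)}
    (a : Link G Y d) : augment G L ≤ augment G (a :: L) := by
  intro u v h
  rw [augment_adj] at h ⊢
  rcases h with h | ⟨b, hb, h⟩
  · exact Or.inl h
  · exact Or.inr ⟨b, List.mem_cons_of_mem _ hb, h⟩

/-- Constricting pairwise compatible links of a graph of `𝒢` yields a graph of `ℋ`, on the vertex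
set `Y` that carries the ends of the links. -/
theorem DConstrictsInto.mem_augment {𝒢 ℋ : GraphClass} {d : ℕ} (hd : DConstrictsInto d 𝒢 ℋ)
    {V : Type} [Finite V] {G : SimpleGraph V} (hG : 𝒢.mem G) {Y : Set V}
    {L : List (Link G Y d)} (hL : L.Pairwise Link.Compatible) :
    ℋ.mem ((augment G L).induce Y) := by
  classical
  let s : Set V := Y ∪ {x | ∃ a ∈ L, x ∈ a.inner}
  have hsupp : ∀ a ∈ L, ∀ x ∈ a.walk.support, x ∈ s := by
    intro a ha x hx
    rcases Link.mem_inner_or hx with h | rfl | rfl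
    · exact Or.inr ⟨a, ha, h⟩
    · exact Or.inl a.src_mem
    · exact Or.inl a.dst_mem
  have hw : ∀ i : Fin L.length,
      ∃ q : (fullSubgraph G s).coe.Walk ⟨L[i].src, Or.inl L[i].src_mem⟩
        ⟨L[i].dst, Or.inl L[i].dst_mem⟩, q.support.map Subtype.val = L[i].walk.support :=
    fun i => exists_walk_fullSubgraph _ (hsupp _ (List.getElem_mem _)) _ _
  choose q hq using hw
  have hmem : ∀ i (x : (fullSubgraph G s).verts), x ∈ (q i).support → x.1 ∈ L[i].walk.support := by
    intro i x hx
    rw [← hq i]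
    exact List.mem_map_of_mem hx
  have hmem' : ∀ i (x : (fullSubgraph G s).verts), x.1 ∈ L[i].walk.support → x ∈ (q i).support := by
    intro i x hx
    rw [← hq i, List.mem_map] at hx
    obtain ⟨y, hy, hyx⟩ := hx
    rwa [← Subtype.ext hyx]
  have hcomp : ∀ i j : Fin L.length, i ≠ j → L[i].Compatible L[j] := by
    intro i j hij
    rcases lt_or_gt_of_ne hij with h | h
    · exact List.pairwise_iff_getElem.1 hL i j i.2 j.2 h
    · exact (List.pairwise_iff_getElem.1 hL j i j.2 i.2 h).symm
  -- A vertex shared by two of the paths is an end of both.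
  have hshare : ∀ i j : Fin L.length, i ≠ j → ∀ x : V, x ∈ L[i].walk.support →
      x ∈ L[j].walk.support → x = L[i].src ∨ x = L[i].dst := by
    intro i j hij x hx hx'
    rcases Link.mem_inner_or hx with h | h
    · rcases Link.mem_inner_or hx' with h' | h'
      · exact absurd h' (Set.disjoint_left.1 (hcomp i j hij).1 h)
      · refine absurd ?_ (L[i].inner_notMem x hx h.2.1 h.2.2)
        rcases h' with rfl | rfl
        · exact L[j].src_mem
        · exact L[j].dst_mem
    · exact h
  let S : PathSystem (fullSubgraph G s).coe :=
    { Idx := Fin L.length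
      src := fun i => ⟨L[i].src, Or.inl L[i].src_mem⟩
      dst := fun i => ⟨L[i].dst, Or.inl L[i].dst_mem⟩
      walk := q
      isPath := by
        intro i
        rw [SimpleGraph.Walk.isPath_def]
        refine List.Nodup.of_map Subtype.val ?_
        rw [hq i]
        exact L[i].isPath.support_nodup
      src_ne_dst := fun i h => L[i].ne (congrArg Subtype.val h)
      not_adj := fun i h => L[i].not_adj h.1
      share_endpoint := by
        intro i j hij x hx hx'
        constructor
        · rcases hshare i j hij x.1 (hmem i x hx) (hmem j x hx') with h | h
          · exact Or.inl (Subtype.ext h)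
          · exact Or.inr (Subtype.ext h)
        · rcases hshare j i hij.symm x.1 (hmem j x hx') (hmem i x hx) with h | h
          · exact Or.inl (Subtype.ext h)
          · exact Or.inr (Subtype.ext h)
      share_at_most_one := by
        intro i j hij x y hx hx' hy hy'
        by_contra hxy
        have hxy' : x.1 ≠ y.1 := fun h => hxy (Subtype.ext h)
        have key : ∀ i : Fin L.length, (x.1 = L[i].src ∨ x.1 = L[i].dst) →
            (y.1 = L[i].src ∨ y.1 = L[i].dst) → L[i].ends = s(x.1, y.1) := by
          intro i h h'
          rw [Link.ends, Sym2.eq_iff]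
          rcases h with h | h <;> rcases h' with h' | h'
          · exact absurd (h.trans h'.symm) hxy'
          · exact Or.inl ⟨h.symm, h'.symm⟩
          · exact Or.inr ⟨h'.symm, h.symm⟩
          · exact absurd (h.trans h'.symm) hxy'
        refine (hcomp i j hij).2 ?_
        rw [key i (hshare i j hij x.1 (hmem i x hx) (hmem j x hx'))
            (hshare i j hij y.1 (hmem i y hy) (hmem j y hy')),
          key j (hshare j i hij.symm x.1 (hmem j x hx') (hmem i x hx))
            (hshare j i hij.symm y.1 (hmem j y hy') (hmem i y hy))] }
  have hinner : ∀ x : (fullSubgraph G s).verts, x ∉ S.inner ↔ x.1 ∈ Y := by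
    intro x
    constructor
    · intro hx
      rcases x.2 with h | ⟨a, ha, hxa⟩
      · exact h
      · exfalso
        obtain ⟨i, hi, rfl⟩ := List.getElem_of_mem ha
        exact hx ⟨⟨i, hi⟩, hmem' ⟨i, hi⟩ x hxa.1, fun h => hxa.2.1 (congrArg Subtype.val h),
          fun h => hxa.2.2 (congrArg Subtype.val h)⟩
    · rintro hx ⟨i, hi, h1, h2⟩
      exact L[i].inner_notMem x.1 (hmem i x hi) (fun h => h1 (Subtype.ext h))
        (fun h => h2 (Subtype.ext h)) hx
  refine hd G _ hG ⟨fullSubgraph G s, S, ?_, ⟨⟨⟨fun x => ⟨x.1.1, (hinner x.1).1 x.2⟩,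
    fun y => ⟨⟨y.1, Or.inl y.2⟩, (hinner _).2 y.2⟩, fun x => rfl, fun y => rfl⟩, ?_⟩⟩⟩
  · intro i
    have h1 := L[i].length_le
    rw [← hq i, List.length_map] at h1
    exact h1
  · intro x y
    change (augment G L).Adj x.1.1 y.1.1 ↔ S.constriction.Adj x y
    rw [augment_adj, PathSystem.constriction, SimpleGraph.fromRel_adj]
    constructor
    · rintro (h | ⟨a, ha, h⟩)
      · refine ⟨fun hxy => G.loopless.irrefl _ (hxy ▸ h), Or.inl (Or.inl ⟨h, x.1.2, y.1.2⟩)⟩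
      · obtain ⟨i, hi, rfl⟩ := List.getElem_of_mem ha
        have hne := L[i].ne
        rw [Link.ends, Sym2.eq_iff] at h
        rcases h with ⟨h1, h2⟩ | ⟨h1, h2⟩
        · refine ⟨?_, Or.inl (Or.inr ⟨⟨i, hi⟩, Subtype.ext h1.symm, Subtype.ext h2.symm⟩)⟩
          rintro rfl
          exact hne (h1.trans h2.symm)
        · refine ⟨?_, Or.inr (Or.inr ⟨⟨i, hi⟩, Subtype.ext h1.symm, Subtype.ext h2.symm⟩)⟩
          rintro rfl
          exact hne (h1.trans h2.symm)
    · rintro ⟨-, (h | ⟨i, h1, h2⟩) | (h | ⟨i, h1, h2⟩)⟩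
      · exact Or.inl h.1
      · refine Or.inr ⟨L[i], List.getElem_mem _, ?_⟩
        rw [Link.ends, Sym2.eq_iff]
        exact Or.inl ⟨(congrArg Subtype.val h1).symm, (congrArg Subtype.val h2).symm⟩
      · exact Or.inl h.1.symm
      · refine Or.inr ⟨L[i], List.getElem_mem _, ?_⟩
        rw [Link.ends, Sym2.eq_iff]
        exact Or.inr ⟨(congrArg Subtype.val h1).symm, (congrArg Subtype.val h2).symm⟩

/-- Pairwise compatible links are no more than the edges of the constricted graph. -/
theorem length_le_ncard_edgeSet {V : Type} [Finite V] {G : SimpleGraph V} {Y : Set V} {d : ℕ}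
    {L : List (Link G Y d)} (hL : L.Pairwise Link.Compatible) :
    L.length ≤ ((augment G L).induce Y).edgeSet.ncard := by
  classical
  let f : Fin L.length → Sym2 Y := fun i => s(⟨L[i].src, L[i].src_mem⟩, ⟨L[i].dst, L[i].dst_mem⟩)
  have hf : ∀ i, (f i).map Subtype.val = L[i].ends := fun i => rfl
  have hinj : Function.Injective f := by
    intro i j hij
    by_contra hne
    have h : L[i].ends = L[j].ends := by rw [← hf, ← hf, hij]
    rcases lt_or_gt_of_ne hne with hlt | hlt
    · exact (List.pairwise_iff_getElem.1 hL i j i.2 j.2 hlt).2 h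
    · exact (List.pairwise_iff_getElem.1 hL j i j.2 i.2 hlt).2 h.symm
  have hsub : Set.range f ⊆ ((augment G L).induce Y).edgeSet := by
    rintro _ ⟨i, rfl⟩
    change (augment G L).Adj _ _
    rw [augment_adj]
    exact Or.inr ⟨L[i], List.getElem_mem _, rfl⟩
  calc L.length = (Set.range f).ncard := by
        rw [← Set.image_univ, Set.ncard_image_of_injective _ hinj, Set.ncard_univ, Nat.card_fin]
    _ ≤ _ := Set.ncard_le_ncard hsub (Set.toFinite _)

theorem ncard_clique_le {V : Type} [Finite V] {H : SimpleGraph V} {Y S : Set V} (hS : S ⊆ Y)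
    (hc : H.IsClique S) : S.ncard ≤ (H.induce Y).cliqueNum := by
  classical
  have : Fintype Y := Fintype.ofFinite _
  let T : Finset Y := Finset.univ.filter fun y => y.1 ∈ S
  have hT : (H.induce Y).IsClique (T : Set Y) := by
    intro x hx y hy hxy
    have hx' : x.1 ∈ S := by simpa [T] using hx
    have hy' : y.1 ∈ S := by simpa [T] using hy
    exact hc hx' hy' fun h => hxy (Subtype.ext h)
  have hST : S = Subtype.val '' (T : Set Y) := by
    ext x
    constructor
    · intro hx
      exact ⟨⟨x, hS hx⟩, by simpa [T] using hx, rfl⟩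
    · rintro ⟨y, hy, rfl⟩
      simpa [T] using hy
  calc S.ncard = (T : Set Y).ncard := by
        conv_lhs => rw [hST]
        exact Set.ncard_image_of_injective _ Subtype.val_injective
    _ = T.card := Set.ncard_coe_finset T
    _ ≤ _ := hT.card_le_cliqueNum

/-! ### Components inside a vertex set -/

/-- The vertices that can be reached from `v` by steps into `A`. -/
def reach {V : Type} (G : SimpleGraph V) (A : Set V) (v : V) : Set V :=
  {u | Relation.ReflTransGen (fun a b => G.Adj a b ∧ b ∈ A) v u}

section reach

variable {V : Type} {G : SimpleGraph V} {A : Set V} {u v w : V}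

theorem mem_reach_self : v ∈ reach G A v := Relation.ReflTransGen.refl

theorem reach_subset (hv : v ∈ A) : reach G A v ⊆ A := by
  intro u hu
  rcases Relation.ReflTransGen.cases_tail hu with h | ⟨_, -, h⟩
  · exact h ▸ hv
  · exact h.2

theorem reach_step (hu : u ∈ reach G A v) (huw : G.Adj u w) (hw : w ∈ A) : w ∈ reach G A v :=
  Relation.ReflTransGen.tail hu ⟨huw, hw⟩

theorem reach_symm (hv : v ∈ A) (hu : u ∈ reach G A v) : v ∈ reach G A u := by
  have hu' : Relation.ReflTransGen (fun a b => G.Adj a b ∧ b ∈ A) v u := hu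
  induction hu' with
  | refl => exact mem_reach_self
  | tail h1 h2 ih =>
    exact Relation.ReflTransGen.trans
      (Relation.ReflTransGen.single ⟨h2.1.symm, reach_subset hv h1⟩) (ih h1)

theorem reach_eq (hv : v ∈ A) (hu : u ∈ reach G A v) : reach G A u = reach G A v := by
  ext x
  constructor
  · intro hx
    exact Relation.ReflTransGen.trans hu hx
  · intro hx
    exact Relation.ReflTransGen.trans (reach_symm hv hu) hx

theorem reach_mono {B : Set V} (h : A ⊆ B) : reach G A v ⊆ reach G B v := by
  intro u hu
  exact Relation.ReflTransGen.mono (fun a b hab => ⟨hab.1, h hab.2⟩) _ _ hu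

theorem exists_walk_of_mem_reach (hu : u ∈ reach G A v) :
    ∃ p : G.Walk v u, ∀ x ∈ p.support, x ∈ reach G A v := by
  have hu' : Relation.ReflTransGen (fun a b => G.Adj a b ∧ b ∈ A) v u := hu
  induction hu' with
  | refl => exact ⟨SimpleGraph.Walk.nil, by simp [mem_reach_self]⟩
  | tail h1 h2 ih =>
    obtain ⟨p, hp⟩ := ih h1
    refine ⟨p.concat h2.1, ?_⟩
    intro x hx
    rw [SimpleGraph.Walk.support_concat, List.mem_append] at hx
    rcases hx with hx | hx
    · exact hp x hx
    · rw [List.mem_singleton] at hx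
      subst hx
      exact reach_step h1 h2.1 h2.2

theorem mem_setNeighbors {S : Set V} {x : V} :
    x ∈ setNeighbors G S ↔ x ∉ S ∧ ∃ y ∈ S, G.Adj x y := by
  simp [setNeighbors, vertexBoundary]

theorem notMem_of_mem_setNeighbors_reach (h : u ∈ setNeighbors G (reach G A v)) : u ∉ A := by
  rw [mem_setNeighbors] at h
  obtain ⟨h1, y, hy, hadj⟩ := h
  exact fun hu => h1 (reach_step hy hadj.symm hu)

/-- Two vertices of the neighborhood of a component are joined by a path through the component. -/
theorem exists_path_through_reach (hv : v ∈ A) {x y : V}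
    (hx : x ∈ setNeighbors G (reach G A v)) (hy : y ∈ setNeighbors G (reach G A v)) :
    ∃ p : G.Walk x y, p.IsPath ∧ ∀ z ∈ p.support, z = x ∨ z = y ∨ z ∈ reach G A v := by
  classical
  rw [mem_setNeighbors] at hx hy
  obtain ⟨-, a, ha, hxa⟩ := hx
  obtain ⟨-, b, hb, hyb⟩ := hy
  have hb' : b ∈ reach G A a := by rwa [reach_eq hv ha]
  obtain ⟨p, hp⟩ := exists_walk_of_mem_reach hb'
  rw [reach_eq hv ha] at hp
  let q : G.Walk x y := SimpleGraph.Walk.cons hxa (p.concat hyb.symm)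
  refine ⟨q.bypass, q.bypass_isPath, ?_⟩
  intro z hz
  have hz' := q.support_bypass_subset_support hz
  simp only [q, SimpleGraph.Walk.support_cons, SimpleGraph.Walk.support_concat, List.mem_cons,
    List.mem_append] at hz'
  rcases hz' with h | h | h
  · exact Or.inl h
  · exact Or.inr (Or.inr (hp z h))
  · exact Or.inr (Or.inl (by simpa using h))

end reach

theorem SimpleGraph.Walk.IsPath.length_support_le {V : Type} [Finite V] {G : SimpleGraph V}
    {u v : V} {p : G.Walk u v} (hp : p.IsPath) {S : Set V} (hS : ∀ x ∈ p.support, x ∈ S) :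
    p.support.length ≤ S.ncard := by
  classical
  rw [← List.toFinset_card_of_nodup hp.support_nodup, ← Set.ncard_coe_finset]
  refine Set.ncard_le_ncard ?_ (Set.toFinite _)
  intro x hx
  exact hS x (by simpa using hx)

/-- Subsets of a bounded-treewidth part of the graph together with few additional vertices have
bounded treewidth: add the vertices of `W ∩ X` to all bags. -/
theorem treewidthLT_induce {V : Type} [Finite V] {G : SimpleGraph V} {X W : Set V} {t b : ℕ}
    (h : TreewidthLT (G.induce Xᶜ) t) (hb : t + (W ∩ X).ncard ≤ b) :
    TreewidthLT (G.induce W) b := by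
  classical
  obtain ⟨D, hD⟩ := h
  have hf := D.finite_node
  obtain ⟨x0⟩ := D.isTree.connected.nonempty
  let bag : D.Node → Set W := fun x => {w | w.1 ∈ X ∨ ∃ h : w.1 ∈ Xᶜ, (⟨w.1, h⟩ : ↥Xᶜ) ∈ D.bag x}
  refine ⟨⟨D.Node, D.finite_node, D.tree, D.isTree, bag, ?_, ?_, ?_⟩, ?_⟩
  · intro v
    by_cases hv : v.1 ∈ X
    · exact ⟨x0, Or.inl hv⟩
    · obtain ⟨x, hx⟩ := D.cover_vertex ⟨v.1, hv⟩
      exact ⟨x, Or.inr ⟨hv, hx⟩⟩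
  · intro u v huv
    by_cases hu : u.1 ∈ X
    · by_cases hv : v.1 ∈ X
      · exact ⟨x0, Or.inl hu, Or.inl hv⟩
      · obtain ⟨x, hx⟩ := D.cover_vertex ⟨v.1, hv⟩
        exact ⟨x, Or.inl hu, Or.inr ⟨hv, hx⟩⟩
    · by_cases hv : v.1 ∈ X
      · obtain ⟨x, hx⟩ := D.cover_vertex ⟨u.1, hu⟩
        exact ⟨x, Or.inr ⟨hu, hx⟩, Or.inl hv⟩
      · obtain ⟨x, hx⟩ := D.cover_edge ⟨u.1, hu⟩ ⟨v.1, hv⟩ huv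
        exact ⟨x, Or.inr ⟨hu, hx.1⟩, Or.inr ⟨hv, hx.2⟩⟩
  · intro v
    by_cases hv : v.1 ∈ X
    · have : {x | v ∈ bag x} = Set.univ := by
        ext x
        simp [bag, hv]
      rw [this]
      exact (SimpleGraph.induceUnivIso D.tree).connected_iff.2 D.isTree.connected
    · have : {x | v ∈ bag x} = {x | (⟨v.1, hv⟩ : ↥Xᶜ) ∈ D.bag x} := by
        ext x
        simp [bag, hv]
      rw [this]
      exact D.subtree _
  · intro x
    refine le_trans ?_ hb
    change (bag x).ncard ≤ _
    rw [← Set.ncard_image_of_injective (bag x) Subtype.val_injective, add_comm]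
    have hsub : Subtype.val '' bag x ⊆ (W ∩ X) ∪ Subtype.val '' D.bag x := by
      rintro _ ⟨w, hw | ⟨h1, h2⟩, rfl⟩
      · exact Or.inl ⟨w.2, hw⟩
      · exact Or.inr ⟨_, h2, rfl⟩
    refine (Set.ncard_le_ncard hsub (Set.toFinite _)).trans ((Set.ncard_union_le _ _).trans ?_)
    refine Nat.add_le_add_left ?_ _
    exact (Set.ncard_image_le (Set.toFinite _)).trans (hD x)

/-! ### Marking bags of the elimination forest -/

/-- A set outside of the treewidth modulator `X` is a protrusion together with its neighborhood, if
the latter is small. -/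
theorem isProtrusion_union_setNeighbors {V : Type} [Finite V] {G : SimpleGraph V} {X S : Set V}
    {t ω : ℕ} (htw : TreewidthLT (G.induce Xᶜ) t) (hS : S ⊆ Xᶜ)
    (hN : (setNeighbors G S).ncard ≤ 2 * t + ω) (hNX : (setNeighbors G S ∩ X).ncard ≤ ω) :
    IsProtrusion G (2 * t + ω) (S ∪ setNeighbors G S) := by
  constructor
  · refine (Set.ncard_le_ncard ?_ (Set.toFinite _)).trans hN
    rintro x ⟨hx | hx, y, hy, hxy⟩
    · exfalso
      have hyS : y ∉ S := fun h => hy (Or.inl h)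
      exact hy (Or.inr (mem_setNeighbors.2 ⟨hyS, x, hx, hxy.symm⟩))
    · exact hx
  · refine treewidthLT_induce htw ?_
    have : (S ∪ setNeighbors G S) ∩ X ⊆ setNeighbors G S ∩ X := by
      rintro x ⟨hx | hx, hxX⟩
      · exact absurd hxX (hS hx)
      · exact ⟨hx, hxX⟩
    have := Set.ncard_le_ncard this (Set.toFinite _)
    omega

namespace ElimOrder

variable {V : Type} {G : SimpleGraph V} {X : Set V} {t : ℕ} (O : ElimOrder G Xᶜ t)

/-- The component of `v` among the unmarked vertices below `v`. -/
def comp (Y : Set V) (v : V) : Set V := reach G (O.below v \ Y) v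

variable {O}

theorem comp_subset {Y : Set V} {v : V} (hv : v ∉ Y) : O.comp Y v ⊆ O.below v \ Y :=
  reach_subset ⟨Le.refl v, hv⟩

theorem comp_subset_compl {Y : Set V} {v : V} (hvX : v ∈ Xᶜ) (hv : v ∉ Y) : O.comp Y v ⊆ Xᶜ :=
  fun _ hx => below_subset hvX (comp_subset hv hx).1

/-- Each component of the unmarked vertices of a down-closed set is of the form `O.comp Y r`: take
the vertex `r` of maximal rank, which all of the component lies below. -/
theorem exists_reach_eq_comp [Finite V] {B Y : Set V} {d : V} (hB : B ⊆ Xᶜ)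
    (hdown : ∀ a ∈ B, O.below a ⊆ B) (hd : d ∈ B \ Y) :
    ∃ r ∈ B \ Y, reach G (B \ Y) d = O.comp Y r := by
  have hne : (reach G (B \ Y) d).Nonempty := ⟨d, mem_reach_self⟩
  obtain ⟨r, hr, hmax⟩ := Set.exists_max_image (reach G (B \ Y) d) O.rank (Set.toFinite _) hne
  have hrB := reach_subset hd hr
  refine ⟨r, hrB, ?_⟩
  have hC : reach G (B \ Y) r = reach G (B \ Y) d := reach_eq hd hr
  rw [← hC] at hmax ⊢
  apply Set.Subset.antisymm
  · intro x hx
    have hx' : Relation.ReflTransGen (fun a b => G.Adj a b ∧ b ∈ B \ Y) r x := hx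
    induction hx' with
    | refl => exact mem_reach_self
    | tail h1 h2 ih =>
      rename_i a b
      have ha := ih h1
      have haT : O.Le a r := (comp_subset hrB.2 ha).1
      refine reach_step ha h2.1 ⟨?_, h2.2.2⟩
      have haB := reach_subset hrB h1
      rcases O.edge (hB haB.1) (hB h2.2.1) h2.1 with h | h
      · by_contra hbr
        have hbK := mem_of_not_le h haT hbr
        rcases O.up hbK with rfl | h
        · exact hbr (Le.refl _)
        · exact absurd (hmax b (reach_step h1 h2.1 h2.2)) (by omega)
      · exact (Le.of_mem h).trans haT
  · refine reach_mono ?_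
    intro x hx
    exact ⟨hdown r hrB.1 hx.1, hx.2⟩

/-- The neighbors outside `X` of the component at `v` are below `v` or in the bag of `v`. -/
theorem mem_below_or_mem_K {Y : Set V} {v x : V} (hvX : v ∈ Xᶜ) (hv : v ∉ Y)
    (hx : x ∈ setNeighbors G (O.comp Y v)) (hxX : x ∉ X) : x ∈ O.below v ∨ x ∈ O.K v := by
  rw [mem_setNeighbors] at hx
  obtain ⟨-, c, hc, hadj⟩ := hx
  by_cases hxv : O.Le x v
  · exact Or.inl hxv
  have hcv := (comp_subset hv hc).1
  rcases O.edge hxX (comp_subset_compl hvX hv hc) hadj with h | h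
  · exact Or.inl ((Le.of_mem h).trans hcv)
  · exact Or.inr (mem_of_not_le h hcv hxv)

/-- The component at `v` has few neighbors in `X` and few marked neighbors below `v`. -/
def Tame (O : ElimOrder G Xᶜ t) (ω : ℕ) (Y : Set V) (v : V) : Prop :=
  (setNeighbors G (O.comp Y v) ∩ X).ncard ≤ ω ∧
    (setNeighbors G (O.comp Y v) ∩ O.below v).ncard ≤ t

/-- There are at most `ω` neighbors in `X`, at most `t` neighbors below `v`, and at most `t`
neighbors in the bag of `v`. -/
theorem Tame.ncard_setNeighbors_le [Finite V] {ω : ℕ} {Y : Set V} {v : V} (h : O.Tame ω Y v)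
    (hvX : v ∈ Xᶜ) (hv : v ∉ Y) : (setNeighbors G (O.comp Y v)).ncard ≤ 2 * t + ω := by
  have hsub : setNeighbors G (O.comp Y v) ⊆ (setNeighbors G (O.comp Y v) ∩ X) ∪
      ((setNeighbors G (O.comp Y v) ∩ O.below v) ∪ O.K v) := by
    intro x hx
    by_cases hxX : x ∈ X
    · exact Or.inl ⟨hx, hxX⟩
    · rcases mem_below_or_mem_K hvX hv hx hxX with h | h
      · exact Or.inr (Or.inl ⟨hx, h⟩)
      · exact Or.inr (Or.inr h)
  have h1 := Set.ncard_le_ncard hsub (Set.toFinite _)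
  have h2 := Set.ncard_union_le (setNeighbors G (O.comp Y v) ∩ X)
    ((setNeighbors G (O.comp Y v) ∩ O.below v) ∪ O.K v)
  have h3 := Set.ncard_union_le (setNeighbors G (O.comp Y v) ∩ O.below v) (O.K v)
  have h4 := O.card_le v
  have := h.1
  have := h.2
  omega

/-- If the components at the unmarked vertices strictly below `v` are tame, then in a reduced graph
each neighbor of the component at `v` in `X` has a short path to `v` through that component: the
path runs through a component strictly below `v`, which is contained in a protrusion. -/
theorem exists_short_path [Finite V] {ω Q : ℕ} {Y : Set V} {v u : V}
    (htw : TreewidthLT (G.induce Xᶜ) t)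
    (hred : ∀ W, IsProtrusion G (2 * t + ω) W → W.ncard ≤ Q) (hQ : 2 ≤ Q)
    (hvX : v ∈ Xᶜ) (hv : v ∉ Y)
    (htame : ∀ r, r ∈ Xᶜ → r ∉ Y → O.rank r < O.rank v → O.Tame ω Y r)
    (huX : u ∈ X) (hu : u ∈ setNeighbors G (O.comp Y v)) :
    ∃ p : G.Walk u v, p.support.length ≤ Q ∧ ∀ x ∈ p.support, x = u ∨ x ∈ O.comp Y v := by
  rw [mem_setNeighbors] at hu
  obtain ⟨-, c, hc, huc⟩ := hu
  by_cases hcv : c = v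
  · subst hcv
    refine ⟨SimpleGraph.Walk.cons huc SimpleGraph.Walk.nil, by simpa using hQ, ?_⟩
    intro x hx
    simp only [SimpleGraph.Walk.support_cons, SimpleGraph.Walk.support_nil, List.mem_cons,
      List.not_mem_nil, or_false] at hx
    rcases hx with h | rfl
    · exact Or.inl h
    · exact Or.inr mem_reach_self
  have hvA : v ∈ O.below v \ Y := ⟨Le.refl v, hv⟩
  have hcA := comp_subset hv hc
  set A' : Set V := (O.below v \ {v}) \ Y with hA'
  have hcA' : c ∈ A' := ⟨⟨hcA.1, hcv⟩, hcA.2⟩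
  have hsub : A' ⊆ O.below v \ Y := fun x hx => ⟨hx.1.1, hx.2⟩
  -- The component of `c` in the vertices strictly below `v` has `v` as a neighbor.
  have hstep : ∀ x, x ∈ reach G (O.below v \ Y) c →
      x ∈ reach G A' c ∨ v ∈ setNeighbors G (reach G A' c) := by
    intro x hx
    have hx' : Relation.ReflTransGen (fun a b => G.Adj a b ∧ b ∈ O.below v \ Y) c x := hx
    induction hx' with
    | refl => exact Or.inl mem_reach_self
    | tail h1 h2 ih =>
      rename_i a b
      rcases ih h1 with h | h
      · by_cases hb : b = v
        · right
          subst hb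
          exact mem_setNeighbors.2 ⟨fun h' => (reach_subset hcA' h').1.2 rfl, a, h, h2.1.symm⟩
        · exact Or.inl (reach_step h h2.1 ⟨⟨h2.2.1, hb⟩, h2.2.2⟩)
      · exact Or.inr h
  have hvN : v ∈ setNeighbors G (reach G A' c) := by
    rcases hstep v (reach_symm hvA hc) with h | h
    · exact absurd rfl (reach_subset hcA' h).1.2
    · exact h
  have huN : u ∈ setNeighbors G (reach G A' c) := by
    refine mem_setNeighbors.2 ⟨fun h => ?_, c, mem_reach_self, huc⟩
    exact below_subset hvX (reach_subset hcA' h).1.1 huX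
  obtain ⟨r, hr, hreq⟩ := exists_reach_eq_comp (O := O) (B := O.below v \ {v}) (Y := Y) (d := c)
    (fun x hx => below_subset hvX hx.1) (by
      intro a ha b hb
      refine ⟨Le.trans hb ha.1, ?_⟩
      rintro rfl
      exact ha.2 (Le.eq_of_rank_le ha.1 (Le.rank_le hb))) hcA'
  have hrX : r ∈ Xᶜ := below_subset hvX hr.1.1
  have hrv : O.rank r < O.rank v := by
    rcases Nat.lt_or_ge (O.rank r) (O.rank v) with h | h
    · exact h
    · exact absurd (Le.eq_of_rank_le hr.1.1 h) hr.1.2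
  have ht := htame r hrX hr.2 hrv
  have hprot := isProtrusion_union_setNeighbors (ω := ω) htw (comp_subset_compl hrX hr.2)
    (ht.ncard_setNeighbors_le hrX hr.2) ht.1
  have hcard := hred _ hprot
  rw [← hreq] at hcard
  obtain ⟨p, hp, hps⟩ := exists_path_through_reach hcA' huN hvN
  refine ⟨p, (hp.length_support_le (fun x hx => ?_)).trans hcard, fun x hx => ?_⟩
  · rcases hps x hx with rfl | rfl | h
    · exact Or.inr huN
    · exact Or.inr hvN
    · exact Or.inl h
  · rcases hps x hx with h | rfl | h
    · exact Or.inl h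
    · exact Or.inr mem_reach_self
    · right
      have h1 := reach_mono hsub h
      rwa [reach_eq hvA hc] at h1

variable (O)

/-- The state of the marking process after the vertices of rank less than `i` have been processed:
the set `Y` of marked vertices, which is a union of bags `O.K m`; the links `L` found so far; the
set `act` of the vertices with a marked bag that suffice to describe `Y`; and the number `joins` of
those bags that were marked because there were two vertices of `act` below.  The other marked bags
are those at which a link was found.  Links have disjoint inner vertices because their inner
vertices are below a vertex of `act`, and such vertices are not reached by later components.  For
the unmarked vertices that have been processed, the neighbors of the component in `X` form a clique
(`clique`), and there are at most `t` neighbors below (`low`). -/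
structure Marking (d i : ℕ) where
  Y : Set V
  L : List (Link G X d)
  act : Finset V
  joins : ℕ
  Y_subset : Y ⊆ Xᶜ
  card_Y : Y.ncard ≤ t * (L.length + joins)
  card_act : joins + act.card ≤ L.length
  compat : L.Pairwise Link.Compatible
  inner_below : ∀ a ∈ L, ∀ x ∈ a.inner, ∃ m ∈ act, O.Le x m
  act_mem : ∀ m ∈ act, m ∈ Xᶜ ∧ O.rank m < i
  K_subset : ∀ m ∈ act, O.K m ⊆ Y
  Y_cases : ∀ y ∈ Y, ∃ m ∈ act, O.Le y m ∨ y ∈ O.K m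
  clique : ∀ v ∈ Xᶜ, O.rank v < i → v ∉ Y →
    (augment G L).IsClique (setNeighbors G (O.comp Y v) ∩ X)
  low : ∀ v ∈ Xᶜ, O.rank v < i → v ∉ Y → (setNeighbors G (O.comp Y v) ∩ O.below v).ncard ≤ t

variable {O} {d i : ℕ}

/-- Marking the bag of `v` does not affect the components at vertices of smaller rank. -/
theorem comp_union_K {Y : Set V} {v w : V} (h : O.rank w < O.rank v) :
    O.comp (Y ∪ O.K v) w = O.comp Y w := by
  unfold comp
  congr 1
  ext x
  constructor
  · rintro ⟨h1, h2⟩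
    exact ⟨h1, fun hx => h2 (Or.inl hx)⟩
  · rintro ⟨h1, h2⟩
    refine ⟨h1, ?_⟩
    rintro (hx | hx)
    · exact h2 hx
    · have h3 := Le.rank_le h1
      rcases O.up hx with rfl | h4 <;> omega

open Classical in
/-- Marks the bag of `v`, which replaces all vertices below it in `act`.  The hypotheses `hlen` and
`hact` hold if either a link has been added to the list, or `v` has two vertices of `act` below and
`joins` has been increased. -/
theorem Marking.mark [Finite V] (M : O.Marking d i) {v : V} (hvX : v ∈ Xᶜ) (hv : O.rank v = i)
    (L' : List (Link G X d)) (joins' : ℕ) (hL' : L'.Pairwise Link.Compatible)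
    (hle : augment G M.L ≤ augment G L')
    (hinner : ∀ a ∈ L', a ∈ M.L ∨ a.inner ⊆ O.below v)
    (hlen : M.L.length + M.joins + 1 ≤ L'.length + joins')
    (hact : joins' + (M.act.filter fun m => ¬ O.Le m v).card + 1 ≤ L'.length) :
    Nonempty (O.Marking d (i + 1)) := by
  have hvK : v ∈ O.K v := O.mem_self v hvX
  have hlift : ∀ m ∈ M.act, ∃ m' ∈ insert v (M.act.filter fun m => ¬ O.Le m v),
      m' = m ∨ (m' = v ∧ O.Le m v) := by
    intro m hm
    by_cases h : O.Le m v
    · exact ⟨v, Finset.mem_insert_self _ _, Or.inr ⟨rfl, h⟩⟩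
    · exact ⟨m, Finset.mem_insert_of_mem (Finset.mem_filter.2 ⟨hm, h⟩), Or.inl rfl⟩
  have hlow : ∀ w, O.rank w < i + 1 → w ∉ M.Y ∪ O.K v → O.rank w < i := by
    intro w hw hwY
    rcases Nat.lt_or_ge (O.rank w) i with h | h
    · exact h
    · exact absurd (Or.inr (O.rank_inj (hv.trans (by omega) : O.rank v = O.rank w) ▸ hvK)) hwY
  refine ⟨⟨M.Y ∪ O.K v, L', insert v (M.act.filter fun m => ¬ O.Le m v), joins', ?_, ?_, ?_, hL',
    ?_, ?_, ?_, ?_, ?_, ?_⟩⟩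
  · exact Set.union_subset M.Y_subset (O.subset v)
  · have h1 := Set.ncard_union_le M.Y (O.K v)
    have h2 := O.card_le v
    have h3 := M.card_Y
    have h4 := Nat.mul_le_mul_left t hlen
    rw [Nat.mul_add, mul_one] at h4
    omega
  · have := Finset.card_insert_le v (M.act.filter fun m => ¬ O.Le m v)
    omega
  · intro a ha x hx
    rcases hinner a ha with h | h
    · obtain ⟨m, hm, hxm⟩ := M.inner_below a h x hx
      obtain ⟨m', hm', h⟩ := hlift m hm
      refine ⟨m', hm', ?_⟩
      rcases h with rfl | ⟨rfl, h⟩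
      · exact hxm
      · exact hxm.trans h
    · exact ⟨v, Finset.mem_insert_self _ _, h hx⟩
  · intro m hm
    rcases Finset.mem_insert.1 hm with rfl | hm
    · exact ⟨hvX, by omega⟩
    · have := M.act_mem m (Finset.mem_filter.1 hm).1
      exact ⟨this.1, by omega⟩
  · intro m hm
    rcases Finset.mem_insert.1 hm with rfl | hm
    · exact Set.subset_union_right
    · exact (M.K_subset m (Finset.mem_filter.1 hm).1).trans Set.subset_union_left
  · rintro y (hy | hy)
    · obtain ⟨m, hm, hym⟩ := M.Y_cases y hy
      obtain ⟨m', hm', h⟩ := hlift m hm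
      refine ⟨m', hm', ?_⟩
      rcases h with rfl | ⟨rfl, h⟩
      · exact hym
      · rcases hym with h' | h'
        · exact Or.inl (h'.trans h)
        · by_cases hy' : O.Le y m'
          · exact Or.inl hy'
          · exact Or.inr (mem_of_not_le h' h hy')
    · exact ⟨v, Finset.mem_insert_self _ _, Or.inr hy⟩
  · intro w hwX hw hwY
    have hwi := hlow w hw hwY
    rw [comp_union_K (by omega)]
    exact (M.clique w hwX hwi fun h => hwY (Or.inl h)).mono hle
  · intro w hwX hw hwY
    have hwi := hlow w hw hwY
    rw [comp_union_K (by omega)]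
    exact M.low w hwX hwi fun h => hwY (Or.inl h)

/-- The component at `v` does not meet the vertices below an active vertex that is not above `v`. -/
theorem Marking.notMem_comp (M : O.Marking d i) {v m x : V} (hvX : v ∈ Xᶜ) (hv : v ∉ M.Y)
    (hm : m ∈ M.act) (hvm : ¬ O.Le v m) (hx : x ∈ O.comp M.Y v) : ¬ O.Le x m := by
  have hx' : Relation.ReflTransGen (fun a b => G.Adj a b ∧ b ∈ O.below v \ M.Y) v x := hx
  induction hx' with
  | refl => exact hvm
  | tail h1 h2 ih =>
    rename_i a b
    have ha : ¬ O.Le a m := ih h1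
    have haA := comp_subset hv h1
    intro hb
    rcases O.edge (below_subset hvX haA.1) (below_subset hvX h2.2.1) h2.1 with h | h
    · exact ha ((Le.of_mem h).trans hb)
    · exact haA.2 (M.K_subset m hm (mem_of_not_le h hb ha))

/-- The marked neighbors below `v` of the component at `v` all lie in the bag of one active vertex
below `v`. -/
theorem Marking.exists_mem_K (M : O.Marking d i) {v y : V} (hvX : v ∈ Xᶜ) (hvi : i ≤ O.rank v)
    (hv : v ∉ M.Y) (hy : y ∈ setNeighbors G (O.comp M.Y v)) (hyv : y ∈ O.below v) :
    ∃ m ∈ M.act, O.Le m v ∧ y ∈ O.K m := by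
  have hyY : y ∈ M.Y := by
    by_contra h
    exact notMem_of_mem_setNeighbors_reach hy ⟨hyv, h⟩
  obtain ⟨m, hm, h⟩ := M.Y_cases y hyY
  have hvm : ¬ O.Le v m := fun h => by
    have := h.rank_le
    have := (M.act_mem m hm).2
    omega
  rcases h with h | h
  · rcases le_total_of_le hyv h with h' | h'
    · exact absurd h' hvm
    refine ⟨m, hm, h', ?_⟩
    rw [mem_setNeighbors] at hy
    obtain ⟨-, c, hc, hadj⟩ := hy
    have hcm := M.notMem_comp hvX hv hm hvm hc
    rcases O.edge (below_subset hvX hyv) (comp_subset_compl hvX hv hc) hadj with h1 | h1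
    · exact absurd (M.K_subset m hm (mem_of_not_le h1 h hcm)) (comp_subset hv hc).2
    · exact absurd ((Le.of_mem h1).trans h) hcm
  · exact ⟨m, hm, (Le.of_mem h).trans hyv, h⟩

open Classical in
/-- Processes the vertex `v` of rank `i`.  Its bag is marked if two vertices of `act` are below `v`,
or if two neighbors in `X` of the component at `v` are not adjacent in the graph augmented so far.
In the latter case, two short paths from these neighbors to `v` yield a new link. -/
theorem Marking.step [Finite V] {ω Q : ℕ} (M : O.Marking d i) (htw : TreewidthLT (G.induce Xᶜ) t)
    (hred : ∀ W, IsProtrusion G (2 * t + ω) W → W.ncard ≤ Q) (hQ : 2 ≤ Q) (hd : 2 * Q ≤ d)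
    (hω : ∀ L : List (Link G X d), L.Pairwise Link.Compatible → ∀ S ⊆ X,
      (augment G L).IsClique S → S.ncard ≤ ω) :
    Nonempty (O.Marking d (i + 1)) := by
  by_cases hex : ∃ v ∈ Xᶜ, O.rank v = i
  swap
  · push Not at hex
    have hlt : ∀ v ∈ Xᶜ, O.rank v < i + 1 → O.rank v < i := fun v hv h =>
      lt_of_le_of_ne (by omega) (hex v hv)
    exact ⟨{ M with
      act_mem := fun m hm => ⟨(M.act_mem m hm).1, by have := (M.act_mem m hm).2; omega⟩
      clique := fun v hv h => M.clique v hv (hlt v hv h)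
      low := fun v hv h => M.low v hv (hlt v hv h) }⟩
  obtain ⟨v, hvX, hv⟩ := hex
  have heq : ∀ w, O.rank w < i + 1 → O.rank w < i ∨ w = v := by
    intro w hw
    rcases Nat.lt_or_ge (O.rank w) i with h | h
    · exact Or.inl h
    · exact Or.inr (O.rank_inj (by omega))
  have hsplit : (M.act.filter fun m => O.Le m v).card + (M.act.filter fun m => ¬ O.Le m v).card =
      M.act.card := Finset.card_filter_add_card_filter_not _
  by_cases hjoin : 2 ≤ (M.act.filter fun m => O.Le m v).card
  · have hc := M.card_act
    exact M.mark hvX hv M.L (M.joins + 1) M.compat le_rfl (fun a ha => Or.inl ha) (by omega)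
      (by omega)
  by_cases hvY : v ∈ M.Y
  · exact ⟨{ M with
      act_mem := fun m hm => ⟨(M.act_mem m hm).1, by have := (M.act_mem m hm).2; omega⟩
      clique := fun w hw h hwY => by
        rcases heq w h with h | rfl
        · exact M.clique w hw h hwY
        · exact absurd hvY hwY
      low := fun w hw h hwY => by
        rcases heq w h with h | rfl
        · exact M.low w hw h hwY
        · exact absurd hvY hwY }⟩
  by_cases hcl : (augment G M.L).IsClique (setNeighbors G (O.comp M.Y v) ∩ X)
  · refine ⟨{ M with
      act_mem := fun m hm => ⟨(M.act_mem m hm).1, by have := (M.act_mem m hm).2; omega⟩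
      clique := fun w hw h hwY => ?_
      low := fun w hw h hwY => ?_ }⟩
    · rcases heq w h with h | rfl
      · exact M.clique w hw h hwY
      · exact hcl
    · rcases heq w h with h | rfl
      · exact M.low w hw h hwY
      rcases Set.eq_empty_or_nonempty (setNeighbors G (O.comp M.Y w) ∩ O.below w) with he | ⟨y, hy⟩
      · simp [he]
      obtain ⟨m, hm, hmw, -⟩ := M.exists_mem_K hvX hv.ge hvY hy.1 hy.2
      refine (Set.ncard_le_ncard (t := O.K m) ?_ (Set.toFinite _)).trans (O.card_le m)
      intro y' hy'
      obtain ⟨m', hm', hmw', hy'K⟩ := M.exists_mem_K hvX hv.ge hvY hy'.1 hy'.2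
      have h1 : (M.act.filter fun m => O.Le m w).card ≤ 1 := by omega
      rw [Finset.card_le_one] at h1
      rw [h1 m (Finset.mem_filter.2 ⟨hm, hmw⟩) m' (Finset.mem_filter.2 ⟨hm', hmw'⟩)]
      exact hy'K
  -- Two neighbors of the component in `X` are not adjacent yet: join them by a new link.
  have htame : ∀ r, r ∈ Xᶜ → r ∉ M.Y → O.rank r < O.rank v → O.Tame ω M.Y r := fun r hr hrY hrv =>
    ⟨hω M.L M.compat _ Set.inter_subset_right (M.clique r hr (by omega) hrY),
      M.low r hr (by omega) hrY⟩
  rw [SimpleGraph.isClique_iff, Set.Pairwise] at hcl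
  push Not at hcl
  obtain ⟨x, hx, y, hy, hxy, hnadj⟩ := hcl
  rw [augment_adj] at hnadj
  push Not at hnadj
  obtain ⟨p, hp, hps⟩ := exists_short_path htw hred hQ hvX hvY htame hx.2 hx.1
  obtain ⟨q, hq, hqs⟩ := exists_short_path htw hred hQ hvX hvY htame hy.2 hy.1
  have hsupp : ∀ z ∈ (p.append q.reverse).bypass.support, z ≠ x → z ≠ y →
      z ∈ O.comp M.Y v := by
    intro z hz hzx hzy
    have hz' := (p.append q.reverse).support_bypass_subset_support hz
    rw [SimpleGraph.Walk.mem_support_append_iff, SimpleGraph.Walk.support_reverse,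
      List.mem_reverse] at hz'
    rcases hz' with h | h
    · exact (hps z h).resolve_left hzx
    · exact (hqs z h).resolve_left hzy
  let a : Link G X d :=
    { src := x
      dst := y
      walk := (p.append q.reverse).bypass
      isPath := SimpleGraph.Walk.bypass_isPath _
      ne := hxy
      not_adj := hnadj.1
      src_mem := hx.2
      dst_mem := hy.2
      inner_notMem := fun z hz hzx hzy => comp_subset_compl hvX hvY (hsupp z hz hzx hzy)
      length_le := by
        have h1 := (p.append q.reverse).length_bypass_le_length
        rw [SimpleGraph.Walk.length_append, SimpleGraph.Walk.length_reverse] at h1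
        rw [SimpleGraph.Walk.length_support] at hp hq ⊢
        omega }
  have ha : a.inner ⊆ O.comp M.Y v := fun z hz => hsupp z hz.1 hz.2.1 hz.2.2
  have hc := M.card_act
  refine M.mark hvX hv (a :: M.L) M.joins ?_ (augment_mono a) ?_ ?_ ?_
  · rw [List.pairwise_cons]
    refine ⟨fun b hb => ⟨Set.disjoint_left.2 fun z hza hzb => ?_, fun h => hnadj.2 b hb h.symm⟩,
      M.compat⟩
    obtain ⟨m, hm, hzm⟩ := M.inner_below b hb z hzb
    refine M.notMem_comp hvX hvY hm ?_ (ha hza) hzm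
    intro h
    have := h.rank_le
    have := (M.act_mem m hm).2
    omega
  · intro b hb
    rcases List.mem_cons.1 hb with rfl | hb
    · exact Or.inr fun z hz => (comp_subset hvY (ha hz)).1
    · exact Or.inl hb
  · simp only [List.length_cons]
    omega
  · simp only [List.length_cons]
    omega

/-- There are a set `Y` of marked vertices and links `L` with ends in `X`, at most `2t` marked
vertices for each link, such that all components of unmarked vertices are tame. -/
theorem exists_marked [Finite V] {ω Q : ℕ} (htw : TreewidthLT (G.induce Xᶜ) t)
    (hred : ∀ W, IsProtrusion G (2 * t + ω) W → W.ncard ≤ Q) (hQ : 2 ≤ Q) (hd : 2 * Q ≤ d)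
    (hω : ∀ L : List (Link G X d), L.Pairwise Link.Compatible → ∀ S ⊆ X,
      (augment G L).IsClique S → S.ncard ≤ ω) :
    ∃ (Y : Set V) (L : List (Link G X d)), Y ⊆ Xᶜ ∧ L.Pairwise Link.Compatible ∧
      Y.ncard ≤ 2 * t * L.length ∧ ∀ v ∈ Xᶜ, v ∉ Y → O.Tame ω Y v := by
  have hall : ∀ i, Nonempty (O.Marking d i) := by
    intro i
    induction i with
    | zero =>
      exact ⟨⟨∅, [], ∅, 0, by simp, by simp, by simp, by simp, by simp, by simp, by simp, by simp,
        by simp, by simp⟩⟩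
    | succ i ih =>
      obtain ⟨M⟩ := ih
      exact M.step htw hred hQ hd hω
  obtain ⟨N, hN⟩ := (Set.finite_range O.rank).bddAbove
  obtain ⟨M⟩ := hall (N + 1)
  have hlt : ∀ v, O.rank v < N + 1 := fun v => Nat.lt_succ_of_le (hN ⟨v, rfl⟩)
  refine ⟨M.Y, M.L, M.Y_subset, M.compat, ?_, fun v hv hvY =>
    ⟨hω M.L M.compat _ Set.inter_subset_right (M.clique v hv (hlt v) hvY),
      M.low v hv (hlt v) hvY⟩⟩
  refine M.card_Y.trans ?_
  have h1 : M.L.length + M.joins ≤ 2 * M.L.length := by have := M.card_act; omega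
  -- Each join uses up a vertex of `act`, and each link produces at most one.
  calc t * (M.L.length + M.joins) ≤ t * (2 * M.L.length) := Nat.mul_le_mul_left t h1
    _ = 2 * t * M.L.length := by ring

/-- A set of marked vertices with tame components can be enlarged one vertex at a time. -/
theorem exists_marked_of_card [Finite V] {ω : ℕ} {Y : Set V} (hY : Y ⊆ Xᶜ)
    (htame : ∀ v ∈ Xᶜ, v ∉ Y → O.Tame ω Y v) {n : ℕ} (hn : (X ∪ Y).ncard ≤ n)
    (hn' : n ≤ Nat.card V) :
    ∃ Y' : Set V, Y' ⊆ Xᶜ ∧ (X ∪ Y').ncard = n ∧ ∀ v ∈ Xᶜ, v ∉ Y' → O.Tame ω Y' v := by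
  induction n, hn using Nat.le_induction with
  | base => exact ⟨Y, hY, rfl, htame⟩
  | succ n hn ih =>
    obtain ⟨Y', hY', hcard, ht⟩ := ih (by omega)
    have hne : ((X ∪ Y')ᶜ).Nonempty := by
      by_contra h
      rw [Set.not_nonempty_iff_eq_empty, Set.compl_empty_iff] at h
      rw [h, Set.ncard_univ] at hcard
      omega
    -- A vertex of maximal rank is not below any other unmarked vertex.
    obtain ⟨z, hz, hmax⟩ := Set.exists_max_image _ O.rank (Set.toFinite _) hne
    have hzX : z ∈ Xᶜ := fun h => hz (Or.inl h)
    refine ⟨insert z Y', Set.insert_subset hzX hY', ?_, ?_⟩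
    · rw [Set.union_insert, Set.ncard_insert_of_notMem hz (Set.toFinite _), hcard]
    · intro v hv hvY
      have hvY' : v ∉ Y' := fun h => hvY (Or.inr h)
      have hvz : v ≠ z := fun h => hvY (Or.inl h)
      have hcomp : O.comp (insert z Y') v = O.comp Y' v := by
        unfold comp
        congr 1
        ext x
        constructor
        · rintro ⟨h1, h2⟩
          exact ⟨h1, fun h => h2 (Or.inr h)⟩
        · rintro ⟨h1, h2⟩
          refine ⟨h1, ?_⟩
          rintro (rfl | h)
          · exact hvz (Le.eq_of_rank_le h1
              (hmax v fun h => h.elim hv hvY')).symm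
          · exact h2 h
      have := ht v hv hvY'
      unfold Tame at this ⊢
      rwa [hcomp]

end ElimOrder

/-! ### Counting the neighborhoods of components -/

theorem exists_link_through_reach {V : Type} [Finite V] {G : SimpleGraph V} {Y : Set V} {d : ℕ}
    {v x y : V} (hv : v ∈ Yᶜ) (hx : x ∈ setNeighbors G (reach G Yᶜ v))
    (hy : y ∈ setNeighbors G (reach G Yᶜ v)) (hxy : x ≠ y) (hadj : ¬ G.Adj x y)
    (hd : (reach G Yᶜ v ∪ setNeighbors G (reach G Yᶜ v)).ncard ≤ d) :
    ∃ a : Link G Y d, a.ends = s(x, y) ∧ a.inner ⊆ reach G Yᶜ v := by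
  obtain ⟨p, hp, hps⟩ := exists_path_through_reach hv hx hy
  have hinner : ∀ z ∈ p.support, z ≠ x → z ≠ y → z ∈ reach G Yᶜ v := fun z hz h1 h2 =>
    ((hps z hz).resolve_left h1).resolve_left h2
  exact ⟨{
    src := x
    dst := y
    walk := p
    isPath := hp
    ne := hxy
    not_adj := hadj
    src_mem := not_not.1 (notMem_of_mem_setNeighbors_reach hx)
    dst_mem := not_not.1 (notMem_of_mem_setNeighbors_reach hy)
    inner_notMem := fun z hz h1 h2 => reach_subset hv (hinner z hz h1 h2)
    length_le := (hp.length_support_le fun z hz => by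
      rcases hps z hz with rfl | rfl | h
      · exact Or.inr hx
      · exact Or.inr hy
      · exact Or.inl h).trans hd }, rfl, fun z hz => hinner z hz.1 hz.2.1 hz.2.2⟩

/-- The neighborhoods of the components of `G - Y` can be mapped injectively to cliques of a
constriction of `G` to `Y`.  They are treated by increasing size: a neighborhood that is a clique
already is mapped to itself, any other one is used to join two of its vertices and is mapped to
this pair.  A neighborhood that is mapped to itself is never one of these pairs, because it would
be contained in, and hence treated before, the neighborhood that has been mapped to the pair. -/
theorem exists_links_injOn_cliques {V : Type} [Finite V] {G : SimpleGraph V} {Y : Set V} {d : ℕ}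
    (s : Finset (Set V)) (hs : ∀ S ∈ s, ∃ v ∈ Yᶜ, setNeighbors G (reach G Yᶜ v) = S ∧
      (reach G Yᶜ v ∪ S).ncard ≤ d) :
    ∃ L : List (Link G Y d), L.Pairwise Link.Compatible ∧
      (∀ a ∈ L, ∃ v ∈ Yᶜ, setNeighbors G (reach G Yᶜ v) ∈ s ∧ a.inner ⊆ reach G Yᶜ v) ∧
      ∃ φ : Set V → Set V, Set.InjOn φ s ∧ ∀ S ∈ s, φ S ⊆ S ∧ (augment G L).IsClique (φ S) ∧
        (φ S = S ∨ (φ S).ncard = 2) := by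
  classical
  induction s using Finset.induction_on_max_value (fun S : Set V => S.ncard) with
  | empty => exact ⟨[], by simp, by simp, id, by simp, by simp⟩
  | insert S s hS hmax ih =>
    obtain ⟨L, hL, hin, φ, hφ, hφs⟩ := ih fun S hS => hs S (Finset.mem_insert_of_mem hS)
    have hne : ∀ S' ∈ s, S' ≠ S := fun S' h h' => hS (h' ▸ h)
    have hout : ∀ A S', S' ∈ s → Function.update φ S A S' = φ S' := fun A S' h =>
      Function.update_of_ne (hne S' h) _ _
    by_cases hcl : (augment G L).IsClique S
    · refine ⟨L, hL, fun a ha => ?_, Function.update φ S S, ?_, ?_⟩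
      · obtain ⟨v, hv, hvs, h⟩ := hin a ha
        exact ⟨v, hv, Finset.mem_insert_of_mem hvs, h⟩
      · rw [Finset.coe_insert, Set.injOn_insert (by simpa using hS)]
        refine ⟨fun A hA B hB hAB => ?_, ?_⟩
        · rw [hout _ A hA, hout _ B hB] at hAB
          exact hφ hA hB hAB
        · rw [Function.update_self]
          rintro ⟨S', hS', h⟩
          rw [hout _ S' hS'] at h
          obtain ⟨h1, -, h2⟩ := hφs S' hS'
          have hsub : S ⊆ S' := h ▸ h1
          exact hne S' hS' (Set.eq_of_subset_of_ncard_le hsub (hmax S' hS') (Set.toFinite _)).symm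
      · intro S' hS'
        rcases Finset.mem_insert.1 hS' with rfl | hS'
        · rw [Function.update_self]
          exact ⟨subset_rfl, hcl, Or.inl rfl⟩
        · rw [hout _ S' hS']
          exact hφs S' hS'
    · rw [SimpleGraph.isClique_iff, Set.Pairwise] at hcl
      push Not at hcl
      obtain ⟨x, hx, y, hy, hxy, hadj⟩ := hcl
      have hadj' := hadj
      rw [augment_adj] at hadj
      push Not at hadj
      obtain ⟨v, hv, hvS, hd⟩ := hs S (Finset.mem_insert_self _ _)
      obtain ⟨a, ha, hav⟩ := exists_link_through_reach (d := d) hv (hvS ▸ hx) (hvS ▸ hy) hxy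
        hadj.1 (by rwa [hvS])
      have hmono := augment_mono (L := L) a
      refine ⟨a :: L, ?_, ?_, Function.update φ S {x, y}, ?_, ?_⟩
      · rw [List.pairwise_cons]
        refine ⟨fun b hb => ⟨Set.disjoint_left.2 fun z hza hzb => ?_, fun h => ?_⟩, hL⟩
        · obtain ⟨v', hv', hvs, h⟩ := hin b hb
          have h1 := reach_eq hv (hav hza)
          have h2 := reach_eq hv' (h hzb)
          rw [← h2, h1, hvS] at hvs
          exact hS hvs
        · exact hadj.2 b hb (h.symm.trans ha)
      · intro b hb
        rcases List.mem_cons.1 hb with rfl | hb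
        · exact ⟨v, hv, hvS ▸ Finset.mem_insert_self _ _, hav⟩
        · obtain ⟨v, hv, hvs, h⟩ := hin b hb
          exact ⟨v, hv, Finset.mem_insert_of_mem hvs, h⟩
      · rw [Finset.coe_insert, Set.injOn_insert (by simpa using hS)]
        refine ⟨fun A hA B hB hAB => ?_, ?_⟩
        · rw [hout _ A hA, hout _ B hB] at hAB
          exact hφ hA hB hAB
        · rw [Function.update_self]
          rintro ⟨S', hS', h⟩
          rw [hout _ S' hS'] at h
          obtain ⟨-, h1, -⟩ := hφs S' hS'
          rw [h] at h1
          exact hadj' (h1 (by simp) (by simp) hxy)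
      · intro S' hS'
        rcases Finset.mem_insert.1 hS' with rfl | hS'
        · rw [Function.update_self]
          refine ⟨?_, ?_, Or.inr (Set.ncard_pair hxy)⟩
          · rintro z (rfl | rfl)
            · exact hx
            · exact hy
          · rw [SimpleGraph.isClique_pair]
            intro _
            rw [augment_adj]
            exact Or.inr ⟨a, List.mem_cons_self, ha⟩
        · rw [hout _ S' hS']
          obtain ⟨h1, h2, h3⟩ := hφs S' hS'
          exact ⟨h1, h2.mono hmono, h3⟩

/-- The summand `1` accounts for the empty neighborhood, since only nonempty cliques are counted. -/
theorem card_neighborhoods_le {𝒢 ℋ : GraphClass} {d : ℕ} (hd : DConstrictsInto d 𝒢 ℋ)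
    {fK : ℕ → ℕ} (hK : ∀ {W : Type} [Finite W] (H : SimpleGraph W), ℋ.mem H →
      numCliques H ≤ fK (Nat.card W))
    {V : Type} [Finite V] {G : SimpleGraph V} (hG : 𝒢.mem G) {Y : Set V} (s : Finset (Set V))
    (hs : ∀ S ∈ s, ∃ v ∈ Yᶜ, setNeighbors G (reach G Yᶜ v) = S ∧ (reach G Yᶜ v ∪ S).ncard ≤ d) :
    s.card ≤ fK Y.ncard + 1 := by
  classical
  obtain ⟨L, hL, -, φ, hφ, hφs⟩ := exists_links_injOn_cliques s hs
  have h1 := hK _ (hd.mem_augment hG hL)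
  rw [Nat.card_coe_set_eq] at h1
  have hsub : ∀ S ∈ s, φ S ⊆ Y := by
    intro S hS x hx
    obtain ⟨v, hv, rfl, -⟩ := hs S hS
    exact not_not.1 (notMem_of_mem_setNeighbors_reach ((hφs _ hS).1 hx))
  have h2 : (s.erase ∅).card ≤ numCliques ((augment G L).induce Y) := by
    rw [← Set.ncard_coe_finset, numCliques]
    refine Set.ncard_le_ncard_of_injOn (fun S => Subtype.val ⁻¹' φ S) ?_ ?_ (Set.toFinite _)
    · intro S hS
      rw [Finset.mem_coe, Finset.mem_erase] at hS
      obtain ⟨h1, h2, h3⟩ := hφs S hS.2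
      have hne : (φ S).Nonempty := by
        rcases h3 with h | h
        · rw [h]
          exact Set.nonempty_iff_ne_empty.2 hS.1
        · exact Set.nonempty_of_ncard_ne_zero (by omega)
      refine ⟨?_, fun x hx y hy hxy => h2 hx hy fun h => hxy (Subtype.ext h)⟩
      obtain ⟨x, hx⟩ := hne
      exact ⟨⟨x, hsub S hS.2 hx⟩, hx⟩
    · intro A hA B hB hAB
      rw [Finset.mem_coe, Finset.mem_erase] at hA hB
      refine hφ hA.2 hB.2 ?_
      have := congrArg (fun T => Subtype.val '' T) hAB
      simpa [Subtype.image_preimage_coe, Set.inter_eq_right.2 (hsub A hA.2),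
        Set.inter_eq_right.2 (hsub B hB.2)] using this
  have h3 := Finset.pred_card_le_card_erase (s := s) (a := ∅)
  omega

/-! ### The protrusion decomposition of a reduced instance -/

theorem isProtrusionDecomposition_univ {V : Type} (G : SimpleGraph V) (b : ℕ) :
    IsProtrusionDecomposition G (max 0 (Set.univ : Set V).ncard) b 0 (fun _ => Set.univ) where
  cover := Set.eq_univ_iff_forall.2 fun _ => Set.mem_iUnion.2 ⟨0, Set.mem_univ _⟩
  disjoint i j hij := absurd (Fin.ext (by omega)) hij
  neighbors i hi := absurd (Fin.ext (by omega)) hi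
  card_le := le_rfl
  protrusion i hi := absurd (Fin.ext (by omega)) hi

/-- In a reduced graph, let `Y₀` consist of the treewidth modulator `X` and of the marked vertices.
The other parts of the decomposition unite the components of `G - Y₀` with the same neighborhood.
If `G` is small, then `Y₀` may contain all vertices; otherwise `X` and `Y₀` are enlarged to have
exactly `s k` and `sepBound s fE t k` vertices, since `fE` and `fK` need not be monotone. -/
theorem exists_protrusionDecomposition
    {𝒢 ℋ : GraphClass} {fE fK : ℕ → ℕ} {ω : ℕ}
    (hE : ∀ {W : Type} [Finite W] (H : SimpleGraph W), ℋ.mem H →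
      H.edgeSet.ncard ≤ fE (Nat.card W))
    (hK : ∀ {W : Type} [Finite W] (H : SimpleGraph W), ℋ.mem H →
      numCliques H ≤ fK (Nat.card W))
    (hω : ∀ {W : Type} [Finite W] (H : SimpleGraph W), ℋ.mem H → H.cliqueNum < ω)
    {s : ℕ → ℕ} {t Q d k : ℕ} (hd : 2 * Q ≤ d) (hQ : 2 * (2 * t + ω) ≤ Q)
    (hcon : DConstrictsInto d 𝒢 ℋ)
    {V : Type} [Finite V] {G : SimpleGraph V} (hG : 𝒢.mem G)
    (hst : ∃ X : Set V, X.ncard ≤ s k ∧ TreewidthLT (G.induce Xᶜ) t)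
    (hred : ∀ W, IsProtrusion G (2 * t + ω) W → W.ncard ≤ Q) :
    ∃ (l : ℕ) (Y : Fin (l + 1) → Set V),
      IsProtrusionDecomposition G (max l (Y 0).ncard) (2 * t + ω) l Y ∧
      (Y 0).ncard ≤ sepBound s fE t k ∧
      (∀ i, i ≠ 0 → (Y i).ncard ≤ Q) ∧
      l ≤ fK (sepBound s fE t k) + 1 := by
  classical
  by_cases hV : Nat.card V ≤ sepBound s fE t k
  · exact ⟨0, fun _ => Set.univ, isProtrusionDecomposition_univ G _, by rwa [Set.ncard_univ],
      fun i hi => absurd (Fin.ext (by omega)) hi, Nat.zero_le _⟩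
  rw [not_le] at hV
  -- Some graph is in `ℋ`, hence `2 ≤ Q`.
  have hω0 : 0 < ω :=
    (Nat.zero_le _).trans_lt (hω _ (hcon.mem_augment (L := ([] : List (Link G ∅ d))) hG (by simp)))
  have hsx : s k ≤ sepBound s fE t k := Nat.le_add_right _ _
  -- The treewidth modulator may be taken to have exactly `s k` vertices.
  obtain ⟨X₀, hX₀, htw₀⟩ := hst
  obtain ⟨X, hXX, -, hX⟩ := Set.exists_subsuperset_card_eq (Set.subset_univ X₀) hX₀
    (by rw [Set.ncard_univ]; omega)
  have htw : TreewidthLT (G.induce Xᶜ) t := by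
    refine treewidthLT_induce htw₀ ?_
    have : Xᶜ ∩ X₀ = ∅ := by
      ext x
      simp only [Set.mem_inter_iff, Set.mem_compl_iff, Set.mem_empty_iff_false, iff_false, not_and]
      exact fun h1 h2 => h1 (hXX h2)
    simp [this]
  obtain ⟨O⟩ := htw.exists_elimOrder
  have hclique : ∀ L : List (Link G X d), L.Pairwise Link.Compatible → ∀ S ⊆ X,
      (augment G L).IsClique S → S.ncard ≤ ω := fun L hL S hS hc =>
    (ncard_clique_le hS hc).trans (hω _ (hcon.mem_augment hG hL)).le
  obtain ⟨Y₁, L, hY₁, hL, hcard, htame₁⟩ :=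
    O.exists_marked (ω := ω) htw hred (by omega) hd hclique
  have hLE : L.length ≤ fE (s k) := by
    refine (length_le_ncard_edgeSet hL).trans ?_
    have := hE _ (hcon.mem_augment hG hL)
    rwa [Nat.card_coe_set_eq, hX] at this
  have hle : (X ∪ Y₁).ncard ≤ sepBound s fE t k := by
    refine (Set.ncard_union_le _ _).trans ?_
    rw [hX]
    exact Nat.add_le_add_left (hcard.trans (Nat.mul_le_mul_left _ hLE)) _
  obtain ⟨Y₂, hY₂, hcard₂, htame⟩ := O.exists_marked_of_card hY₁ htame₁ hle hV.le
  set Y₀ := X ∪ Y₂ with hY₀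
  let nb : V → Set V := fun v => setNeighbors G (reach G Y₀ᶜ v)
  let 𝒮 : Finset (Set V) := (Set.toFinite (nb '' Y₀ᶜ)).toFinset
  have h𝒮 : ∀ S, S ∈ 𝒮 ↔ ∃ v ∈ Y₀ᶜ, nb v = S := by simp [𝒮]
  let part : Set V → Set V := fun S => {v | v ∈ Y₀ᶜ ∧ nb v = S}
  have hcompl : Y₀ᶜ = Xᶜ \ Y₂ := by
    ext x
    simp [hY₀]
  have hpartX : ∀ S, part S ⊆ Xᶜ := fun S v hv h => hv.1 (Or.inl h)
  have hnbv : ∀ v ∈ Y₀ᶜ, (nb v).ncard ≤ 2 * t + ω ∧ (nb v ∩ X).ncard ≤ ω := by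
    intro v hv
    rw [hcompl] at hv
    obtain ⟨r, hr, hreq⟩ := ElimOrder.exists_reach_eq_comp (O := O) subset_rfl
      (fun a ha => ElimOrder.below_subset ha) hv
    have h := htame r hr.1 hr.2
    simp only [nb, hcompl, hreq]
    exact ⟨h.ncard_setNeighbors_le hr.1 hr.2, h.1⟩
  have hpart : ∀ S ∈ 𝒮, setNeighbors G (part S) = S := by
    intro S hS
    obtain ⟨v, hv, rfl⟩ := (h𝒮 S).1 hS
    ext x
    rw [mem_setNeighbors]
    constructor
    · rintro ⟨hx, y, ⟨hy, hyv⟩, hxy⟩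
      rw [← hyv]
      refine mem_setNeighbors.2 ⟨fun h => hx ⟨reach_subset hy h, ?_⟩, y, mem_reach_self, hxy⟩
      rw [← hyv]
      simp only [nb, reach_eq hy h]
    · intro hx
      have hxA := notMem_of_mem_setNeighbors_reach hx
      obtain ⟨-, y, hy, hxy⟩ := mem_setNeighbors.1 hx
      exact ⟨fun h => hxA h.1, y, ⟨reach_subset hv hy, by simp only [nb, reach_eq hv hy]⟩, hxy⟩
  have hsubY : ∀ S ∈ 𝒮, S ⊆ Y₀ := by
    intro S hS x hx
    obtain ⟨v, hv, rfl⟩ := (h𝒮 S).1 hS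
    exact not_not.1 (notMem_of_mem_setNeighbors_reach hx)
  have hprot : ∀ S ∈ 𝒮, IsProtrusion G (2 * t + ω) (part S ∪ S) := by
    intro S hS
    have h := hpart S hS
    obtain ⟨v, hv, hvS⟩ := (h𝒮 S).1 hS
    have h' := hnbv v hv
    rw [hvS] at h'
    have := isProtrusion_union_setNeighbors (ω := ω) htw (hpartX S) (by rw [h]; exact h'.1)
      (by rw [h]; exact h'.2)
    rwa [h] at this
  have hcount : 𝒮.card ≤ fK (sepBound s fE t k) + 1 := by
    rw [← hcard₂]
    refine card_neighborhoods_le hcon hK hG 𝒮 ?_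
    intro S hS
    obtain ⟨v, hv, hvS⟩ := (h𝒮 S).1 hS
    refine ⟨v, hv, hvS, le_trans (Set.ncard_le_ncard ?_ (Set.toFinite _))
      ((hred _ (hprot S hS)).trans (by omega))⟩
    refine Set.union_subset_union_left _ fun x hx => ⟨reach_subset hv hx, ?_⟩
    rw [← hvS]
    simp only [nb, reach_eq hv hx]
  let e := 𝒮.equivFin
  let Y : Fin (𝒮.card + 1) → Set V := Fin.cons Y₀ fun i => part (e.symm i).1
  have hY0 : Y 0 = Y₀ := rfl
  have hYs : ∀ i, Y (Fin.succ i) = part (e.symm i).1 := fun i => rfl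
  have hdisj : ∀ i j : Fin (𝒮.card + 1), i < j → Disjoint (Y i) (Y j) := by
    intro i j hij
    obtain ⟨j, rfl⟩ := Fin.exists_succ_eq.2 (Fin.pos_iff_ne_zero.1 ((Fin.zero_le i).trans_lt hij))
    rw [Set.disjoint_left]
    intro x hx hxj
    rw [hYs] at hxj
    rcases Fin.eq_zero_or_eq_succ i with rfl | ⟨i, rfl⟩
    · exact hxj.1 hx
    · rw [hYs] at hx
      have : (e.symm i).1 = (e.symm j).1 := hx.2.symm.trans hxj.2
      have := e.symm.injective (Subtype.ext this)
      exact absurd (congrArg Fin.succ this) hij.ne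
  refine ⟨𝒮.card, Y, ⟨?_, ?_, ?_, le_rfl, ?_⟩, ?_, ?_, hcount⟩
  · rw [Set.eq_univ_iff_forall]
    intro v
    rw [Set.mem_iUnion]
    by_cases hv : v ∈ Y₀
    · exact ⟨0, hv⟩
    · refine ⟨Fin.succ (e ⟨nb v, (h𝒮 _).2 ⟨v, hv, rfl⟩⟩), ?_⟩
      rw [hYs, Equiv.symm_apply_apply]
      exact ⟨hv, rfl⟩
  · intro i j hij
    rcases lt_or_gt_of_ne hij with h | h
    · exact hdisj i j h
    · exact (hdisj j i h).symm
  · intro i hi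
    obtain ⟨i, rfl⟩ := Fin.exists_succ_eq.2 hi
    rw [hYs, hpart _ (e.symm i).2]
    exact hsubY _ (e.symm i).2
  · intro i hi
    obtain ⟨i, rfl⟩ := Fin.exists_succ_eq.2 hi
    rw [hYs, hpart _ (e.symm i).2, hY0, Set.inter_eq_left.2 (hsubY _ (e.symm i).2)]
    exact hprot _ (e.symm i).2
  · rw [hY0, hcard₂]
  · intro i hi
    obtain ⟨i, rfl⟩ := Fin.exists_succ_eq.2 hi
    rw [hYs]
    exact (Set.ncard_le_ncard Set.subset_union_left (Set.toFinite _)).trans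
      (hred _ (hprot _ (e.symm i).2))

theorem IsProtrusionDecomposition.card_le_add_mul {V : Type} [Finite V] {G : SimpleGraph V}
    {α b l Q : ℕ} {Y : Fin (l + 1) → Set V} (h : IsProtrusionDecomposition G α b l Y)
    (hY : ∀ i, i ≠ 0 → (Y i).ncard ≤ Q) : Nat.card V ≤ (Y 0).ncard + l * Q := by
  have h1 : (Set.univ : Set V) ⊆ Y 0 ∪ ⋃ i : Fin l, Y i.succ := by
    rw [← h.cover]
    intro x hx
    obtain ⟨i, hi⟩ := Set.mem_iUnion.1 hx
    rcases Fin.eq_zero_or_eq_succ i with rfl | ⟨i, rfl⟩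
    · exact Or.inl hi
    · exact Or.inr (Set.mem_iUnion.2 ⟨i, hi⟩)
  rw [← Set.ncard_univ]
  refine (Set.ncard_le_ncard h1 (Set.toFinite _)).trans ((Set.ncard_union_le _ _).trans ?_)
  refine Nat.add_le_add_left ?_ _
  refine (Set.ncard_iUnion_le_of_fintype _).trans ?_
  refine (Finset.sum_le_card_nsmul _ _ Q fun i _ => hY _ (Fin.succ_ne_zero i)).trans ?_
  simp

/-! ### Representatives -/

/-- In each class of equivalent boundaried graphs there is one with the smallest shift: if some
gluing `A ⊕ F` is in the problem for some parameter, take `A` with the smallest such parameter. -/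
theorem exists_minimal_representative (P : GraphProblem) (C : GraphClass) (b : ℕ)
    (B : {A : BoundariedGraph b // C.mem A.graph}) :
    ∃ A : {A : BoundariedGraph b // C.mem A.graph}, (equivSetoid P C b).r A B ∧
      ∀ B' : {A : BoundariedGraph b // C.mem A.graph}, (equivSetoid P C b).r A B' →
        ∃ δ : ℤ, 0 ≤ δ ∧ EquivShift P C δ A.1 B'.1 := by
  by_cases hex : ∃ (A : {A : BoundariedGraph b // C.mem A.graph}) (F : BoundariedGraph b) (k : ℕ),
      (equivSetoid P C b).r A B ∧ P.mem (glue A.1 F) k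
  · obtain ⟨A₀, F, k₀, hA₀, hk₀⟩ := hex
    let p : ℕ → Prop := fun k => ∃ A : {A : BoundariedGraph b // C.mem A.graph},
      (equivSetoid P C b).r A B ∧ P.mem (glue A.1 F) k
    have hp : ∃ k, p k := ⟨k₀, A₀, hA₀, hk₀⟩
    classical
    obtain ⟨A, hA, hAk⟩ := Nat.find_spec hp
    refine ⟨A, hA, fun B' hB' => ?_⟩
    obtain ⟨δ, hδ⟩ := hB'
    refine ⟨δ, ?_, hδ⟩
    obtain ⟨m, hm, hmem⟩ := ((hδ F).2 (Nat.find hp)).1 ⟨_, rfl, hAk⟩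
    have : Nat.find hp ≤ m := Nat.find_min' hp
      ⟨B', (equivSetoid P C b).trans ((equivSetoid P C b).symm ⟨δ, hδ⟩) hA, hmem⟩
    omega
  · push Not at hex
    refine ⟨B, (equivSetoid P C b).refl B, fun B' hB' => ⟨0, le_rfl, ?_⟩⟩
    intro F
    obtain ⟨δ, hδ⟩ := hB'
    refine ⟨(hδ F).1, fun k => ⟨?_, ?_⟩⟩
    · rintro ⟨m, -, hm⟩
      exact absurd hm (hex B F m ((equivSetoid P C b).refl B))
    · rintro ⟨m, -, hm⟩
      exact absurd hm (hex B' F m ((equivSetoid P C b).symm ⟨δ, hδ⟩))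

theorem HasFII.exists_isRepresentativeFamily {P : GraphProblem} {C : GraphClass}
    (h : HasFII P C) : ∃ R : ∀ b : ℕ, Set (BoundariedGraph b), IsRepresentativeFamily P C R := by
  choose f hf1 hf2 using exists_minimal_representative P C
  refine ⟨fun b => Set.range fun q : Quotient (equivSetoid P C b) => (f b q.out).1, fun b => ?_⟩
  have := h b
  refine ⟨Set.finite_range _, ?_, ?_⟩
  · rintro _ ⟨q, rfl⟩
    exact (f b q.out).2
  · intro B hB
    refine ⟨_, ⟨Quotient.mk (equivSetoid P C b) ⟨B, hB⟩, rfl⟩, ?_⟩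
    exact hf2 b _ ⟨B, hB⟩ ((equivSetoid P C b).trans (hf1 b _) (Quotient.mk_out (s :=
      equivSetoid P C b) ⟨B, hB⟩))

/-! ### Large protrusions contain protrusions of bounded size -/

/-- A `b`-protrusion with more than `Q ≥ b` vertices contains a set of more than `Q` and at most
`2Q` vertices with a boundary of at most `2b` vertices.  It is found as a minimal down-closed set
`D` of the elimination forest, together with a set `S` of at most `b` vertices that contains the
upper neighbors of `D`, with more than `Q` vertices in total. -/
theorem IsProtrusion.exists_bounded {V : Type} [Finite V] {G : SimpleGraph V} {W : Set V}
    {b Q : ℕ} (hW : IsProtrusion G b W) (hb : b ≤ Q) (hQ : Q < W.ncard) :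
    ∃ W' : Set V, Q < W'.ncard ∧ W'.ncard ≤ 2 * Q ∧ (vertexBoundary G W').ncard ≤ 2 * b := by
  classical
  obtain ⟨O⟩ := hW.2.exists_elimOrder
  let p : ℕ → Prop := fun n => ∃ D S : Set V, D ⊆ W ∧ D.ncard = n ∧ S.ncard ≤ b ∧
    (∀ a ∈ D, O.below a ⊆ D) ∧ (∀ a ∈ D, ∀ x ∈ O.K a, x ∈ D ∨ x ∈ S) ∧ Q < (D ∪ S).ncard
  have hp : ∃ n, p n := ⟨_, W, ∅, subset_rfl, rfl, by simp,
    fun a ha => ElimOrder.below_subset ha, fun a _ x hx => Or.inl (O.subset a hx), by simpa⟩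
  obtain ⟨D, S, hDW, hD, hS, hdown, hup, hlarge⟩ := Nat.find_spec hp
  have hmin : ∀ D' S' : Set V, D' ⊆ D → D' ≠ D → S'.ncard ≤ b →
      (∀ a ∈ D', O.below a ⊆ D') → (∀ a ∈ D', ∀ x ∈ O.K a, x ∈ D' ∨ x ∈ S') →
      (D' ∪ S').ncard ≤ Q := by
    intro D' S' h1 h2 h3 h4 h5
    by_contra h
    have hlt : D'.ncard < Nat.find hp := by
      rw [← hD]
      exact Set.ncard_lt_ncard (h1.ssubset_of_ne h2) (Set.toFinite _)
    exact Nat.find_min hp hlt ⟨D', S', h1.trans hDW, rfl, h3, h4, h5, not_le.1 h⟩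
  refine ⟨D ∪ S, hlarge, ?_, ?_⟩
  · have hne : D.Nonempty := by
      by_contra h
      rw [Set.not_nonempty_iff_eq_empty] at h
      rw [h, Set.empty_union] at hlarge
      omega
    obtain ⟨r, hr, hmax⟩ := Set.exists_max_image D O.rank (Set.toFinite _) hne
    have hrK : ∀ x ∈ O.K r, x ∈ D → x = r := by
      intro x hx hxD
      rcases O.up hx with h | h
      · exact h
      · exact absurd (hmax x hxD) (by omega)
    by_cases hT : O.below r = D
    · -- `D` has a single root, which can be removed.
      have h1 := hmin (D \ {r}) (O.K r) Set.sdiff_subset (fun h => ((Set.ext_iff.1 h r).2 hr).2 rfl)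
        (O.card_le r) (fun a ha x hx => ⟨hdown a ha.1 hx, by
          rintro rfl
          exact ha.2 ((ElimOrder.Le.eq_of_rank_le hx (hmax a ha.1)).symm)⟩) (by
          intro a ha x hx
          by_cases hxr : x = r
          · exact Or.inr (hxr ▸ O.mem_self r (hDW hr))
          by_cases hxD : x ∈ D
          · exact Or.inl ⟨hxD, hxr⟩
          · refine Or.inr (ElimOrder.mem_of_not_le hx (hT.symm ▸ ha.1 : a ∈ O.below r) ?_)
            exact fun h => hxD (hT ▸ h : x ∈ D))
      have h2 : D ⊆ (D \ {r}) ∪ O.K r := by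
        intro x hx
        by_cases hxr : x = r
        · exact Or.inr (hxr ▸ O.mem_self r (hDW hr))
        · exact Or.inl ⟨hx, hxr⟩
      have h3 := Set.ncard_le_ncard h2 (Set.toFinite _)
      have h4 := Set.ncard_union_le D S
      omega
    · -- `D` splits into the vertices below `r` and the others.
      have hsub := hdown r hr
      have h1 := hmin (O.below r) S hsub hT hS (fun a ha x hx => ElimOrder.Le.trans hx ha) (by
        intro a ha x hx
        by_cases hxr : O.Le x r
        · exact Or.inl hxr
        · right
          refine (hup a (hsub ha) x hx).resolve_left fun hxD => ?_
          have := hrK x (ElimOrder.mem_of_not_le hx ha hxr) hxD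
          subst this
          exact hxr (ElimOrder.Le.refl x))
      have h2 := hmin (D \ O.below r) S Set.sdiff_subset
        (fun h => ((Set.ext_iff.1 h r).2 hr).2 (ElimOrder.Le.refl r)) hS (by
          intro a ha x hx
          refine ⟨hdown a ha.1 hx, fun hxr => ?_⟩
          rcases ElimOrder.le_total_of_le (hx : O.Le x a) hxr with h | h
          · exact ha.2 h
          · exact ha.2 (ElimOrder.Le.eq_of_rank_le h (hmax a ha.1) ▸ ElimOrder.Le.refl r)) (by
          intro a ha x hx
          by_cases hxD : x ∈ D
          · refine Or.inl ⟨hxD, fun hxr => ha.2 ((ElimOrder.Le.of_mem hx).trans hxr)⟩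
          · exact Or.inr ((hup a ha.1 x hx).resolve_left hxD))
      have h3 : D ∪ S ⊆ (O.below r ∪ S) ∪ (D \ O.below r ∪ S) := by
        rintro x (hx | hx)
        · by_cases hxr : x ∈ O.below r
          · exact Or.inl (Or.inl hxr)
          · exact Or.inr (Or.inl ⟨hx, hxr⟩)
        · exact Or.inl (Or.inr hx)
      have h4 := Set.ncard_le_ncard h3 (Set.toFinite _)
      have h5 := Set.ncard_union_le (O.below r ∪ S) (D \ O.below r ∪ S)
      omega
  · have h1 : vertexBoundary G (D ∪ S) ⊆ S ∪ vertexBoundary G W := by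
      rintro x ⟨hx | hx, y, hy, hxy⟩
      · by_cases hyW : y ∈ W
        · exfalso
          rcases O.edge (hDW hx) hyW hxy with h | h
          · exact hy (hup x hx y h)
          · exact hy (Or.inl (hdown x hx (ElimOrder.Le.of_mem h)))
        · exact Or.inr ⟨hDW hx, y, hyW, hxy⟩
      · exact Or.inl hx
    have h2 := Set.ncard_le_ncard h1 (Set.toFinite _)
    have h3 := Set.ncard_union_le S (vertexBoundary G W)
    have h4 := hW.1
    omega

/-! ### Replacing protrusions -/

/-- `E` with the edges among the vertices `w i` replaced by those of the pattern `H`. -/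
def patch {V : Type*} {c : ℕ} (E : SimpleGraph V) (w : Fin c → V) (H : SimpleGraph (Fin c)) :
    SimpleGraph V where
  Adj x y := (∃ i j, w i = x ∧ w j = y ∧ H.Adj i j ∧ x ≠ y) ∨
    (¬ ((∃ i, w i = x) ∧ ∃ j, w j = y) ∧ E.Adj x y)
  symm := ⟨by
    rintro x y (⟨i, j, hi, hj, h, hne⟩ | ⟨h1, h2⟩)
    · exact Or.inl ⟨j, i, hj, hi, h.symm, hne.symm⟩
    · exact Or.inr ⟨fun h => h1 ⟨h.2, h.1⟩, h2.symm⟩⟩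
  loopless := ⟨by
    rintro x (⟨i, j, -, -, -, h⟩ | ⟨-, h⟩)
    · exact h rfl
    · exact E.loopless.irrefl x h⟩

/-- The part of the graph `E`, on the vertex set `S`, outside of a boundaried graph that has the
vertices `w i`, the first `b` of which are its boundary. -/
def outsidePart {b c : ℕ} (hbc : b ≤ c) (E : SimpleGraph ℕ) (S : Finset ℕ) (w : Fin c → ℕ)
    (hw : Function.Injective w) (hS : ∀ i, w i ∈ S) : BoundariedGraph b where
  V := {x : ℕ // x ∈ S ∧ ∀ j : Fin c, b ≤ j → w j ≠ x}
  finite_V := Finite.of_injective (β := {x // x ∈ S}) (fun x => ⟨x.1, x.2.1⟩)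
    fun _ _ h => Subtype.ext (Subtype.mk.inj h)
  graph :=
    { Adj := fun x y => E.Adj x.1 y.1 ∧ ¬ ((∃ i, w i = x.1) ∧ ∃ j, w j = y.1)
      symm := ⟨fun _ _ h => ⟨h.1.symm, fun h' => h.2 ⟨h'.2, h'.1⟩⟩⟩
      loopless := ⟨fun x h => E.loopless.irrefl _ h.1⟩ }
  bd := ⟨fun i => ⟨w (Fin.castLE hbc i), hS _, fun j hj h => by
      have h1 := congrArg Fin.val (hw h)
      have h2 : (Fin.castLE hbc i).val = i.val := rfl
      have h3 := i.2
      omega⟩,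
    fun i j h => Fin.castLE_injective hbc (hw (congrArg Subtype.val h))⟩

/-- Gluing `A` to the outside part amounts to patching `A` in. -/
theorem nonempty_glue_outsidePart_iso {b c : ℕ} (hbc : b ≤ c) (E : SimpleGraph ℕ) (S : Finset ℕ)
    (w : Fin c → ℕ) (hw : Function.Injective w) (hS : ∀ i, w i ∈ S)
    (hin : ∀ j : Fin c, b ≤ j → ∀ x ∈ S, (∀ i, w i ≠ x) → ¬ E.Adj (w j) x)
    (A : BoundariedGraph b) (φ : A.V ↪ Fin c) (hφ : ∀ i, φ (A.bd i) = Fin.castLE hbc i)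
    (S' : Finset ℕ) (hS' : ∀ x, x ∈ S' ↔ x ∈ S ∧ ∀ j, w j = x → j ∈ Set.range φ) :
    Nonempty (glue A (outsidePart hbc E S w hw hS) ≃g
      (patch E w (A.graph.map φ)).induce (S' : Set ℕ)) := by
  classical
  set F := outsidePart hbc E S w hw hS with hF
  let f : GlueVertex A F → ℕ := Sum.elim (fun a => w (φ a)) fun x => x.1.1
  have hFbd : ∀ x : F.V, x ∈ Set.range F.bd ↔ ∃ j, w j = x.1 := by
    intro x
    constructor
    · rintro ⟨i, rfl⟩
      exact ⟨Fin.castLE hbc i, rfl⟩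
    · rintro ⟨j, hj⟩
      have hjb : j.1 < b := by
        by_contra h
        exact x.2.2 j (not_lt.1 h) hj
      exact ⟨⟨j, hjb⟩, Subtype.ext hj⟩
  have hfinj : Function.Injective f := by
    rintro (a | x) (a' | x') h
    · exact congrArg Sum.inl (φ.injective (hw h))
    · exact absurd ((hFbd x'.1).2 ⟨_, h⟩) x'.2
    · exact absurd ((hFbd x.1).2 ⟨_, h.symm⟩) x.2
    · exact congrArg Sum.inr (Subtype.ext (Subtype.ext h))
  have hfS : ∀ p, f p ∈ S' := by
    rintro (a | x)
    · exact (hS' _).2 ⟨hS _, fun j hj => ⟨a, (hw hj).symm⟩⟩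
    · exact (hS' _).2 ⟨x.1.2.1, fun j hj => absurd ((hFbd x.1).2 ⟨j, hj⟩) x.2⟩
  have hfsurj : ∀ x ∈ S', ∃ p, f p = x := by
    intro x hx
    rw [hS'] at hx
    by_cases h : ∃ j, w j = x
    · obtain ⟨j, hj⟩ := h
      obtain ⟨a, ha⟩ := hx.2 j hj
      exact ⟨Sum.inl a, by simp [f, ha, hj]⟩
    · let y : F.V := ⟨x, hx.1, fun j _ hj => h ⟨j, hj⟩⟩
      exact ⟨Sum.inr ⟨y, fun hy => h ((hFbd y).1 hy)⟩, rfl⟩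
  have hfR : ∀ x : F.V, f (glueRight A F x) = x.1 := by
    intro x
    unfold glueRight
    split_ifs with h
    · have h1 : F.bd h.choose = x := h.choose_spec
      change w (φ (A.bd h.choose)) = x.1
      rw [hφ]
      exact congrArg Subtype.val h1
    · rfl
  let e : GlueVertex A F ≃ (S' : Set ℕ) := Equiv.ofBijective (fun p => ⟨f p, hfS p⟩)
    ⟨fun p q h => hfinj (congrArg Subtype.val h), fun x => by
      obtain ⟨p, hp⟩ := hfsurj x.1 x.2
      exact ⟨p, Subtype.ext hp⟩⟩
  refine ⟨⟨e, ?_⟩⟩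
  intro p q
  change (patch E w (A.graph.map φ)).Adj (f p) (f q) ↔ (glue A F).Adj p q
  simp only [patch, glue, SimpleGraph.sup_adj, SimpleGraph.map_adj']
  constructor
  · rintro (⟨i, j, hi, hj, ⟨-, a, a', ha, rfl, rfl⟩, hne⟩ | ⟨h1, h2⟩)
    · have hp : Sum.inl a = p := hfinj hi
      have hq : Sum.inl a' = q := hfinj hj
      exact Or.inl ⟨fun h => hne (congrArg f h), a, a', ha, hp, hq⟩
    · right
      have hfp := ((hS' _).1 (hfS p)).1
      have hfq := ((hS' _).1 (hfS q)).1
      let x : F.V := ⟨f p, hfp, fun j hj hjx => by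
        refine hin j hj (f q) hfq (fun i hi => h1 ⟨⟨j, hjx⟩, i, hi⟩) ?_
        rwa [hjx]⟩
      let y : F.V := ⟨f q, hfq, fun j hj hjx => by
        refine hin j hj (f p) hfp (fun i hi => h1 ⟨⟨i, hi⟩, j, hjx⟩) ?_
        rw [hjx]
        exact h2.symm⟩
      exact ⟨fun h => E.ne_of_adj h2 (congrArg f h), x, y, ⟨h2, h1⟩, hfinj (hfR x), hfinj (hfR y)⟩
  · rintro (⟨hne, a, a', ha, rfl, rfl⟩ | ⟨hne, x, y, hxy, rfl, rfl⟩)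
    · exact Or.inl ⟨φ a, φ a', rfl, rfl, ⟨fun h => ha.ne (φ.injective h), a, a', ha, rfl, rfl⟩,
        fun h => hne (hfinj h)⟩
    · rw [hfR, hfR]
      exact Or.inr ⟨hxy.2, hxy.1⟩

/-- The pattern `H` occurs in the graph `E` on the vertex set `S` at the vertices `w i`, and only
the first `b` of these vertices have neighbors other than the `w i`. -/
structure OccursAt {c : ℕ} (b : ℕ) (H : SimpleGraph (Fin c)) (E : SimpleGraph ℕ) (S : Finset ℕ)
    (w : Fin c → ℕ) : Prop where
  inj : Function.Injective w
  mem : ∀ i, w i ∈ S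
  adj : ∀ i j, E.Adj (w i) (w j) ↔ H.Adj i j
  inside : ∀ j : Fin c, b ≤ j → ∀ x ∈ S, (∀ i, w i ≠ x) → ¬ E.Adj (w j) x

/-- A replacement rule: where `pat` occurs, replace it by `new`, delete all its vertices but those
in `keep`, and decrease the parameter by `shift`. -/
structure Rule (c : ℕ) where
  pat : SimpleGraph (Fin c)
  new : SimpleGraph (Fin c)
  keep : Finset (Fin c)
  shift : ℕ

namespace Rule

variable {c : ℕ}

open Classical in
/-- The vertices that remain after an application of the rule at `w`. -/
noncomputable def remaining (r : Rule c) (S : Finset ℕ) (w : Fin c → ℕ) : Finset ℕ :=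
  S.filter fun x => ∀ j, w j = x → j ∈ r.keep

theorem mem_remaining {r : Rule c} {S : Finset ℕ} {w : Fin c → ℕ} {x : ℕ} :
    x ∈ r.remaining S w ↔ x ∈ S ∧ ∀ j, w j = x → j ∈ r.keep := by
  simp [remaining]

/-- The rule maps instances to equivalent ones. -/
def Sound (r : Rule c) (P : GraphProblem) (C : GraphClass) (b : ℕ) : Prop :=
  ∀ (E : SimpleGraph ℕ) (S : Finset ℕ) (w : Fin c → ℕ), OccursAt b r.pat E S w →
    (C.mem (E.induce (S : Set ℕ)) ↔
      C.mem ((patch E w r.new).induce (r.remaining S w : Set ℕ))) ∧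
    ∀ k : ℤ, P.memInt (E.induce (S : Set ℕ)) k ↔
      P.memInt ((patch E w r.new).induce (r.remaining S w : Set ℕ)) (k - r.shift)

theorem card_remaining_lt {r : Rule c} {S : Finset ℕ} {w : Fin c → ℕ} {b : ℕ}
    {E : SimpleGraph ℕ} (hr : ∃ j, j ∉ r.keep) (h : OccursAt b r.pat E S w) :
    (r.remaining S w).card < S.card := by
  classical
  obtain ⟨j, hj⟩ := hr
  refine Finset.card_lt_card ⟨Finset.filter_subset _ _, fun hsub => ?_⟩
  exact hj ((mem_remaining.1 (hsub (h.mem j))).2 j rfl)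

end Rule

/-- The elements of a finite type can be numbered such that prescribed elements come first. -/
theorem exists_equiv_fin_extending {α : Type} [Finite α] {b : ℕ} (f : Fin b ↪ α) :
    ∃ e : Fin (Nat.card α) ≃ α, ∀ (i : Fin b) (h : i.1 < Nat.card α), e ⟨i, h⟩ = f i := by
  classical
  have : Fintype α := Fintype.ofFinite α
  have hb : b ≤ Nat.card α := by
    have := Finite.card_le_of_embedding f
    rwa [Nat.card_fin] at this
  rcases Nat.eq_zero_or_pos b with rfl | hb0
  · exact ⟨(Finite.equivFin α).symm, fun i => i.elim0⟩
  let g : Fin (Nat.card α) → α := fun i => if h : i.1 < b then f ⟨i, h⟩ else f ⟨0, hb0⟩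
  have hg : Set.InjOn g ((Finset.univ.filter fun i : Fin (Nat.card α) => i.1 < b) : Set _) := by
    intro i hi j hj hij
    have hi' : i.1 < b := by simpa using hi
    have hj' : j.1 < b := by simpa using hj
    simp only [g, hi', hj', dif_pos] at hij
    exact Fin.ext (Fin.mk.inj (f.injective hij))
  obtain ⟨e, he⟩ := Finset.exists_equiv_extend_of_card_eq (t := (Finset.univ : Finset α))
    (by rw [Fintype.card_fin, Finset.card_univ, Nat.card_eq_fintype_card])
    (Finset.subset_univ _) hg
  refine ⟨e.trans ((Equiv.subtypeUnivEquiv (by simp))), fun i h => ?_⟩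
  have := he ⟨i, h⟩ (by simp)
  simp only [g, i.2, dif_pos] at this
  exact this

theorem memInt_iso {P : GraphProblem} {V W : Type} [Finite V] [Finite W] {G : SimpleGraph V}
    {H : SimpleGraph W} (e : G ≃g H) (k : ℤ) : P.memInt G k ↔ P.memInt H k := by
  constructor
  · rintro ⟨m, hm, h⟩
    exact ⟨m, hm, P.mem_of_iso e h⟩
  · rintro ⟨m, hm, h⟩
    exact ⟨m, hm, P.mem_of_iso e.symm h⟩

theorem GraphClass.mem_iso (C : GraphClass) {V W : Type} [Finite V] [Finite W] {G : SimpleGraph V}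
    {H : SimpleGraph W} (e : G ≃g H) : C.mem G ↔ C.mem H :=
  ⟨C.mem_of_iso e, C.mem_of_iso e.symm⟩

/-- Each pattern in the class that is larger than the protrusion limit can be replaced by a smaller
one, namely by its representative, embedded such that the boundary vertices stay in place.  Since
the shift of the representative is nonnegative, the parameter does not increase. -/
theorem IsRepresentativeFamily.exists_rule {P : GraphProblem} {C : GraphClass}
    {R : ∀ b : ℕ, Set (BoundariedGraph b)} (hR : IsRepresentativeFamily P C R) {b c : ℕ}
    (hc : protLimit R b < c) (H : SimpleGraph (Fin c)) (hH : C.mem H) :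
    ∃ r : Rule c, r.pat = H ∧ r.Sound P C b ∧ ∃ j, j ∉ r.keep := by
  classical
  have hbc : b ≤ c := (le_max_left _ _).trans hc.le
  let B : BoundariedGraph b := ⟨Fin c, inferInstance, H, Fin.castLEEmb hbc⟩
  obtain ⟨A, hA, δ, hδ, hequiv⟩ := (hR b).2.2 B hH
  have hAcard : Nat.card A.V ≤ protLimit R b :=
    (le_csSup ((hR b).1.image fun A : BoundariedGraph b => Nat.card A.V).bddAbove
      (Set.mem_image_of_mem (fun A : BoundariedGraph b => Nat.card A.V) hA)).trans
      (le_max_right _ _)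
  obtain ⟨e, he⟩ := exists_equiv_fin_extending A.bd
  have hbA : b ≤ Nat.card A.V := by
    have := Finite.card_le_of_embedding A.bd
    rwa [Nat.card_fin] at this
  let φ : A.V ↪ Fin c :=
    ⟨fun a => Fin.castLE (hAcard.trans hc.le) (e.symm a),
      (Fin.castLE_injective _).comp e.symm.injective⟩
  have hφ : ∀ i, φ (A.bd i) = Fin.castLE hbc i := by
    intro i
    have h := he i (i.2.trans_le hbA)
    have h' : e.symm (A.bd i) = ⟨i, i.2.trans_le hbA⟩ := by rw [← h, Equiv.symm_apply_apply]
    simp only [φ, Function.Embedding.coeFn_mk, h']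
    rfl
  lift δ to ℕ using hδ
  refine ⟨⟨H, A.graph.map φ, (Set.toFinite (Set.range φ)).toFinset, δ⟩, rfl, ?_, ?_⟩
  · intro E S w hocc
    have hinst := hocc.adj
    obtain ⟨isoB⟩ := nonempty_glue_outsidePart_iso hbc E S w hocc.inj hocc.mem hocc.inside B
      (Function.Embedding.refl _) (fun i => rfl) S (by simp)
    have hpatch : patch E w (B.graph.map (Function.Embedding.refl (Fin c))) = E := by
      ext x y
      simp only [patch, SimpleGraph.map_adj', Function.Embedding.refl_apply]
      constructor
      · rintro (⟨i, j, rfl, rfl, ⟨-, i', j', h, rfl, rfl⟩, -⟩ | h)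
        · exact (hinst _ _).2 h
        · exact h.2
      · intro h
        by_cases hex : (∃ i, w i = x) ∧ ∃ j, w j = y
        · obtain ⟨⟨i, rfl⟩, j, rfl⟩ := hex
          have h' := (hinst _ _).1 h
          exact Or.inl ⟨i, j, rfl, rfl, ⟨h'.ne, i, j, h', rfl, rfl⟩, h.ne⟩
        · exact Or.inr ⟨hex, h⟩
    rw [hpatch] at isoB
    obtain ⟨isoA⟩ := nonempty_glue_outsidePart_iso hbc E S w hocc.inj hocc.mem hocc.inside A
      φ hφ (Rule.remaining ⟨H, A.graph.map φ, (Set.toFinite (Set.range φ)).toFinset, δ⟩ S w)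
      (fun x => by simp [Rule.mem_remaining])
    have hF := hequiv (outsidePart hbc E S w hocc.inj hocc.mem)
    refine ⟨(C.mem_iso isoB).symm.trans (hF.1.symm.trans (C.mem_iso isoA)), fun k => ?_⟩
    rw [← memInt_iso isoB, ← memInt_iso isoA]
    have := hF.2 (k - δ)
    rw [sub_add_cancel] at this
    exact this.symm
  · by_contra hall
    push Not at hall
    have hsurj : Function.Surjective φ := fun j => by simpa using hall j
    have := Nat.card_le_card_of_surjective φ hsurj
    rw [Nat.card_fin] at this
    omega

/-- If no pattern of `𝒢` with more than `Q` and at most `2Q` vertices occurs with a boundary of at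
most `2b` vertices, where `Q` is the protrusion limit, then the graph is reduced. -/
theorem protrusionReduced_of_not_occursAt {C : GraphClass} (hC : C.SubgraphClosed)
    {R : ∀ b : ℕ, Set (BoundariedGraph b)} {b : ℕ} {E : SimpleGraph ℕ} {S : Finset ℕ}
    (hE : C.mem (E.induce (S : Set ℕ)))
    (h : ∀ c, protLimit' R b < c → c ≤ 2 * protLimit' R b → ∀ H : SimpleGraph (Fin c), C.mem H →
      ∀ w : Fin c → ℕ, ¬ OccursAt (2 * b) H E S w) :
    ProtrusionReduced R b (E.induce (S : Set ℕ)) := by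
  classical
  rintro ⟨W, hW, hlt⟩
  have h2b : 2 * b ≤ protLimit' R b := le_max_left _ _
  obtain ⟨W', h1, h2, h3⟩ := hW.exists_bounded (by omega) hlt
  have hsub : vertexBoundary (E.induce (S : Set ℕ)) W' ⊆ W' := fun x hx => hx.1
  obtain ⟨B, hB1, hB2, hB3⟩ := Set.exists_subsuperset_card_eq hsub h3 (by omega)
  have eB : Fin (2 * b) ≃ B := by
    have := Finite.equivFin B
    rw [Nat.card_coe_set_eq, hB3] at this
    exact this.symm
  let f : Fin (2 * b) ↪ W' := ⟨fun i => ⟨(eB i).1, hB2 (eB i).2⟩, fun i j hij =>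
    eB.injective (Subtype.ext (congrArg (fun x : W' => x.1) hij))⟩
  obtain ⟨e, he⟩ := exists_equiv_fin_extending f
  have hcard : Nat.card W' = W'.ncard := Nat.card_coe_set_eq _
  rw [← hcard] at h1 h2
  let w : Fin (Nat.card W') → ℕ := fun i => (e i).1.1
  have hw : Function.Injective w := fun i j hij => e.injective (Subtype.ext (Subtype.ext hij))
  refine h _ h1 h2 (E.comap w) ?_ w ⟨hw, fun i => (e i).1.2, fun i j => Iff.rfl, ?_⟩
  · refine hC _ _ ⟨⟨⟨fun i => (e i).1, fun hij => hij⟩, fun i j hij => ?_⟩⟩ hE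
    exact e.injective (Subtype.ext hij)
  · intro j hj x hx hne hadj
    have hxW : (⟨x, hx⟩ : (S : Set ℕ)) ∉ W' := by
      intro hxW
      refine hne (e.symm ⟨_, hxW⟩) ?_
      change (e (e.symm ⟨_, hxW⟩)).1.1 = x
      rw [Equiv.apply_symm_apply]
    have hjB : (e j).1 ∈ B := hB1 ⟨(e j).2, _, hxW, hadj⟩
    obtain ⟨i, hi⟩ := eB.surjective ⟨_, hjB⟩
    have h4 := he i (i.2.trans_le (by omega))
    have h5 : e ⟨i, i.2.trans_le (by omega)⟩ = e j := by
      rw [h4]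
      exact Subtype.ext (congrArg (fun x : B => x.1) hi)
    have h6 := congrArg Fin.val (e.injective h5)
    have h7 := i.2
    simp only at h6
    omega

/-! ### Programs: specifications with a time bound -/

namespace Ram

/-- Started in `σ`, the program `p` halts after at most `T` steps in a state that satisfies `Q`. -/
def Runs (p : Prog) (σ : State) (T : ℕ) (Q : State → Prop) : Prop :=
  ∃ n τ, Exec p σ n τ ∧ n ≤ T ∧ Q τ

section Runs

variable {p q : Prog} {σ : State} {T T' : ℕ} {Q Q' : State → Prop}

theorem Runs.mono (h : Runs p σ T Q) (hT : T ≤ T') (hQ : ∀ τ, Q τ → Q' τ) : Runs p σ T' Q' := by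
  obtain ⟨n, τ, h1, h2, h3⟩ := h
  exact ⟨n, τ, h1, h2.trans hT, hQ τ h3⟩

theorem Runs.skip (h : Q σ) : Runs Prog.skip σ 1 Q := ⟨1, σ, Exec.skip σ, le_rfl, h⟩

theorem Runs.assign {x : ℕ} {e : Expr} (h : Q (σ.setVar x (e.eval σ))) :
    Runs (Prog.assign x e) σ 1 Q := ⟨1, _, Exec.assign x e σ, le_rfl, h⟩

theorem Runs.store {a : ℕ} {i j e : Expr} (h : Q (σ.setArr a (i.eval σ) (j.eval σ) (e.eval σ))) :
    Runs (Prog.store a i j e) σ 1 Q := ⟨1, _, Exec.store a i j e σ, le_rfl, h⟩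

theorem Runs.seq (hp : Runs p σ T Q) (hq : ∀ τ, Q τ → Runs q τ T' Q') :
    Runs (Prog.seq p q) σ (T + T') Q' := by
  obtain ⟨n, τ, h1, h2, h3⟩ := hp
  obtain ⟨m, ρ, h4, h5, h6⟩ := hq τ h3
  exact ⟨n + m, ρ, Exec.seq h1 h4, Nat.add_le_add h2 h5, h6⟩

theorem Runs.ite {e : Expr} (hp : e.eval σ ≠ 0 → Runs p σ T Q)
    (hq : e.eval σ = 0 → Runs q σ T Q) : Runs (Prog.ite e p q) σ (T + 1) Q := by
  by_cases he : e.eval σ = 0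
  · obtain ⟨n, τ, h1, h2, h3⟩ := hq he
    exact ⟨n + 1, τ, Exec.ite_else he h1, Nat.succ_le_succ h2, h3⟩
  · obtain ⟨n, τ, h1, h2, h3⟩ := hp he
    exact ⟨n + 1, τ, Exec.ite_then he h1, Nat.succ_le_succ h2, h3⟩

/-- The loop `for x in 0, …, (var y) - 1 do p`. -/
def forLoop (x y : ℕ) (p : Prog) : Prog :=
  Prog.seq (Prog.assign x (Expr.const 0))
    (Prog.loop (Expr.sub (Expr.var y) (Expr.var x))
      (Prog.seq p (Prog.assign x (Expr.add (Expr.var x) (Expr.const 1)))))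

/-- Here `I i` is the loop invariant before the iteration with value `i` of the loop variable. -/
theorem Runs.forLoop {x y n : ℕ} (I : ℕ → State → Prop) (h0 : I 0 (σ.setVar x 0))
    (hI : ∀ i τ, I i τ → τ.var x = i ∧ τ.var y = n)
    (hp : ∀ i τ, i < n → I i τ → Runs p τ T fun τ' => I (i + 1) (τ'.setVar x (τ'.var x + 1))) :
    Runs (forLoop x y p) σ (n * (T + 2) + 2) (I n) := by
  have key : ∀ m i τ, i + m = n → I i τ →
      Runs (Prog.loop (Expr.sub (Expr.var y) (Expr.var x))
        (Prog.seq p (Prog.assign x (Expr.add (Expr.var x) (Expr.const 1))))) τ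
        (m * (T + 2) + 1) (I n) := by
    intro m
    induction m with
    | zero =>
      intro i τ hi hτ
      have h := hI i τ hτ
      rw [add_zero] at hi
      subst hi
      exact ⟨1, τ, Exec.loop_exit (by simp [Expr.eval, h]), by omega, hτ⟩
    | succ m ih =>
      intro i τ hi hτ
      have h := hI i τ hτ
      obtain ⟨a, ρ, h1, h2, h3⟩ := Runs.seq (hp i τ (by omega) hτ)
        (fun τ' hτ' => Runs.assign (x := x) (e := Expr.add (Expr.var x) (Expr.const 1))
          (Q := I (i + 1)) hτ')
      obtain ⟨a', ρ', h1', h2', h3'⟩ := ih (i + 1) ρ (by omega) h3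
      refine ⟨a + a' + 1, ρ', Exec.loop_step ?_ h1 h1', ?_, h3'⟩
      · simp only [Expr.eval, h]
        omega
      · rw [Nat.add_mul]
        omega
  refine (Runs.seq (Q := I 0) (Runs.assign h0) (fun τ hτ => key n 0 τ (by omega) hτ)).mono ?_
    fun _ h => h
  omega

end Runs

/-- Sequential composition of a list of programs. -/
def progList (l : List Prog) : Prog := l.foldr Prog.seq Prog.skip

/-- An expression that is nonzero if and only if one of those in the list is. -/
def orList (l : List Expr) : Expr := l.foldr Expr.add (Expr.const 0)

theorem eval_orList {l : List Expr} {σ : State} :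
    (orList l).eval σ = 0 ↔ ∀ e ∈ l, e.eval σ = 0 := by
  induction l with
  | nil => simp [orList, Expr.eval]
  | cons e l ih =>
    have : orList (e :: l) = Expr.add e (orList l) := rfl
    rw [this, Expr.eval, Nat.add_eq_zero_iff, ih]
    simp

/-- An expression that is nonzero if and only if `e` and `f` have equal values. -/
def eqExpr (e f : Expr) : Expr := Expr.sub (Expr.const 1) (Expr.add (Expr.sub e f) (Expr.sub f e))

theorem eval_eqExpr {e f : Expr} {σ : State} :
    (eqExpr e f).eval σ = 0 ↔ e.eval σ ≠ f.eval σ := by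
  simp only [eqExpr, Expr.eval]
  omega

theorem State.setVar_var {σ : State} {x v y : ℕ} :
    (σ.setVar x v).var y = if y = x then v else σ.var y := by
  simp [State.setVar, Function.update_apply]

theorem State.setVar_arr {σ : State} {x v : ℕ} : (σ.setVar x v).arr = σ.arr := rfl

theorem State.setArr_var {σ : State} {a i j v : ℕ} : (σ.setArr a i j v).var = σ.var := rfl

theorem State.setArr_arr {σ : State} {a i j v a' i' j' : ℕ} :
    (σ.setArr a i j v).arr a' i' j' =
      if a' = a ∧ i' = i ∧ j' = j then v else σ.arr a' i' j' := by
  by_cases h : a' = a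
  · subst h
    by_cases h' : i' = i
    · subst h'
      by_cases h'' : j' = j
      · simp [State.setArr, h'']
      · simp [State.setArr, h'']
    · simp [State.setArr, h']
  · simp [State.setArr, h]

/-- The effect of a list of stores into the array `a`.  The positions are given by expressions
that depend on the variables only. -/
theorem runs_stores {ι : Type*} (l : List ι) (a : ℕ) (eI eJ : ι → Expr) (v : ι → ℕ) (I J : ι → ℕ)
    (σ : State) (hI : ∀ p ∈ l, ∀ τ : State, τ.var = σ.var → (eI p).eval τ = I p)
    (hJ : ∀ p ∈ l, ∀ τ : State, τ.var = σ.var → (eJ p).eval τ = J p) :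
    Runs (progList (l.map fun p => Prog.store a (eI p) (eJ p) (Expr.const (v p)))) σ
      (l.length + 1) fun τ => τ.var = σ.var ∧ (∀ a', a' ≠ a → τ.arr a' = σ.arr a') ∧
        ∀ x y, (∃ p ∈ l, I p = x ∧ J p = y ∧ τ.arr a x y = v p) ∨
          ((∀ p ∈ l, I p = x → J p ≠ y) ∧ τ.arr a x y = σ.arr a x y) := by
  induction l generalizing σ with
  | nil => exact Runs.skip ⟨rfl, fun _ _ => rfl, fun x y => Or.inr ⟨by simp, rfl⟩⟩
  | cons q l ih =>
    have hT : (q :: l).length + 1 = 1 + (l.length + 1) := by simp [add_comm]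
    rw [hT]
    refine Runs.seq (p := Prog.store a (eI q) (eJ q) (Expr.const (v q)))
      (Q := fun τ => τ = σ.setArr a (I q) (J q) (v q)) (Runs.store ?_) ?_
    · rw [hI q (by simp) σ rfl, hJ q (by simp) σ rfl]
      rfl
    · rintro _ rfl
      refine (ih (σ.setArr a (I q) (J q) (v q)) (fun p hp τ h => hI p (by simp [hp]) τ h)
        (fun p hp τ h => hJ p (by simp [hp]) τ h)).mono le_rfl ?_
      rintro τ ⟨h1, h2, h3⟩
      refine ⟨h1, fun a' ha' => (h2 a' ha').trans ?_, fun x y => ?_⟩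
      · ext i j
        rw [State.setArr_arr, if_neg fun h => ha' h.1]
      · rcases h3 x y with ⟨p, hp, h⟩ | ⟨h, h'⟩
        · exact Or.inl ⟨p, by simp [hp], h⟩
        · rw [State.setArr_arr] at h'
          by_cases hq : x = I q ∧ y = J q
          · rw [if_pos ⟨rfl, hq⟩] at h'
            exact Or.inl ⟨q, by simp, hq.1.symm, hq.2.symm, h'⟩
          · rw [if_neg fun h => hq h.2] at h'
            refine Or.inr ⟨fun p hp hx hy => ?_, h'⟩
            rcases List.mem_cons.1 hp with rfl | hp
            · exact hq ⟨hx.symm, hy.symm⟩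
            · exact h p hp hx hy

/-! ### Relocation of a program -/

/-- An expression with the numbers of the variables shifted by `m` and those of the arrays by `a`. -/
def Expr.shift (m a : ℕ) : Expr → Expr
  | const n => const n
  | var x => var (m + x)
  | arr b i j => arr (a + b) (i.shift m a) (j.shift m a)
  | add e f => add (e.shift m a) (f.shift m a)
  | sub e f => sub (e.shift m a) (f.shift m a)

/-- A program with the numbers of the variables shifted by `m` and those of the arrays by `a`. -/
def Prog.shift (m a : ℕ) : Prog → Prog
  | skip => skip
  | assign x e => assign (m + x) (e.shift m a)
  | store b i j e => store (a + b) (i.shift m a) (j.shift m a) (e.shift m a)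
  | seq p q => seq (p.shift m a) (q.shift m a)
  | ite e p q => ite (e.shift m a) (p.shift m a) (q.shift m a)
  | loop e p => loop (e.shift m a) (p.shift m a)

/-- `σ'` holds the memory of `σ` at the addresses shifted by `m` and `a`. -/
def Shifted (m a : ℕ) (σ σ' : State) : Prop :=
  (∀ x, σ'.var (m + x) = σ.var x) ∧ ∀ b i j, σ'.arr (a + b) i j = σ.arr b i j

/-- `σ` and `σ'` agree on the memory below the addresses `m` and `a`. -/
def SameLow (m a : ℕ) (σ σ' : State) : Prop :=
  (∀ x, x < m → σ'.var x = σ.var x) ∧ ∀ b, b < a → σ'.arr b = σ.arr b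

theorem Expr.eval_shift {m a : ℕ} {σ σ' : State} (h : Shifted m a σ σ') (e : Expr) :
    (e.shift m a).eval σ' = e.eval σ := by
  induction e with
  | const n => rfl
  | var x => exact h.1 x
  | arr b i j hi hj => simp only [Expr.shift, Expr.eval, hi, hj, h.2]
  | add e f he hf => simp only [Expr.shift, Expr.eval, he, hf]
  | sub e f he hf => simp only [Expr.shift, Expr.eval, he, hf]

/-- A shifted program computes the same in the shifted memory, in as many steps, and leaves the
memory below untouched. -/
theorem Exec.shift {m a : ℕ} {p : Prog} {σ τ : State} {T : ℕ} (h : Exec p σ T τ) :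
    ∀ σ', Shifted m a σ σ' →
      ∃ τ', Exec (p.shift m a) σ' T τ' ∧ Shifted m a τ τ' ∧ SameLow m a σ' τ' := by
  induction h with
  | skip σ =>
    exact fun σ' h => ⟨σ', Exec.skip σ', h, fun _ _ => rfl, fun _ _ => rfl⟩
  | assign x e σ =>
    intro σ' h
    refine ⟨_, Exec.assign _ _ _, ⟨fun y => ?_, h.2⟩, fun y hy => ?_, fun _ _ => rfl⟩
    · rw [State.setVar_var, State.setVar_var, Expr.eval_shift h]
      simp [h.1 y]
    · rw [State.setVar_var, if_neg (by omega)]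
  | store b i j e σ =>
    intro σ' h
    refine ⟨_, Exec.store _ _ _ _ _, ⟨h.1, fun b' i' j' => ?_⟩, fun _ _ => rfl, fun b' hb => ?_⟩
    · rw [State.setArr_arr, State.setArr_arr, Expr.eval_shift h, Expr.eval_shift h,
        Expr.eval_shift h]
      simp [h.2]
    · ext i' j'
      rw [State.setArr_arr, if_neg (by omega)]
  | seq _ _ ih1 ih2 =>
    intro σ' h
    obtain ⟨τ', h1, h2, h3⟩ := ih1 σ' h
    obtain ⟨ρ', h4, h5, h6⟩ := ih2 τ' h2
    exact ⟨ρ', Exec.seq h1 h4, h5, fun x hx => (h6.1 x hx).trans (h3.1 x hx),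
      fun b hb => (h6.2 b hb).trans (h3.2 b hb)⟩
  | ite_then he _ ih =>
    intro σ' h
    obtain ⟨τ', h1, h2, h3⟩ := ih σ' h
    exact ⟨τ', Exec.ite_then (by rwa [Expr.eval_shift h]) h1, h2, h3⟩
  | ite_else he _ ih =>
    intro σ' h
    obtain ⟨τ', h1, h2, h3⟩ := ih σ' h
    exact ⟨τ', Exec.ite_else (by rwa [Expr.eval_shift h]) h1, h2, h3⟩
  | loop_step he _ _ ih1 ih2 =>
    intro σ' h
    obtain ⟨τ', h1, h2, h3⟩ := ih1 σ' h
    obtain ⟨ρ', h4, h5, h6⟩ := ih2 τ' h2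
    exact ⟨ρ', Exec.loop_step (by rwa [Expr.eval_shift h]) h1 h4, h5,
      fun x hx => (h6.1 x hx).trans (h3.1 x hx), fun b hb => (h6.2 b hb).trans (h3.2 b hb)⟩
  | loop_exit he =>
    exact fun σ' h => ⟨σ', Exec.loop_exit (by rwa [Expr.eval_shift h]), h, fun _ _ => rfl,
      fun _ _ => rfl⟩

/-! ### Polynomial bounds -/

/-- The function is bounded by a polynomial. -/
def PolyBdd (T : ℕ → ℕ) : Prop := ∃ q : Polynomial ℕ, ∀ n, T n ≤ q.eval n

theorem eval_le_eval (q : Polynomial ℕ) {m n : ℕ} (h : m ≤ n) : q.eval m ≤ q.eval n := by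
  rw [Polynomial.eval_eq_sum_range, Polynomial.eval_eq_sum_range]
  exact Finset.sum_le_sum fun i _ => Nat.mul_le_mul_left _ (Nat.pow_le_pow_left h i)

theorem PolyBdd.const (c : ℕ) : PolyBdd fun _ => c := ⟨Polynomial.C c, fun n => by simp⟩

theorem PolyBdd.id : PolyBdd fun n => n := ⟨Polynomial.X, fun n => by simp⟩

theorem PolyBdd.add {S T : ℕ → ℕ} (hS : PolyBdd S) (hT : PolyBdd T) :
    PolyBdd fun n => S n + T n := by
  obtain ⟨p, hp⟩ := hS
  obtain ⟨q, hq⟩ := hT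
  exact ⟨p + q, fun n => by
    rw [Polynomial.eval_add]
    exact Nat.add_le_add (hp n) (hq n)⟩

theorem PolyBdd.mul {S T : ℕ → ℕ} (hS : PolyBdd S) (hT : PolyBdd T) :
    PolyBdd fun n => S n * T n := by
  obtain ⟨p, hp⟩ := hS
  obtain ⟨q, hq⟩ := hT
  exact ⟨p * q, fun n => by
    rw [Polynomial.eval_mul]
    exact Nat.mul_le_mul (hp n) (hq n)⟩

/-- The running time of a loop with `n` iterations is polynomial if that of its body is. -/
theorem PolyBdd.loop {T : ℕ → ℕ} (hT : PolyBdd T) : PolyBdd fun n => n * (T n + 2) + 2 :=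
  (PolyBdd.id.mul (hT.add (PolyBdd.const 2))).add (PolyBdd.const 2)

end Ram

/-! ### The reduction program -/

namespace Ram

/-- An instance as it is kept by the reduction program: the graph `E` on the vertex set `S`, with
the parameter decreased by `D`. -/
structure Inst where
  E : SimpleGraph ℕ
  S : Finset ℕ
  D : ℕ

/-- The graph of the instance. -/
abbrev Inst.graph (a : Inst) : SimpleGraph (a.S : Set ℕ) := a.E.induce (a.S : Set ℕ)

/-- The state `σ` holds the instance `a`, obtained from an input `(G, k)` with `|G| = n`: array 0
is the adjacency matrix, column 0 of array 1 marks the deleted vertices, and variable 4 is `a.D`.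
The variables 2, 3, 5 to 8 and those from 10 to `M - 1` as well as the arrays 2 and 3 are working
memory.  The variables from `M` on and the arrays from 4 on have not been used: they are reserved
for a relocated program, which expects them to be zero. -/
structure Holds (n k M : ℕ) (a : Inst) (σ : State) : Prop where
  var_zero : σ.var 0 = n
  var_one : σ.var 1 = k
  var_four : σ.var 4 = a.D
  adj : ∀ i j, a.E.Adj i j → σ.arr 0 i j = 1
  not_adj : ∀ i j, ¬ a.E.Adj i j → σ.arr 0 i j = 0
  alive : ∀ i, i < n → (σ.arr 1 i 0 = 0 ↔ i ∈ a.S)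
  lt : ∀ i ∈ a.S, i < n
  fresh_var : ∀ x, M ≤ x → σ.var x = 0
  fresh_arr : ∀ b i j, 4 ≤ b → σ.arr b i j = 0

theorem Holds.congr {n k M : ℕ} {a : Inst} {σ τ : State} (h : Holds n k M a σ)
    (harr : τ.arr = σ.arr)
    (hvar : ∀ x, (x = 0 ∨ x = 1 ∨ x = 4 ∨ M ≤ x) → τ.var x = σ.var x) : Holds n k M a τ where
  var_zero := (hvar 0 (by simp)).trans h.var_zero
  var_one := (hvar 1 (by simp)).trans h.var_one
  var_four := (hvar 4 (by simp)).trans h.var_four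
  adj := by rw [harr]; exact h.adj
  not_adj := by rw [harr]; exact h.not_adj
  alive := by rw [harr]; exact h.alive
  lt := h.lt
  fresh_var x hx := (hvar x (by simp [hx])).trans (h.fresh_var x hx)
  fresh_arr := by rw [harr]; exact h.fresh_arr

theorem Holds.arr_eq_zero_iff {n k M : ℕ} {a : Inst} {σ : State} (h : Holds n k M a σ) (i j : ℕ) :
    σ.arr 0 i j = 0 ↔ ¬ a.E.Adj i j := by
  constructor
  · intro h0 hadj
    rw [h.adj i j hadj] at h0
    exact one_ne_zero h0
  · exact h.not_adj i j

/-- The tuple of vertices in the variables from 10 on. -/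
def tuple (c : ℕ) (σ : State) : Fin c → ℕ := fun i => σ.var (10 + i)

/-- The variable that holds the `i`-th vertex of the tuple. -/
def tupleVar (i : ℕ) : Expr := Expr.var (10 + i)

section Program

variable {c : ℕ}

open Classical in
/-- Zero if and only if the tuple consists of distinct remaining vertices that induce `H`. -/
noncomputable def mismatch (H : SimpleGraph (Fin c)) : Expr :=
  Expr.add
    (orList ((Finset.univ : Finset (Fin c × Fin c)).toList.map fun p => Expr.add
      (if p.1 = p.2 then Expr.const 0 else eqExpr (tupleVar p.1) (tupleVar p.2))
      (if H.Adj p.1 p.2 then Expr.sub (Expr.const 1) (Expr.arr 0 (tupleVar p.1) (tupleVar p.2))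
        else Expr.arr 0 (tupleVar p.1) (tupleVar p.2))))
    (orList ((Finset.univ : Finset (Fin c)).toList.map fun i : Fin c =>
      Expr.arr 1 (tupleVar i) (Expr.const 0)))

theorem eval_mismatch {n k M : ℕ} {a : Inst} {σ : State} (h : Holds n k M a σ)
    (hlt : ∀ i, tuple c σ i < n) (H : SimpleGraph (Fin c)) :
    (mismatch H).eval σ = 0 ↔ Function.Injective (tuple c σ) ∧ (∀ i, tuple c σ i ∈ a.S) ∧
      ∀ i j, a.E.Adj (tuple c σ i) (tuple c σ j) ↔ H.Adj i j := by
  classical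
  have h1 : ∀ i j : Fin c, ((if i = j then Expr.const 0 else
      eqExpr (tupleVar i) (tupleVar j)).eval σ = 0 ↔ (tuple c σ i = tuple c σ j → i = j)) := by
    intro i j
    by_cases hij : i = j
    · simp [hij, Expr.eval]
    · rw [if_neg hij, eval_eqExpr]
      simp only [hij, imp_false]
      rfl
  have h2 : ∀ i j : Fin c, ((if H.Adj i j then
      Expr.sub (Expr.const 1) (Expr.arr 0 (tupleVar i) (tupleVar j))
      else Expr.arr 0 (tupleVar i) (tupleVar j)).eval σ = 0 ↔
        (a.E.Adj (tuple c σ i) (tuple c σ j) ↔ H.Adj i j)) := by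
    intro i j
    by_cases hij : H.Adj i j
    · simp only [hij, if_true, iff_true, Expr.eval]
      change 1 - σ.arr 0 (tuple c σ i) (tuple c σ j) = 0 ↔ _
      by_cases ha : a.E.Adj (tuple c σ i) (tuple c σ j)
      · simp [h.adj _ _ ha, ha]
      · simp [h.not_adj _ _ ha, ha]
    · simp only [hij, if_false, iff_false]
      exact h.arr_eq_zero_iff _ _
  have h3 : ∀ i : Fin c, σ.arr 1 ((tupleVar i).eval σ) 0 = 0 ↔ tuple c σ i ∈ a.S :=
    fun i => h.alive _ (hlt i)
  simp only [mismatch, Expr.eval, Nat.add_eq_zero_iff, eval_orList, List.forall_mem_map,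
    Finset.mem_toList, Finset.mem_univ, true_implies, Prod.forall, h1, h2, h3]
  constructor
  · rintro ⟨h4, h5⟩
    exact ⟨fun i j hij => (h4 i j).1 hij, h5, fun i j => (h4 i j).2⟩
  · rintro ⟨h4, h5, h6⟩
    exact ⟨fun i j => ⟨fun hij => h4 hij, h6 i j⟩, h5⟩

/-- Nonzero if the vertex in variable 3 is deleted or belongs to the tuple. -/
noncomputable def excluded (c : ℕ) : Expr :=
  orList (Expr.arr 1 (Expr.var 3) (Expr.const 0) ::
    (Finset.univ : Finset (Fin c)).toList.map fun i : Fin c => eqExpr (tupleVar i) (Expr.var 3))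

/-- Nonzero if the vertex in variable 3 has a neighbor in the tuple that is not among the first
`b` vertices. -/
noncomputable def touching (b c : ℕ) : Expr :=
  orList ((Finset.univ.filter fun j : Fin c => b ≤ j).toList.map fun j : Fin c =>
    Expr.arr 0 (tupleVar j) (Expr.var 3))

/-- Sets variable 2 to zero if and only if the pattern occurs at the tuple. -/
noncomputable def test (b : ℕ) (H : SimpleGraph (Fin c)) : Prog :=
  Prog.seq (Prog.assign 2 (mismatch H))
    (forLoop 3 0 (Prog.ite (excluded c) Prog.skip
      (Prog.ite (touching b c) (Prog.assign 2 (Expr.const 1)) Prog.skip)))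

theorem runs_test {n k M b : ℕ} {a : Inst} {σ : State} (h : Holds n k M a σ)
    (hlt : ∀ i, tuple c σ i < n) (H : SimpleGraph (Fin c)) :
    Runs (test b H) σ (1 + (n * (3 + 2) + 2)) fun τ =>
      τ.arr = σ.arr ∧ (∀ x, x ≠ 2 → x ≠ 3 → τ.var x = σ.var x) ∧
        (τ.var 2 = 0 ↔ OccursAt b H a.E a.S (tuple c σ)) := by
  classical
  -- The neighbors less than `i` have been tested.
  let I : ℕ → State → Prop := fun i τ => τ.arr = σ.arr ∧
    (∀ x, x ≠ 2 → x ≠ 3 → τ.var x = σ.var x) ∧ τ.var 3 = i ∧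
    (τ.var 2 = 0 ↔ (mismatch H).eval σ = 0 ∧ ∀ j : Fin c, b ≤ j → ∀ x ∈ a.S, x < i →
      (∀ i, tuple c σ i ≠ x) → ¬ a.E.Adj (tuple c σ j) x)
  refine Runs.seq (Q := fun τ => τ = σ.setVar 2 ((mismatch H).eval σ)) (Runs.assign rfl) ?_
  rintro _ rfl
  refine (Runs.forLoop (n := n) I ?_ ?_ ?_).mono le_rfl ?_
  · refine ⟨rfl, fun x h2 h3 => ?_, ?_, ?_⟩
    · simp [State.setVar_var, h2, h3]
    · simp [State.setVar_var]
    · simp [State.setVar_var]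
  · rintro i τ ⟨-, h2, h3, -⟩
    exact ⟨h3, (h2 0 (by omega) (by omega)).trans h.var_zero⟩
  · rintro i τ hi ⟨h1, h2, h3, h4⟩
    have htv : ∀ j : Fin c, (tupleVar j).eval τ = tuple c σ j := fun j =>
      h2 _ (by omega) (by omega)
    have hexc : (excluded c).eval τ = 0 ↔ i ∈ a.S ∧ ∀ j, tuple c σ j ≠ i := by
      simp only [excluded, eval_orList, List.forall_mem_cons, List.forall_mem_map,
        Finset.mem_toList, Finset.mem_univ, true_implies, eval_eqExpr, htv, Expr.eval, h3, h1,
        h.alive i hi]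
    have htouch : (touching b c).eval τ = 0 ↔
        ∀ j : Fin c, b ≤ j → ¬ a.E.Adj (tuple c σ j) i := by
      simp only [touching, eval_orList, List.forall_mem_map, Finset.mem_toList,
        Finset.mem_filter, Finset.mem_univ, true_and, Expr.eval, htv, h3, h1, h.arr_eq_zero_iff]
    have hnext : ∀ τ' : State, τ'.arr = σ.arr → (∀ x, x ≠ 2 → x ≠ 3 → τ'.var x = σ.var x) →
        τ'.var 3 = i →
        (τ'.var 2 = 0 ↔ τ.var 2 = 0 ∧ (i ∈ a.S → (∀ j, tuple c σ j ≠ i) →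
          ∀ j : Fin c, b ≤ j → ¬ a.E.Adj (tuple c σ j) i)) →
        I (i + 1) (τ'.setVar 3 (τ'.var 3 + 1)) := by
      intro τ' h1' h2' h3' h4'
      refine ⟨h1', fun x hx2 hx3 => ?_, ?_, ?_⟩
      · rw [State.setVar_var, if_neg hx3, h2' x hx2 hx3]
      · simp [State.setVar_var, h3']
      · rw [State.setVar_var, if_neg (by omega), h4', h4, and_assoc]
        refine and_congr_right fun _ => ?_
        constructor
        · rintro ⟨h5, h6⟩ j hj x hx hxi hne
          rcases Nat.lt_succ_iff_lt_or_eq.1 hxi with hxi | rfl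
          · exact h5 j hj x hx hxi hne
          · exact h6 hx hne j hj
        · intro h5
          exact ⟨fun j hj x hx hxi hne => h5 j hj x hx (by omega) hne,
            fun hx hne j hj => h5 j hj i hx (by omega) hne⟩
    refine Runs.ite (T := 2) (fun he => ?_) (fun he => ?_)
    · refine Runs.mono (T := 1) (Runs.skip (hnext τ h1 h2 h3 ?_)) (by omega) fun _ h => h
      refine ⟨fun h => ⟨h, fun h5 h6 => absurd (hexc.2 ⟨h5, h6⟩) he⟩, fun h => h.1⟩
    · have he' := hexc.1 he
      refine Runs.ite (T := 1) (fun ht => Runs.assign (hnext _ h1 (fun x h5 h6 => ?_) ?_ ?_))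
        (fun ht => Runs.skip (hnext τ h1 h2 h3 ?_))
      · rw [State.setVar_var, if_neg h5, h2 x h5 h6]
      · rw [State.setVar_var, if_neg (by omega), h3]
      · simp only [State.setVar_var, if_true, Expr.eval, one_ne_zero, false_iff]
        rintro ⟨-, h5⟩
        exact ht (htouch.2 (h5 he'.1 he'.2))
      · exact ⟨fun h5 => ⟨h5, fun _ _ => htouch.1 ht⟩, fun h => h.1⟩
  · rintro τ ⟨h1, h2, -, h4⟩
    refine ⟨h1, h2, ?_⟩
    rw [h4, eval_mismatch h hlt]
    constructor
    · rintro ⟨⟨h5, h6, h7⟩, h8⟩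
      exact ⟨h5, h6, h7, fun j hj x hx => h8 j hj x hx (h.lt x hx)⟩
    · rintro ⟨h5, h6, h7, h8⟩
      exact ⟨⟨h5, h6, h7⟩, fun j hj x hx _ => h8 j hj x hx⟩

open Classical in
/-- Applies the rule at the tuple. -/
noncomputable def replace (r : Rule c) : Prog :=
  Prog.seq (progList ((Finset.univ : Finset (Fin c × Fin c)).toList.map fun p =>
      Prog.store 0 (tupleVar p.1) (tupleVar p.2) (Expr.const (if r.new.Adj p.1 p.2 then 1 else 0))))
    (Prog.seq (progList ((Finset.univ.filter fun j : Fin c => j ∉ r.keep).toList.map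
        fun j : Fin c => Prog.store 1 (tupleVar j) (Expr.const 0) (Expr.const 1)))
      (Prog.assign 4 (Expr.add (Expr.var 4) (Expr.const r.shift))))

/-- The instance after an application of the rule. -/
noncomputable def _root_.Rule.apply (r : Rule c) (a : Inst) (w : Fin c → ℕ) : Inst :=
  ⟨patch a.E w r.new, r.remaining a.S w, a.D + r.shift⟩

theorem exists_runs_replace (r : Rule c) (M : ℕ) (hM : 4 < M) :
    ∃ T, ∀ (n k : ℕ) (a : Inst) (σ : State), Holds n k M a σ →
      Function.Injective (tuple c σ) → (∀ i, tuple c σ i < n) →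
      Runs (replace r) σ T fun τ => (∀ x, x ≠ 4 → τ.var x = σ.var x) ∧
        Holds n k M (r.apply a (tuple c σ)) τ := by
  classical
  refine ⟨((Finset.univ : Finset (Fin c × Fin c)).toList.length + 1) +
    (((Finset.univ.filter fun j : Fin c => j ∉ r.keep).toList.length + 1) + 1),
    fun n k a σ h hinj hlt => ?_⟩
  refine Runs.seq (runs_stores (ι := Fin c × Fin c) _ 0 (fun p => tupleVar p.1)
    (fun p => tupleVar p.2) _ (fun p => tuple c σ p.1) (fun p => tuple c σ p.2) σ
    (fun p _ τ hτ => congrFun hτ (10 + p.1)) (fun p _ τ hτ => congrFun hτ (10 + p.2)))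
    fun σ₁ h₁ => ?_
  refine Runs.seq (runs_stores (ι := Fin c) _ 1 (fun j => tupleVar j) (fun _ => Expr.const 0)
    (fun _ => 1) (fun j => tuple c σ j) (fun _ => 0) σ₁
    (fun j _ τ hτ => (congrFun hτ (10 + j)).trans (congrFun h₁.1 (10 + j)))
    (fun _ _ _ _ => rfl)) fun σ₂ h₂ => Runs.assign ?_
  obtain ⟨hv₁, ha₁, hs₁⟩ := h₁
  obtain ⟨hv₂, ha₂, hs₂⟩ := h₂
  have hv : σ₂.var = σ.var := hv₂.trans hv₁
  have hadj : ∀ x y, ((patch a.E (tuple c σ) r.new).Adj x y → σ₂.arr 0 x y = 1) ∧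
      (¬ (patch a.E (tuple c σ) r.new).Adj x y → σ₂.arr 0 x y = 0) := by
    intro x y
    rw [ha₂ 0 (by omega)]
    rcases hs₁ x y with ⟨⟨i, j⟩, -, hi, hj, hval⟩ | ⟨hno, hval⟩
    · simp only at hi hj hval
      have hiff : (patch a.E (tuple c σ) r.new).Adj x y ↔ r.new.Adj i j := by
        constructor
        · rintro (⟨i', j', hi', hj', hadj, -⟩ | ⟨hno, -⟩)
          · rwa [hinj (hi.trans hi'.symm), hinj (hj.trans hj'.symm)]
          · exact absurd ⟨⟨i, hi⟩, j, hj⟩ hno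
        · intro hadj
          refine Or.inl ⟨i, j, hi, hj, hadj, ?_⟩
          rintro rfl
          exact hadj.ne (hinj (hi.trans hj.symm))
      rw [hiff, hval]
      exact ⟨fun h => if_pos h, fun h => if_neg h⟩
    · have hno' : ¬ ((∃ i, tuple c σ i = x) ∧ ∃ j, tuple c σ j = y) := by
        rintro ⟨⟨i, hi⟩, j, hj⟩
        exact hno (i, j) (by simp) hi hj
      have hiff : (patch a.E (tuple c σ) r.new).Adj x y ↔ a.E.Adj x y := by
        constructor
        · rintro (⟨i', j', hi', hj', -⟩ | ⟨-, h⟩)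
          · exact absurd ⟨⟨i', hi'⟩, j', hj'⟩ hno'
          · exact h
        · exact fun h => Or.inr ⟨hno', h⟩
      rw [hiff, hval]
      exact ⟨h.adj x y, h.not_adj x y⟩
  refine ⟨fun x hx => ?_, ⟨?_, ?_, ?_, fun x y => (hadj x y).1, fun x y => (hadj x y).2, ?_, ?_,
    ?_, ?_⟩⟩
  · rw [State.setVar_var, if_neg hx, hv]
  · rw [State.setVar_var, if_neg (by omega), hv, h.var_zero]
  · rw [State.setVar_var, if_neg (by omega), hv, h.var_one]
  · simp only [State.setVar_var, if_true, Expr.eval, hv, h.var_four]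
    rfl
  · intro x hx
    rw [State.setVar_arr]
    change _ ↔ x ∈ r.remaining a.S (tuple c σ)
    rw [Rule.mem_remaining, ← h.alive x hx, ← ha₁ 1 (by omega)]
    rcases hs₂ x 0 with ⟨j, hj, hjx, -, hval⟩ | ⟨hno, hval⟩
    · rw [hval]
      rw [Finset.mem_toList, Finset.mem_filter] at hj
      simp only [one_ne_zero, false_iff, not_and]
      exact fun _ h => hj.2 (h j hjx)
    · rw [hval]
      refine ⟨fun h => ⟨h, fun j hj => ?_⟩, fun h => h.1⟩
      by_contra hk
      exact hno j (by simpa using hk) hj rfl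
  · exact fun x hx => h.lt x (Rule.mem_remaining.1 hx).1
  · intro x hx
    rw [State.setVar_var, if_neg (by omega), hv, h.fresh_var x hx]
  · intro b i j hb
    rw [State.setVar_arr, ha₂ b (by omega), ha₁ b (by omega), h.fresh_arr b i j hb]

/-- Applies the rule at the tuple if its pattern occurs there. -/
noncomputable def tryRule (b : ℕ) (r : Rule c) : Prog :=
  Prog.seq (test b r.pat) (Prog.ite (Expr.var 2) Prog.skip (replace r))

theorem exists_runs_tryRule (b : ℕ) (r : Rule c) (M : ℕ) (hM : 4 < M) :
    ∃ T, PolyBdd T ∧ ∀ (n k : ℕ) (a : Inst) (σ : State), Holds n k M a σ →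
      (∀ i, tuple c σ i < n) →
      Runs (tryRule b r) σ (T n) fun τ => (∀ x, 5 ≤ x → τ.var x = σ.var x) ∧
        ((¬ OccursAt b r.pat a.E a.S (tuple c σ) ∧ Holds n k M a τ) ∨
          (OccursAt b r.pat a.E a.S (tuple c σ) ∧ Holds n k M (r.apply a (tuple c σ)) τ)) := by
  obtain ⟨T, hT⟩ := exists_runs_replace r M hM
  refine ⟨fun n => 1 + (n * (3 + 2) + 2) + (1 + T + 1), ?_, ?_⟩
  · exact ((PolyBdd.const 1).add (PolyBdd.loop (PolyBdd.const 3))).add (PolyBdd.const (1 + T + 1))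
  intro n k a σ h hlt
  refine Runs.seq (runs_test h hlt r.pat) ?_
  rintro τ ⟨h1, h2, h3⟩
  have h' : Holds n k M a τ := h.congr h1 fun x hx => h2 x (by omega) (by omega)
  have htup : tuple c τ = tuple c σ := funext fun i => h2 _ (by omega) (by omega)
  refine Runs.ite (fun he => ?_) (fun he => ?_)
  · refine Runs.mono (T := 1) (Runs.skip ⟨fun x hx => h2 x (by omega) (by omega),
      Or.inl ⟨?_, h'⟩⟩) (by omega) fun _ h => h
    rw [← h3]
    exact he
  · have hocc := h3.1 he
    refine (hT n k a τ h' (htup ▸ hocc.inj) (htup ▸ hlt)).mono (by omega) ?_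
    rintro ρ ⟨h4, h5⟩
    refine ⟨fun x hx => (h4 x (by omega)).trans (h2 x (by omega) (by omega)), Or.inr ⟨hocc, ?_⟩⟩
    rwa [htup] at h5

end Program

end Ram

namespace Ram

/-! ### Exhaustive application of the rules -/

/-- None of the patterns of the rules occurs in the instance. -/
def Stuck (b : ℕ) (rules : List (Σ c, Rule c)) (a : Inst) : Prop :=
  ∀ r ∈ rules, ∀ w, ¬ OccursAt b r.2.pat a.E a.S w

/-- The instance `a'` is equivalent to `a`; it is `a` itself, and then `a` satisfies `U`, or it is
smaller, and then some rule was applicable to `a`. -/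
structure Advances (P : GraphProblem) (C : GraphClass) (b : ℕ) (rules : List (Σ c, Rule c))
    (U : Inst → Prop) (a a' : Inst) : Prop where
  mem : C.mem a.graph ↔ C.mem a'.graph
  memInt : ∀ k : ℤ, P.memInt a.graph (k - a.D) ↔ P.memInt a'.graph (k - a'.D)
  cases : (a' = a ∧ U a) ∨ (a'.S.card < a.S.card ∧ ¬ Stuck b rules a)

section Advances

variable {P : GraphProblem} {C : GraphClass} {b : ℕ} {rules : List (Σ c, Rule c)}
  {U U' : Inst → Prop} {a a' a'' : Inst}

theorem Advances.refl (h : U a) : Advances P C b rules U a a :=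
  ⟨Iff.rfl, fun _ => Iff.rfl, Or.inl ⟨rfl, h⟩⟩

theorem Advances.trans (h : Advances P C b rules U a a') (h' : Advances P C b rules U' a' a'') :
    Advances P C b rules (fun a => U a ∧ U' a) a a'' := by
  refine ⟨h.mem.trans h'.mem, fun k => (h.memInt k).trans (h'.memInt k), ?_⟩
  rcases h.cases with ⟨rfl, h1⟩ | ⟨h1, h2⟩
  · rcases h'.cases with ⟨rfl, h3⟩ | h3
    · exact Or.inl ⟨rfl, h1, h3⟩
    · exact Or.inr h3
  · rcases h'.cases with ⟨rfl, -⟩ | ⟨h3, -⟩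
    · exact Or.inr ⟨h1, h2⟩
    · exact Or.inr ⟨h3.trans h1, h2⟩

theorem Advances.mono (h : Advances P C b rules U a a') (hU : U a → U' a) :
    Advances P C b rules U' a a' :=
  ⟨h.mem, h.memInt, h.cases.imp_left fun h => ⟨h.1, hU h.2⟩⟩

theorem Advances.apply {c : ℕ} {r : Rule c} {w : Fin c → ℕ} (hr : ⟨c, r⟩ ∈ rules)
    (hs : r.Sound P C b) (hk : ∃ j, j ∉ r.keep) (h : OccursAt b r.pat a.E a.S w) :
    Advances P C b rules U a (r.apply a w) := by
  obtain ⟨h1, h2⟩ := hs a.E a.S w h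
  refine ⟨h1, fun k => ?_, Or.inr ⟨Rule.card_remaining_lt hk h, fun hst => hst _ hr w h⟩⟩
  rw [h2 (k - a.D)]
  have : k - ((r.apply a w).D : ℤ) = k - a.D - r.shift := by
    have : (r.apply a w).D = a.D + r.shift := rfl
    rw [this]
    push_cast
    ring
  rw [this]
  rfl

end Advances

/-- Nested loops that run `p` for all values of the first `j` entries of the tuple. -/
def nest (p : Prog) : ℕ → Prog
  | 0 => p
  | j + 1 => forLoop (10 + j) 0 (nest p j)

section Loops

variable {P : GraphProblem} {C : GraphClass} {b M : ℕ} {rules : List (Σ c, Rule c)}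

theorem Holds.setVar {n k x v : ℕ} {a : Inst} {σ : State} (h : Holds n k M a σ) (hx : 4 < x)
    (hxM : x < M) : Holds n k M a (σ.setVar x v) :=
  h.congr rfl fun y hy => by
    rw [State.setVar_var, if_neg]
    omega

theorem exists_runs_nest {c : ℕ} {r : Rule c} (hr : ⟨c, r⟩ ∈ rules) (hs : r.Sound P C b)
    (hk : ∃ j, j ∉ r.keep) (hM : 10 + c ≤ M) (j : ℕ) (hj : j ≤ c) :
    ∃ T, PolyBdd T ∧ ∀ (n k : ℕ) (a : Inst) (σ : State), Holds n k M a σ →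
      (∀ i, j ≤ i → i < c → σ.var (10 + i) < n) →
      Runs (nest (tryRule b r) j) σ (T n) fun τ => ∃ a', Holds n k M a' τ ∧
        (∀ x, 5 ≤ x → (x < 10 ∨ 10 + j ≤ x) → τ.var x = σ.var x) ∧
        Advances P C b rules (fun a => ∀ w : Fin c → ℕ,
          (∀ i : Fin c, j ≤ i → w i = σ.var (10 + i)) → (∀ i : Fin c, i.1 < j → w i < n) →
          ¬ OccursAt b r.pat a.E a.S w) a a' := by
  induction j with
  | zero =>
    obtain ⟨T, hT, h⟩ := exists_runs_tryRule b r M (by omega)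
    refine ⟨T, hT, fun n k a σ hσ hlt => ?_⟩
    refine (h n k a σ hσ fun i => hlt i (by omega) i.2).mono le_rfl ?_
    rintro τ ⟨h1, ⟨h2, h3⟩ | ⟨h2, h3⟩⟩
    · refine ⟨a, h3, fun x hx _ => h1 x hx, Advances.refl fun w hw _ => ?_⟩
      have : w = tuple c σ := funext fun i => hw i (by omega)
      rwa [this]
    · exact ⟨_, h3, fun x hx _ => h1 x hx, Advances.apply hr hs hk h2⟩
  | succ j ih =>
    obtain ⟨T, hT, h⟩ := ih (by omega)
    refine ⟨fun n => n * (T n + 2) + 2, PolyBdd.loop hT, fun n k a σ hσ hlt => ?_⟩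
    -- The tuples whose `j`-th entry is less than `i` have been treated.
    let I : ℕ → State → Prop := fun i τ => τ.var (10 + j) = i ∧ ∃ a', Holds n k M a' τ ∧
      (∀ x, 5 ≤ x → (x < 10 ∨ 10 + (j + 1) ≤ x) → τ.var x = σ.var x) ∧
      Advances P C b rules (fun a => ∀ w : Fin c → ℕ,
        (∀ i' : Fin c, j + 1 ≤ i' → w i' = σ.var (10 + i')) →
        (∀ i' : Fin c, i'.1 = j → w i' < i) → (∀ i' : Fin c, i'.1 < j → w i' < n) →
        ¬ OccursAt b r.pat a.E a.S w) a a'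
    refine (Runs.forLoop (n := n) I ?_ ?_ ?_).mono le_rfl ?_
    · refine ⟨by simp [State.setVar_var], a, hσ.setVar (by omega) (by omega), ?_, ?_⟩
      · intro x hx hx'
        rw [State.setVar_var, if_neg (by omega)]
      · exact Advances.refl fun w _ hw => absurd (hw ⟨j, by omega⟩ rfl) (Nat.not_lt_zero _)
    · rintro i τ ⟨h1, a', h2, -⟩
      exact ⟨h1, h2.var_zero⟩
    · rintro i τ hi ⟨h1, a', h2, h3, h4⟩
      refine (h n k a' τ h2 ?_).mono le_rfl ?_
      · intro i' hi' hi'c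
        rcases Nat.eq_or_lt_of_le hi' with rfl | hlt'
        · rwa [h1]
        · rw [h3 _ (by omega) (by omega)]
          exact hlt i' (by omega) hi'c
      · rintro ρ ⟨a'', h5, h6, h7⟩
        refine ⟨?_, a'', h5.setVar (by omega) (by omega), ?_, (h4.trans h7).mono ?_⟩
        · rw [State.setVar_var, if_pos rfl, h6 _ (by omega) (by omega), h1]
        · intro x hx hx'
          rw [State.setVar_var, if_neg (by omega), h6 x hx (by omega), h3 x hx hx']
        · rintro ⟨h8, h9⟩ w hw1 hw2 hw3
          by_cases hwj : w ⟨j, by omega⟩ = i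
          · refine h9 w (fun i' hi' => ?_) hw3
            rcases Nat.eq_or_lt_of_le hi' with heq | hlt'
            · have : i' = ⟨j, by omega⟩ := Fin.ext heq.symm
              rw [this, hwj, h1]
            · rw [hw1 i' hlt', h3 _ (by omega) (by omega)]
          · refine h8 w hw1 (fun i' hi' => ?_) hw3
            have h10 := hw2 i' hi'
            have h11 : i' = ⟨j, by omega⟩ := Fin.ext hi'
            rw [h11] at h10 ⊢
            omega
    · rintro τ ⟨-, a', h2, h3, h4⟩
      exact ⟨a', h2, h3, h4.mono fun h5 w hw1 hw2 =>
        h5 w hw1 (fun i hi => hw2 i (by omega)) fun i hi => hw2 i (by omega)⟩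

/-- Tries all rules of the list at all tuples. -/
noncomputable def sweep (b : ℕ) (l : List (Σ c, Rule c)) : Prog :=
  progList (l.map fun r => nest (tryRule b r.2) r.1)

theorem exists_runs_sweep (l : List (Σ c, Rule c)) (hl : ∀ r ∈ l, r ∈ rules)
    (hr : ∀ r ∈ rules, r.2.Sound P C b ∧ (∃ j, j ∉ r.2.keep) ∧ 10 + r.1 ≤ M) :
    ∃ T, PolyBdd T ∧ ∀ (n k : ℕ) (a : Inst) (σ : State), Holds n k M a σ →
      Runs (sweep b l) σ (T n) fun τ => ∃ a', Holds n k M a' τ ∧ τ.var 5 = σ.var 5 ∧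
        Advances P C b rules (Stuck b l) a a' := by
  induction l with
  | nil =>
    exact ⟨fun _ => 1, PolyBdd.const 1, fun n k a σ hσ =>
      Runs.skip ⟨a, hσ, rfl, Advances.refl fun r hr => absurd hr List.not_mem_nil⟩⟩
  | cons r l ih =>
    obtain ⟨T', hT', h'⟩ := ih fun r' hr' => hl r' (List.mem_cons_of_mem _ hr')
    obtain ⟨hs, hk, hM⟩ := hr r (hl r List.mem_cons_self)
    obtain ⟨T, hT, h⟩ := exists_runs_nest (hl r List.mem_cons_self) hs hk hM r.1 le_rfl
    refine ⟨fun n => T n + T' n, hT.add hT', fun n k a σ hσ => ?_⟩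
    refine Runs.seq (h n k a σ hσ fun i h1 h2 => absurd h1 (by omega)) ?_
    rintro τ ⟨a', h1, h2, h3⟩
    refine (h' n k a' τ h1).mono le_rfl ?_
    rintro ρ ⟨a'', h4, h5, h6⟩
    refine ⟨a'', h4, h5.trans (h2 5 le_rfl (by omega)), (h3.trans h6).mono ?_⟩
    rintro ⟨h7, h8⟩ r' hr' w hw
    rcases List.mem_cons.1 hr' with rfl | hr'
    · exact h7 w (fun i hi => absurd i.2 (by omega)) (fun i _ => hσ.lt _ (hw.mem i)) hw
    · exact h8 r' hr' w hw

/-- Applies the rules exhaustively: each of the `n` sweeps over all rules and tuples deletes a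
vertex unless none of the patterns occurs any more. -/
noncomputable def reduce (b : ℕ) (rules : List (Σ c, Rule c)) : Prog :=
  forLoop 5 0 (sweep b rules)

theorem exists_runs_reduce (hM : 10 ≤ M)
    (hr : ∀ r ∈ rules, r.2.Sound P C b ∧ (∃ j, j ∉ r.2.keep) ∧ 10 + r.1 ≤ M) :
    ∃ T, PolyBdd T ∧ ∀ (n k : ℕ) (a : Inst) (σ : State), Holds n k M a σ → a.S.card ≤ n →
      Runs (reduce b rules) σ (T n) fun τ => ∃ a', Holds n k M a' τ ∧ Stuck b rules a' ∧
        (C.mem a.graph ↔ C.mem a'.graph) ∧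
        ∀ k : ℤ, P.memInt a.graph (k - a.D) ↔ P.memInt a'.graph (k - a'.D) := by
  obtain ⟨T, hT, h⟩ := exists_runs_sweep rules (fun _ h => h) hr
  refine ⟨fun n => n * (T n + 2) + 2, PolyBdd.loop hT, fun n k a σ hσ hcard => ?_⟩
  -- Each sweep so far has deleted a vertex, unless no pattern occurs any more.
  let I : ℕ → State → Prop := fun i τ => τ.var 5 = i ∧ ∃ a', Holds n k M a' τ ∧
    (a'.S.card + i ≤ n ∨ Stuck b rules a') ∧ (C.mem a.graph ↔ C.mem a'.graph) ∧
    ∀ k : ℤ, P.memInt a.graph (k - a.D) ↔ P.memInt a'.graph (k - a'.D)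
  refine (Runs.forLoop (n := n) I ?_ ?_ ?_).mono le_rfl ?_
  · exact ⟨by simp [State.setVar_var], a, hσ.setVar (by omega) (by omega), Or.inl hcard, Iff.rfl,
      fun _ => Iff.rfl⟩
  · rintro i τ ⟨h1, a', h2, -⟩
    exact ⟨h1, h2.var_zero⟩
  · rintro i τ hi ⟨h1, a', h2, h3, h4, h5⟩
    refine (h n k a' τ h2).mono le_rfl ?_
    rintro ρ ⟨a'', h6, h7, h8⟩
    refine ⟨by rw [State.setVar_var, if_pos rfl, h7, h1], a'', h6.setVar (by omega) (by omega), ?_,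
      h4.trans h8.mem, fun k => (h5 k).trans (h8.memInt k)⟩
    rcases h8.cases with ⟨rfl, h9⟩ | ⟨h9, h10⟩
    · exact Or.inr h9
    · left
      have := h3.resolve_right h10
      omega
  · rintro τ ⟨-, a', h2, h3, h4⟩
    refine ⟨a', h2, ?_, h4⟩
    rcases h3 with h3 | h3
    · -- Without remaining vertices no pattern occurs, since a pattern has a vertex to be deleted.
      intro r hrr w hw
      obtain ⟨j, -⟩ := (hr r hrr).2.1
      have : a'.S = ∅ := Finset.card_eq_zero.1 (by omega)
      exact absurd (hw.mem j) (by simp [this])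
    · exact h3

end Loops

/-! ### Compaction of the vertex set -/

/-- Sets array `c` to the values of `e` at all positions below variable 6. -/
def fill (c : ℕ) (e : Expr) : Prog :=
  forLoop 7 6 (forLoop 8 6 (Prog.store c (Expr.var 7) (Expr.var 8) e))

theorem runs_fill {c m : ℕ} {e : Expr} {σ : State} {v : ℕ → ℕ → ℕ} (hm : σ.var 6 = m)
    (he : ∀ τ : State, (∀ c', c' ≠ c → τ.arr c' = σ.arr c') → e.eval τ = v (τ.var 7) (τ.var 8)) :
    Runs (fill c e) σ (m * (m * (1 + 2) + 2 + 2) + 2) fun τ =>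
      (∀ x, x ≠ 7 → x ≠ 8 → τ.var x = σ.var x) ∧ (∀ c', c' ≠ c → τ.arr c' = σ.arr c') ∧
        ∀ i j, i < m → j < m → τ.arr c i j = v i j := by
  let I : ℕ → State → Prop := fun i τ => τ.var 7 = i ∧
    (∀ x, x ≠ 7 → x ≠ 8 → τ.var x = σ.var x) ∧ (∀ c', c' ≠ c → τ.arr c' = σ.arr c') ∧
      ∀ i' j, i' < i → j < m → τ.arr c i' j = v i' j
  refine (Runs.forLoop (n := m) I ?_ ?_ ?_).mono le_rfl fun τ h => h.2
  · refine ⟨by simp [State.setVar_var], fun x h7 h8 => ?_, fun _ _ => rfl, by simp⟩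
    rw [State.setVar_var, if_neg h7]
  · rintro i τ ⟨h1, h2, -⟩
    exact ⟨h1, (h2 6 (by omega) (by omega)).trans hm⟩
  · rintro i τ hi ⟨h1, h2, h3, h4⟩
    let J : ℕ → State → Prop := fun j ρ => ρ.var 8 = j ∧ ρ.var 7 = i ∧
      (∀ x, x ≠ 7 → x ≠ 8 → ρ.var x = σ.var x) ∧ (∀ c', c' ≠ c → ρ.arr c' = σ.arr c') ∧
        ∀ i' j', j' < m → (i' < i ∨ (i' = i ∧ j' < j)) → ρ.arr c i' j' = v i' j'
    refine (Runs.forLoop (n := m) J ?_ ?_ ?_).mono le_rfl ?_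
    · refine ⟨by simp [State.setVar_var], ?_, fun x h7 h8 => ?_, h3, ?_⟩
      · rw [State.setVar_var, if_neg (by omega), h1]
      · rw [State.setVar_var, if_neg h8, h2 x h7 h8]
      · rintro i' j' hj' (h | ⟨-, h⟩)
        · exact h4 i' j' h hj'
        · exact absurd h (Nat.not_lt_zero _)
    · rintro j ρ ⟨h5, -, h6, -⟩
      exact ⟨h5, (h6 6 (by omega) (by omega)).trans hm⟩
    · rintro j ρ hj ⟨h5, h6, h7, h8, h9⟩
      refine Runs.store ⟨?_, ?_, fun x hx7 hx8 => ?_, fun c' hc' => ?_, fun i' j' hj' h => ?_⟩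
      · rw [State.setVar_var, if_pos rfl, State.setArr_var, h5]
      · rw [State.setVar_var, if_neg (by omega), State.setArr_var, h6]
      · rw [State.setVar_var, if_neg hx8, State.setArr_var, h7 x hx7 hx8]
      · rw [State.setVar_arr, ← h8 c' hc']
        ext x y
        rw [State.setArr_arr, if_neg fun h => hc' h.1]
      · rw [State.setVar_arr, State.setArr_arr, he ρ h8]
        simp only [Expr.eval, h5, h6, true_and]
        by_cases hij : i' = i ∧ j' = j
        · rw [if_pos hij, hij.1, hij.2]
        · rw [if_neg hij]
          exact h9 i' j' hj' (by omega)
    · rintro ρ ⟨-, h6, h7, h8, h9⟩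
      refine ⟨?_, fun x hx7 hx8 => ?_, h8, fun i' j hi' hj => h9 i' j hj (by omega)⟩
      · rw [State.setVar_var, if_pos rfl, h6]
      · rw [State.setVar_var, if_neg hx7, h7 x hx7 hx8]

/-- Lists the remaining vertices in array 2 and their number in variable 6. -/
def listVertices : Prog :=
  Prog.seq (Prog.assign 6 (Expr.const 0))
    (forLoop 3 0 (Prog.ite (Expr.arr 1 (Expr.var 3) (Expr.const 0)) Prog.skip
      (Prog.seq (Prog.store 2 (Expr.var 6) (Expr.const 0) (Expr.var 3))
        (Prog.assign 6 (Expr.add (Expr.var 6) (Expr.const 1))))))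

theorem runs_listVertices {n k M : ℕ} {a : Inst} {σ : State} (h : Holds n k M a σ) :
    Runs listVertices σ (1 + (n * (3 + 2) + 2)) fun τ =>
      (∀ x, x ≠ 3 → x ≠ 6 → τ.var x = σ.var x) ∧ (∀ c, c ≠ 2 → τ.arr c = σ.arr c) ∧
      (∀ i j, i < τ.var 6 → j < τ.var 6 → τ.arr 2 i 0 = τ.arr 2 j 0 → i = j) ∧
      ∀ x, x ∈ a.S ↔ ∃ i, i < τ.var 6 ∧ τ.arr 2 i 0 = x := by
  refine Runs.seq (Q := fun τ => τ = σ.setVar 6 0) (Runs.assign rfl) ?_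
  rintro _ rfl
  let I : ℕ → State → Prop := fun i τ => τ.var 3 = i ∧
      (∀ x, x ≠ 3 → x ≠ 6 → τ.var x = σ.var x) ∧ (∀ c, c ≠ 2 → τ.arr c = σ.arr c) ∧
      (∀ i j, i < τ.var 6 → j < τ.var 6 → τ.arr 2 i 0 = τ.arr 2 j 0 → i = j) ∧
      ∀ x, (x ∈ a.S ∧ x < i) ↔ ∃ i, i < τ.var 6 ∧ τ.arr 2 i 0 = x
  refine (Runs.forLoop (n := n) I ?_ ?_ ?_).mono le_rfl ?_
  · refine ⟨by simp [State.setVar_var], fun x h3 h6 => ?_, fun _ _ => rfl, ?_, ?_⟩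
    · simp [State.setVar_var, h3, h6]
    · simp [State.setVar_var]
    · simp [State.setVar_var]
  · rintro i τ ⟨h1, h2, -⟩
    exact ⟨h1, (h2 0 (by omega) (by omega)).trans h.var_zero⟩
  · rintro i τ hi ⟨h1, h2, h3, h4, h5⟩
    have hdead : (Expr.arr 1 (Expr.var 3) (Expr.const 0)).eval τ = 0 ↔ i ∈ a.S := by
      simp only [Expr.eval, h1, h3 1 (by omega)]
      exact h.alive i hi
    refine Runs.ite (T := 2) (fun he => ?_) (fun he => ?_)
    · refine Runs.mono (T := 1) (Runs.skip ⟨?_, fun x hx3 hx6 => ?_, h3, ?_, fun x => ?_⟩)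
        (by omega) fun _ h => h
      · rw [State.setVar_var, if_pos rfl, h1]
      · rw [State.setVar_var, if_neg hx3, h2 x hx3 hx6]
      · rw [State.setVar_var, if_neg (by omega)]
        exact h4
      · rw [State.setVar_var, if_neg (by omega), State.setVar_arr, ← h5 x]
        refine and_congr_right fun hx => ⟨fun hlt => ?_, fun hlt => by omega⟩
        refine lt_of_le_of_ne (by omega) ?_
        rintro rfl
        exact he (hdead.2 hx)
    · have hiS := hdead.1 he
      refine Runs.seq (T := 1) (T' := 1) (Runs.store rfl) fun ρ hρ => Runs.assign ?_
      have hρ' : ρ = τ.setArr 2 (τ.var 6) 0 i := by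
        rw [← h1]
        exact hρ.symm
      subst hρ'
      have hold : ∀ j, j < τ.var 6 → (τ.setArr 2 (τ.var 6) 0 i).arr 2 j 0 = τ.arr 2 j 0 := by
        intro j hj
        rw [State.setArr_arr, if_neg (by omega)]
      have hnew : (τ.setArr 2 (τ.var 6) 0 i).arr 2 (τ.var 6) 0 = i := by
        rw [State.setArr_arr, if_pos ⟨rfl, rfl, rfl⟩]
      have hlt : ∀ j, j < τ.var 6 → τ.arr 2 j 0 < i := fun j hj =>
        ((h5 (τ.arr 2 j 0)).2 ⟨j, hj, rfl⟩).2
      refine ⟨?_, fun x hx3 hx6 => ?_, fun c hc => ?_, ?_, fun x => ?_⟩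
      · simp [State.setVar_var, State.setArr_var, h1]
      · rw [State.setVar_var, if_neg hx3, State.setVar_var, if_neg hx6, State.setArr_var,
          h2 x hx3 hx6]
      · rw [State.setVar_arr, State.setVar_arr, ← h3 c hc]
        ext x y
        rw [State.setArr_arr, if_neg fun h => hc h.1]
      · simp only [State.setVar_var, State.setVar_arr, Expr.eval, State.setArr_var]
        rw [if_neg (by omega), if_pos trivial]
        intro j j' hj hj' heq
        rcases Nat.lt_succ_iff_lt_or_eq.1 hj with hj | rfl <;>
          rcases Nat.lt_succ_iff_lt_or_eq.1 hj' with hj' | rfl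
        · rw [hold j hj, hold j' hj'] at heq
          exact h4 j j' hj hj' heq
        · rw [hold j hj, hnew] at heq
          exact absurd (hlt j hj) (by omega)
        · rw [hold j' hj', hnew] at heq
          exact absurd (hlt j' hj') (by omega)
        · rfl
      · simp only [State.setVar_var, State.setVar_arr, Expr.eval, State.setArr_var]
        rw [if_neg (by omega), if_pos trivial]
        constructor
        · rintro ⟨hx, hxi⟩
          rcases Nat.lt_succ_iff_lt_or_eq.1 hxi with hxi | rfl
          · obtain ⟨j, hj, hjx⟩ := (h5 x).1 ⟨hx, hxi⟩
            exact ⟨j, by omega, (hold j hj).trans hjx⟩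
          · exact ⟨τ.var 6, by omega, hnew⟩
        · rintro ⟨j, hj, hjx⟩
          rcases Nat.lt_succ_iff_lt_or_eq.1 hj with hj | rfl
          · rw [hold j hj] at hjx
            obtain ⟨h6, h7⟩ := (h5 x).2 ⟨j, hj, hjx⟩
            exact ⟨h6, by omega⟩
          · rw [hnew] at hjx
            subst hjx
            exact ⟨hiS, by omega⟩
  · rintro τ ⟨-, h2, h3, h4, h5⟩
    refine ⟨h2, h3, h4, fun x => ?_⟩
    rw [← h5 x]
    exact ⟨fun hx => ⟨hx, h.lt x hx⟩, fun hx => hx.1⟩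

/-- Writes the graph of the instance into array 0, with the vertices `0, …, m - 1`, where `m` is
its order, which is put into variable 6.  The new matrix is prepared in array 3, since array 0 is
still being read. -/
def compact : Prog :=
  Prog.seq listVertices
    (Prog.seq (fill 3 (Expr.arr 0 (Expr.arr 2 (Expr.var 7) (Expr.const 0))
        (Expr.arr 2 (Expr.var 8) (Expr.const 0))))
      (fill 0 (Expr.arr 3 (Expr.var 7) (Expr.var 8))))

theorem exists_runs_compact (M : ℕ) (hM : 10 ≤ M) :
    ∃ T, PolyBdd T ∧ ∀ (n k : ℕ) (a : Inst) (σ : State), Holds n k M a σ → a.S.card ≤ n →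
      Runs compact σ (T n) fun τ => ∃ (m : ℕ) (G : SimpleGraph (Fin m)),
        m ≤ n ∧ Nonempty (G ≃g a.graph) ∧ τ.var 6 = m ∧ τ.var 1 = k ∧ τ.var 4 = a.D ∧
        (∀ u v : Fin m, G.Adj u v ↔ τ.arr 0 u v = 1) ∧ (∀ x, M ≤ x → τ.var x = 0) ∧
        ∀ b i j, 4 ≤ b → τ.arr b i j = 0 := by
  refine ⟨fun n => 1 + (n * (3 + 2) + 2) + (n * (n * (1 + 2) + 2 + 2) + 2 +
    (n * (n * (1 + 2) + 2 + 2) + 2)), ?_, fun n k a σ h hcard => ?_⟩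
  · have h1 : PolyBdd fun n => n * (n * (1 + 2) + 2 + 2) + 2 :=
      PolyBdd.loop (PolyBdd.loop (PolyBdd.const 1))
    exact ((PolyBdd.const 1).add (PolyBdd.loop (PolyBdd.const 3))).add (h1.add h1)
  refine Runs.seq (runs_listVertices h) ?_
  rintro τ ⟨h1, h2, h3, h4⟩
  set m := τ.var 6 with hm
  let pos : Fin m → (a.S : Set ℕ) := fun i => ⟨τ.arr 2 i 0, (h4 _).2 ⟨i, i.2, rfl⟩⟩
  have hpos : Function.Bijective pos :=
    ⟨fun i j hij => Fin.ext (h3 i j i.2 j.2 (congrArg Subtype.val hij)), fun x => by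
      obtain ⟨i, hi, hix⟩ := (h4 x.1).1 x.2
      exact ⟨⟨i, hi⟩, Subtype.ext hix⟩⟩
  have hmn : m ≤ n := by
    have := Nat.card_congr (Equiv.ofBijective pos hpos)
    rw [Nat.card_fin, Nat.card_coe_set_eq, Set.ncard_coe_finset] at this
    omega
  have hT : m * (m * (1 + 2) + 2 + 2) + 2 ≤ n * (n * (1 + 2) + 2 + 2) + 2 := by gcongr
  refine Runs.seq (T := n * (n * (1 + 2) + 2 + 2) + 2) (T' := n * (n * (1 + 2) + 2 + 2) + 2)
    ((runs_fill (m := m) (v := fun i j => σ.arr 0 (τ.arr 2 i 0) (τ.arr 2 j 0)) hm.symm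
    fun ρ hρ => ?_).mono hT fun _ h => h) ?_
  · simp only [Expr.eval, hρ 0 (by omega), hρ 2 (by omega), h2 0 (by omega)]
  rintro ρ ⟨h5, h6, h7⟩
  refine (runs_fill (m := m) (v := fun i j => ρ.arr 3 i j)
    ((h5 6 (by omega) (by omega)).trans hm.symm) fun ρ' hρ' => ?_).mono hT ?_
  · simp only [Expr.eval, hρ' 3 (by omega)]
  rintro ρ' ⟨h8, h9, h10⟩
  have hvar : ∀ x, x ≠ 3 → x ≠ 6 → x ≠ 7 → x ≠ 8 → ρ'.var x = σ.var x := fun x hx3 hx6 hx7 hx8 =>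
    ((h8 x hx7 hx8).trans (h5 x hx7 hx8)).trans (h1 x hx3 hx6)
  refine ⟨m, a.graph.comap pos, hmn, ⟨⟨Equiv.ofBijective pos hpos, Iff.rfl⟩⟩, ?_, ?_, ?_,
    fun u v => ?_, fun x hx => ?_, fun b i j hb => ?_⟩
  · rw [h8 6 (by omega) (by omega), h5 6 (by omega) (by omega)]
  · rw [hvar 1 (by omega) (by omega) (by omega) (by omega), h.var_one]
  · rw [hvar 4 (by omega) (by omega) (by omega) (by omega), h.var_four]
  · rw [h10 u v u.2 v.2, h7 u v u.2 v.2]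
    change a.E.Adj (τ.arr 2 u 0) (τ.arr 2 v 0) ↔ _
    constructor
    · exact fun hadj => h.adj _ _ hadj
    · intro h1
      by_contra hn
      rw [h.not_adj _ _ hn] at h1
      omega
  · rw [hvar x (by omega) (by omega) (by omega) (by omega), h.fresh_var x hx]
  · rw [h9 b (by omega), h6 b (by omega), h2 b (by omega), h.fresh_arr b i j hb]

end Ram

/-! ### The kernelization -/

namespace Ram

/-- Outputs the complete graph on `ω` vertices. -/
noncomputable def outputClique (ω : ℕ) : Prog :=
  Prog.seq (progList ((Finset.univ : Finset (Fin ω × Fin ω)).toList.map fun p =>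
      Prog.store 0 (Expr.const p.1) (Expr.const p.2) (Expr.const (if p.1 = p.2 then 0 else 1))))
    (Prog.assign 0 (Expr.const ω))

theorem exists_runs_outputClique (ω : ℕ) : ∃ T, ∀ σ : State,
    Runs (outputClique ω) σ T fun τ => IsOutput τ (⊤ : SimpleGraph (Fin ω)) (σ.var 1) := by
  refine ⟨((Finset.univ : Finset (Fin ω × Fin ω)).toList.length + 1) + 1, fun σ => ?_⟩
  refine Runs.seq (runs_stores (ι := Fin ω × Fin ω) _ 0 (fun p => Expr.const p.1)
    (fun p => Expr.const p.2) (fun p => if p.1 = p.2 then 0 else 1) (fun p => p.1) (fun p => p.2) σ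
    (fun _ _ _ _ => rfl) (fun _ _ _ _ => rfl)) fun τ hτ => Runs.assign ?_
  obtain ⟨h1, -, h2⟩ := hτ
  refine ⟨by simp [State.setVar_var, Expr.eval], ?_, fun u v => ?_⟩
  · rw [State.setVar_var, if_neg (by omega), h1]
  · rw [State.setVar_arr, SimpleGraph.top_adj]
    rcases h2 u v with ⟨⟨i, j⟩, -, hi, hj, hval⟩ | ⟨hno, -⟩
    · have hi' : i = u := Fin.ext hi
      have hj' : j = v := Fin.ext hj
      rw [hval, hi', hj']
      by_cases huv : u = v <;> simp [huv]
    · exact absurd rfl (hno (u, v) (by simp) rfl)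

/-- Decreases the parameter by variable 4 and runs the program `p`, which decides whether the order
of the graph is small enough.  If the parameter would become negative, or if the graph is too large,
the output is the complete graph on `ω` vertices.  The first condition is the truncated difference
of the two variables. -/
noncomputable def finish (M ω : ℕ) (p : Prog) : Prog :=
  Prog.ite (Expr.sub (Expr.var 4) (Expr.var 1)) (outputClique ω)
    (Prog.seq (Prog.assign 1 (Expr.sub (Expr.var 1) (Expr.var 4)))
      (Prog.seq (Prog.assign M (Expr.var 6))
        (Prog.seq (Prog.assign (M + 1) (Expr.var 1))
          (Prog.seq (p.shift M 4)
            (Prog.ite (Expr.var M) (Prog.assign 0 (Expr.var 6)) (outputClique ω))))))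

theorem exists_runs_finish {r : ℕ → ℕ → Prop} {p : Prog} {q : Polynomial ℕ}
    (hp : ∀ n k : ℕ, ∃ (T : ℕ) (σ : State), Exec p (inputPair n k) T σ ∧
      T ≤ q.eval (n + k) ∧ (σ.var 0 ≠ 0 ↔ r n k)) (M ω : ℕ) (hM : 10 ≤ M) :
    ∃ T, PolyBdd T ∧ ∀ (N k m D : ℕ) (G : SimpleGraph (Fin m)) (σ : State), m + k ≤ N →
      σ.var 6 = m → σ.var 1 = k → σ.var 4 = D → (∀ u v : Fin m, G.Adj u v ↔ σ.arr 0 u v = 1) →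
      (∀ x, M ≤ x → σ.var x = 0) → (∀ b i j, 4 ≤ b → σ.arr b i j = 0) →
      Runs (finish M ω p) σ (T N) fun τ =>
        (D ≤ k ∧ r m (k - D) ∧ IsOutput τ G (k - D)) ∨
          (¬ (D ≤ k ∧ r m (k - D)) ∧ ∃ k', k' ≤ k ∧ IsOutput τ (⊤ : SimpleGraph (Fin ω)) k') := by
  obtain ⟨T, hT⟩ := exists_runs_outputClique ω
  refine ⟨fun N => 1 + (1 + (1 + (q.eval N + (T + 1 + 1)))) + 1, ?_, ?_⟩
  · exact ((PolyBdd.const 1).add ((PolyBdd.const 1).add ((PolyBdd.const 1).add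
      (PolyBdd.add ⟨q, fun _ => le_rfl⟩ (PolyBdd.const (T + 1 + 1)))))).add (PolyBdd.const 1)
  intro N k m D G σ hN h6 h1 h4 hG hvar harr
  refine Runs.ite (fun he => ?_) (fun he => ?_)
  · simp only [Expr.eval, h1, h4] at he
    refine (hT σ).mono (by omega) fun τ hτ => Or.inr ⟨fun h => ?_, k, le_rfl, ?_⟩
    · exact he (Nat.sub_eq_zero_of_le h.1)
    · rwa [h1] at hτ
  · simp only [Expr.eval, h1, h4] at he
    have hD : D ≤ k := Nat.le_of_sub_eq_zero he
    refine Runs.seq (Runs.assign (Q := fun τ => τ = σ.setVar 1 (k - D)) ?_) ?_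
    · simp only [Expr.eval, h1, h4]
    rintro _ rfl
    refine Runs.seq (Runs.assign (Q := fun τ => τ = (σ.setVar 1 (k - D)).setVar M m) ?_) ?_
    · simp only [Expr.eval, State.setVar_var, h6]
      rw [if_neg (by omega)]
    rintro _ rfl
    refine Runs.seq (Runs.assign (Q := fun τ =>
      τ = ((σ.setVar 1 (k - D)).setVar M m).setVar (M + 1) (k - D)) ?_) ?_
    · simp only [Expr.eval, State.setVar_var]
      rw [if_neg (by omega), if_pos trivial]
    rintro _ rfl
    set σ' := ((σ.setVar 1 (k - D)).setVar M m).setVar (M + 1) (k - D) with hσ'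
    have hσ'arr : σ'.arr = σ.arr := rfl
    have hσ'6 : σ'.var 6 = m := by
      rw [hσ', State.setVar_var, if_neg (by omega), State.setVar_var, if_neg (by omega),
        State.setVar_var, if_neg (by omega), h6]
    have hσ'1 : σ'.var 1 = k - D := by
      rw [hσ', State.setVar_var, if_neg (by omega), State.setVar_var, if_neg (by omega),
        State.setVar_var, if_pos rfl]
    have hshift : Shifted M 4 (inputPair m (k - D)) σ' := by
      refine ⟨fun x => ?_, fun b i j => harr _ i j (by omega)⟩
      rw [hσ', State.setVar_var, State.setVar_var, State.setVar_var, hvar _ (by omega)]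
      simp only [inputPair]
      by_cases hx0 : x = 0
      · subst hx0
        rw [if_neg (by omega), if_pos (by omega), if_pos rfl]
      by_cases hx1 : x = 1
      · subst hx1
        rw [if_pos (by omega), if_neg (by omega), if_pos rfl]
      · rw [if_neg (by omega), if_neg (by omega), if_neg (by omega), if_neg (by omega),
          if_neg (by omega)]
    obtain ⟨n, ρ, hexec, hn, hr⟩ := hp m (k - D)
    obtain ⟨ρ', hexec', hshift', hlow⟩ := hexec.shift σ' hshift
    have hρ6 : ρ'.var 6 = m := (hlow.1 6 (by omega)).trans hσ'6
    have hρ1 : ρ'.var 1 = k - D := (hlow.1 1 (by omega)).trans hσ'1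
    have hρM : ρ'.var M = ρ.var 0 := hshift'.1 0
    refine Runs.seq (T := q.eval N) (Q := fun τ => τ = ρ')
      ⟨n, ρ', hexec', hn.trans (eval_le_eval q (by omega)), rfl⟩ ?_
    intro τ' hτ'
    rw [hτ']
    refine Runs.ite (T := T + 1) (fun he => ?_) (fun he => ?_)
    · simp only [Expr.eval, hρM] at he
      refine Runs.mono (T := 1) (Runs.assign (Or.inl ⟨hD, hr.1 he, ?_, ?_, fun u v => ?_⟩))
        (by omega) fun _ h => h
      · rw [State.setVar_var, if_pos rfl]
        exact hρ6
      · rw [State.setVar_var, if_neg (by omega), hρ1]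
      · rw [State.setVar_arr, hlow.2 0 (by omega), hσ'arr]
        exact hG u v
    · simp only [Expr.eval, hρM] at he
      refine (hT ρ').mono (by omega) fun τ hτ => Or.inr ⟨fun h => ?_, k - D, Nat.sub_le _ _, ?_⟩
      · exact hr.2 h.2 he
      · rwa [hρ1] at hτ

theorem holds_inputInstance {n : ℕ} (G : SimpleGraph (Fin n)) (k M : ℕ) (hM : 10 ≤ M) :
    Holds n k M ⟨G.map Fin.valEmbedding, Finset.range n, 0⟩ (inputInstance G k) where
  var_zero := rfl
  var_one := rfl
  var_four := rfl
  adj i j h := by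
    rw [SimpleGraph.map_adj] at h
    obtain ⟨u, v, h, hu, hv⟩ := h
    exact if_pos ⟨rfl, u, v, hu, hv, h⟩
  not_adj i j h := by
    refine if_neg ?_
    rintro ⟨-, u, v, hu, hv, h'⟩
    exact h ((SimpleGraph.map_adj _ _ _ _).2 ⟨u, v, h', hu, hv⟩)
  alive i hi := by simp [inputInstance, hi]
  lt i hi := Finset.mem_range.1 hi
  fresh_var x hx := by
    change (if x = 0 then n else if x = 1 then k else 0) = 0
    rw [if_neg (by omega), if_neg (by omega)]
  fresh_arr b i j hb := by
    refine if_neg ?_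
    rintro ⟨h, -⟩
    omega

theorem nonempty_iso_map_val {n : ℕ} (G : SimpleGraph (Fin n)) :
    Nonempty (G ≃g Inst.graph ⟨G.map Fin.valEmbedding, Finset.range n, 0⟩) := by
  refine ⟨⟨⟨fun i => ⟨i.1, Finset.mem_coe.2 (Finset.mem_range.2 i.2)⟩,
    fun x => ⟨x.1, Finset.mem_range.1 (Finset.mem_coe.1 x.2)⟩, fun _ => rfl, fun _ => rfl⟩, ?_⟩⟩
  intro u v
  change (G.map Fin.valEmbedding).Adj (Fin.valEmbedding u) (Fin.valEmbedding v) ↔ _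
  rw [SimpleGraph.map_adj_apply]

end Ram

/-- A finite list of sound rules with a rule for each pattern of the class of the relevant sizes. -/
theorem IsRepresentativeFamily.exists_rules {P : GraphProblem} {C : GraphClass}
    {R : ∀ b : ℕ, Set (BoundariedGraph b)} (hR : IsRepresentativeFamily P C R) (b N : ℕ) :
    ∃ rules : List (Σ c, Rule c),
      (∀ r ∈ rules, r.2.Sound P C b ∧ (∃ j, j ∉ r.2.keep) ∧ r.1 ≤ N) ∧
      ∀ c, protLimit R b < c → c ≤ N → ∀ H : SimpleGraph (Fin c), C.mem H →
        ∃ r : Rule c, ⟨c, r⟩ ∈ rules ∧ r.pat = H := by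
  classical
  let ι := Σ c : Fin (N + 1), {H : SimpleGraph (Fin c) // protLimit R b < c ∧ C.mem H}
  have : Fintype ι := Fintype.ofFinite ι
  have hex : ∀ x : ι, ∃ r : Rule x.1, r.pat = x.2.1 ∧ r.Sound P C b ∧ ∃ j, j ∉ r.keep :=
    fun x => hR.exists_rule x.2.2.1 x.2.1 x.2.2.2
  choose f hf1 hf2 hf3 using hex
  refine ⟨(Finset.univ : Finset ι).toList.map fun x => ⟨x.1, f x⟩, ?_, ?_⟩
  · intro r hr
    obtain ⟨x, -, rfl⟩ := List.mem_map.1 hr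
    exact ⟨hf2 x, hf3 x, Nat.lt_succ_iff.1 x.1.2⟩
  · intro c hc hcN H hH
    let x : ι := ⟨⟨c, Nat.lt_succ_of_le hcN⟩, H, hc, hH⟩
    exact ⟨f x, List.mem_map.2 ⟨x, by simp, rfl⟩, hf1 x⟩

open Ram in
/-- If reduced instances of the problem are small, then applying the replacement rules exhaustively
yields a kernel.  The complete graph on `ω` vertices serves as a trivial no-instance. -/
theorem IsRepresentativeFamily.hasKernelOfSize {P : GraphProblem} {C : GraphClass}
    (hC : C.SubgraphClosed) {R : ∀ b : ℕ, Set (BoundariedGraph b)}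
    (hR : IsRepresentativeFamily P C R) {β ω : ℕ} {g : ℕ → ℕ} (hg : Monotone g)
    (hdec : PolyTimeDecidable fun n k => n ≤ g k)
    (hsmall : ∀ {V : Type} [Finite V] (G : SimpleGraph V) (k : ℕ), C.mem G → P.mem G k →
      ProtrusionReduced R β G → Nat.card V ≤ g k)
    (hω : ∀ k, ω ≤ g k) (hclique : ¬ C.mem (⊤ : SimpleGraph (Fin ω))) :
    HasKernelOfSize P C g := by
  obtain ⟨rules, hrules, hall⟩ := hR.exists_rules (2 * β) (2 * protLimit' R β)
  obtain ⟨p, q, hp⟩ := hdec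
  let M := 10 + 2 * protLimit' R β
  have hM : 10 ≤ M := Nat.le_add_right _ _
  obtain ⟨T₁, ⟨q₁, hq₁⟩, h₁⟩ := exists_runs_reduce (P := P) (C := C) (b := 2 * β) hM
    fun r hr => ⟨(hrules r hr).1, (hrules r hr).2.1, Nat.add_le_add_left (hrules r hr).2.2 10⟩
  obtain ⟨T₂, ⟨q₂, hq₂⟩, h₂⟩ := exists_runs_compact M hM
  obtain ⟨T₃, ⟨q₃, hq₃⟩, h₃⟩ := exists_runs_finish hp M ω hM
  refine ⟨Prog.seq (reduce (2 * β) rules) (Prog.seq compact (finish M ω p)), q₁ + (q₂ + q₃), ?_⟩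
  intro n G k hG
  obtain ⟨e⟩ := nonempty_iso_map_val G
  have hruns : Runs (Prog.seq (reduce (2 * β) rules) (Prog.seq compact (finish M ω p)))
      (inputInstance G k) ((q₁ + (q₂ + q₃)).eval (n + k)) fun τ =>
        ∃ (n' : ℕ) (G' : SimpleGraph (Fin n')) (k' : ℕ), IsOutput τ G' k' ∧
          ((P.restrict C).mem G k ↔ (P.restrict C).mem G' k') ∧ n' ≤ g k ∧ k' ≤ k := by
    rw [Polynomial.eval_add, Polynomial.eval_add]
    refine Runs.seq ((h₁ n k _ _ (holds_inputInstance G k M hM) (by simp)).mono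
      ((hq₁ n).trans (eval_le_eval q₁ (Nat.le_add_right _ _))) fun _ h => h) ?_
    rintro σ₁ ⟨a, ha, hstuck, hmem, hmemInt⟩
    have hcard : a.S.card ≤ n := by
      have hsub : a.S ⊆ Finset.range n := fun x hx => Finset.mem_range.2 (ha.lt x hx)
      simpa using Finset.card_le_card hsub
    refine Runs.seq ((h₂ n k a σ₁ ha hcard).mono
      ((hq₂ n).trans (eval_le_eval q₂ (Nat.le_add_right _ _))) fun _ h => h) ?_
    rintro σ₂ ⟨m, G', hmn, ⟨e'⟩, h6, hv1, h4, hadj, hvar, harr⟩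
    have haC : C.mem a.graph := hmem.1 (C.mem_of_iso e hG)
    have hred : ProtrusionReduced R β a.graph := by
      refine protrusionReduced_of_not_occursAt hC haC fun c hc1 hc2 H hH w hw => ?_
      obtain ⟨r, hr, rfl⟩ := hall c hc1 hc2 H hH
      exact hstuck _ hr w hw
    have hPG : P.mem G k ↔ P.memInt a.graph ((k : ℤ) - a.D) := by
      rw [← hmemInt k]
      simp only [Nat.cast_zero, sub_zero]
      rw [← memInt_iso e]
      exact ⟨fun h => ⟨k, rfl, h⟩, fun ⟨m, hm, h⟩ => by rwa [← Nat.cast_inj.1 hm]⟩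
    have hPG' : a.D ≤ k → (P.memInt a.graph ((k : ℤ) - a.D) ↔ P.mem G' (k - a.D)) := by
      intro hD
      rw [← memInt_iso e']
      constructor
      · rintro ⟨m, hm, h⟩
        have : m = k - a.D := by omega
        rwa [← this]
      · exact fun h => ⟨k - a.D, by omega, h⟩
    refine (h₃ (n + k) k m a.D G' σ₂ (by omega) h6 hv1 h4 hadj hvar harr).mono
      (hq₃ (n + k)) ?_
    rintro τ (⟨hD, hle, hout⟩ | ⟨hno, k', hk', hout⟩)
    · refine ⟨m, G', k - a.D, hout, ?_, hle.trans (hg (Nat.sub_le _ _)), Nat.sub_le _ _⟩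
      exact ⟨fun h => ⟨C.mem_of_iso e'.symm haC, (hPG' hD).1 (hPG.1 h.2)⟩,
        fun h => ⟨hG, hPG.2 ((hPG' hD).2 h.2)⟩⟩
    · -- The instance is a no-instance, since it would be small otherwise.
      refine ⟨ω, ⊤, k', hout, ⟨fun h => absurd ?_ hno, fun h => absurd h.1 hclique⟩, hω k, hk'⟩
      obtain ⟨j, hj, hmemj⟩ := hPG.1 h.2
      have hle := hsmall _ _ haC hmemj hred
      rw [← Nat.card_congr e'.toEquiv, Nat.card_fin] at hle
      have hjk : j = k - a.D := by omega
      exact ⟨by omega, hjk ▸ hle⟩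
  obtain ⟨T, τ, h1, h2, n', G', k', h3, h4, h5, h6⟩ := hruns
  exact ⟨T, τ, n', G', k', h1, h2, h3, h4, h5, h6⟩

/-- The complete graph with as many vertices as the bound on cliques of `ℋ` is not in `𝒢`. -/
theorem DConstrictsInto.not_mem_top {𝒢 ℋ : GraphClass} {d ω : ℕ} (hd : DConstrictsInto d 𝒢 ℋ)
    (hω : ∀ {W : Type} [Finite W] (H : SimpleGraph W), ℋ.mem H → H.cliqueNum < ω) :
    ¬ 𝒢.mem (⊤ : SimpleGraph (Fin ω)) := by
  intro h
  have h1 := hω _ (hd.mem_augment (Y := Set.univ) (L := []) h (by simp))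
  have h2 : (Set.univ : Set (Fin ω)).ncard ≤ _ :=
    ncard_clique_le (H := augment (⊤ : SimpleGraph (Fin ω)) ([] : List (Link ⊤ Set.univ d)))
      (Y := Set.univ) subset_rfl fun x _ y _ hxy => augment_adj.2 (Or.inl hxy)
  rw [Set.ncard_univ, Nat.card_fin] at h2
  omega

theorem mainTheorem3
    (𝒢 ℋ : GraphClass) (h𝒢 : 𝒢.SubgraphClosed) (hℋ : ℋ.SubgraphClosed)
    (fE fK : ℕ → ℕ) (ω : ℕ)
    (hE : ∀ {W : Type} [Finite W] (H : SimpleGraph W), ℋ.mem H →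
      H.edgeSet.ncard ≤ fE (Nat.card W))
    (hK : ∀ {W : Type} [Finite W] (H : SimpleGraph W), ℋ.mem H →
      numCliques H ≤ fK (Nat.card W))
    (hω : ∀ {W : Type} [Finite W] (H : SimpleGraph W), ℋ.mem H → H.cliqueNum < ω)
    (P : GraphProblem) (hFII : HasFII P 𝒢)
    (s : ℕ → ℕ) (t : ℕ) (hst : TreewidthBounding P 𝒢 s t) :
    (∃ R : ∀ b : ℕ, Set (BoundariedGraph b), IsRepresentativeFamily P 𝒢 R) ∧
    ∀ R : ∀ b : ℕ, Set (BoundariedGraph b), IsRepresentativeFamily P 𝒢 R →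
      ∀ d : ℕ, 2 * protLimit' R (2 * t + ω) + 2 ≤ d → DConstrictsInto d 𝒢 ℋ →
        (∀ {V : Type} [Finite V] (G : SimpleGraph V) (k : ℕ),
          𝒢.mem G → P.mem G k → ProtrusionReduced R (2 * t + ω) G →
          ∃ (l : ℕ) (Y : Fin (l + 1) → Set V),
            IsProtrusionDecomposition G (max l (Y 0).ncard) (2 * t + ω) l Y ∧
            (Y 0).ncard ≤ sepBound s fE t k ∧
            (∀ i, i ≠ 0 → (Y i).ncard ≤ protLimit' R (2 * t + ω)) ∧
            l ≤ fK (sepBound s fE t k) + sepBound s fE t k + 1) ∧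
        (Monotone (kernelBound s fE fK t (protLimit' R (2 * t + ω))) →
          PolyTimeDecidable
            (fun n k => n ≤ kernelBound s fE fK t (protLimit' R (2 * t + ω)) k) →
          HasKernelOfSize P 𝒢 (kernelBound s fE fK t (protLimit' R (2 * t + ω))))
        := by
  refine ⟨hFII.exists_isRepresentativeFamily, fun R hR d hd hcon => ?_⟩
  have hQ : 2 * (2 * t + ω) ≤ protLimit' R (2 * t + ω) := le_max_left _ _
  have hpart : ∀ {V : Type} [Finite V] (G : SimpleGraph V) (k : ℕ),
      𝒢.mem G → P.mem G k → ProtrusionReduced R (2 * t + ω) G →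
      ∃ (l : ℕ) (Y : Fin (l + 1) → Set V),
        IsProtrusionDecomposition G (max l (Y 0).ncard) (2 * t + ω) l Y ∧
        (Y 0).ncard ≤ sepBound s fE t k ∧
        (∀ i, i ≠ 0 → (Y i).ncard ≤ protLimit' R (2 * t + ω)) ∧
        l ≤ fK (sepBound s fE t k) + sepBound s fE t k + 1 := by
    intro V _ G k hG hP hred
    obtain ⟨l, Y, h1, h2, h3, h4⟩ := exists_protrusionDecomposition (d := d) hE hK hω (by omega)
      hQ hcon hG (hst G k hG hP)
      fun W hW => not_lt.1 fun hlt => hred ⟨W, hW, hlt⟩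
    exact ⟨l, Y, h1, h2, h3, by omega⟩
  refine ⟨hpart, fun hmono hdec => hR.hasKernelOfSize (β := 2 * t + ω) (ω := ω) h𝒢
    hmono hdec ?_ ?_ (hcon.not_mem_top hω)⟩
  · intro V _ G k hG hP hred
    obtain ⟨l, Y, h1, h2, h3, h4⟩ := hpart G k hG hP hred
    exact (h1.card_le_add_mul h3).trans (Nat.add_le_add h2 (Nat.mul_le_mul_right _ h4))
  · -- The bound is at least `protLimit' R (2 * t + ω)`, because of the summand `1`.
    intro k
    rw [kernelBound, Nat.add_mul _ 1, one_mul]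
    omega
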